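/- Let $V\in L^1((0,\infty);dx)$ be complex-valued, and write $u=\exp(i\arg V)|V|^{1/2}$, $v=|V|^{1/2}$, so that $V=uv$. In $L^2((0,\infty);dx)$ let $H_+^D$ and $H_+^N$ act as $g\mapsto -g''+Vg$ on those $g\in L^2((0,\infty);dx)$ for which $g,g'$ are absolutely continuous on $[0,R]$ for all $R>0$, $-g''+Vg\in L^2((0,\infty);dx)$, and $g(0)=0$ (for $H_+^D$), respectively $g'(0)=0$ (for $H_+^N$); let $H_{0,+}^D$, $H_{0,+}^N$ be these operators for $V=0$. $M_w$ denotes the maximally defined operator of multiplication by $w$, products of operators have their natural domains, and a bar denotes the closure. Let $\gamma_D g=g(0)$ for $g\in C([0,\infty))$ and $\gamma_N g=-g'(0)$ for $g\in C^1([0,\infty))$. Let $z\in\mathbb C\setminus\sigma(H_+^D)$ with $\operatorname{Im} z^{1/2}>0$, where $z^{1/2}$ is the branch of the square root with $\operatorname{Im} z^{1/2}\ge 0$. With $g(x,x')=z^{-1/2}\sin(z^{1/2}(x-x'))$, let $f_+(z,\cdot)$, $\phi_+^D(z,\cdot)$, $\theta_+^D(z,\cdot)$ be the continuous solutions on $[0,\infty)$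 of $$f_+(z,x)=e^{iz^{1/2}x}-\int_x^\infty g(x,x')V(x')f_+(z,x')\,dx',$$ $$\phi_+^D(z,x)=\frac{\sin(z^{1/2}x)}{z^{1/2}}+\int_0^x g(x,x')V(x')\phi_+^D(z,x')\,dx',$$ $$\theta_+^D(z,x)=\cos(z^{1/2}x)+\int_0^x g(x,x')V(x')\theta_+^D(z,x')\,dx',$$ and put $\phi_+^N=-\theta_+^D$, $W(f,g)=fg'-f'g$, and $$m_{0,+}^D(z)=iz^{1/2},\quad m_{0,+}^N(z)=-\frac1{m_{0,+}^D(z)},\quad m_+^D(z)=\frac{f_+'(z,0)}{f_+(z,0)},\quad m_+^N(z)=-\frac{f_+(z,0)}{f_+'(z,0)}.$$ Then these solutions exist, $z$ lies in the resolvent sets of $H_{0,+}^D$ and $H_{0,+}^N$, $\overline z$ lies in the resolvent set of $H_{0,+}^N$, the operators $\overline{M_u(H_{0,+}^N-z)^{-1}M_v}$ and $\overline{M_u(H_{0,+}^D-z)^{-1}M_v}$ are everywhere defined and trace class, the numbers $\det\big(I+\overline{M_u(H_{0,+}^D-z)^{-1}M_v}\big)$ and $f_+(z,0)$ are nonzero,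 $W(f_+(z,\cdot),\phi_+^D(z,\cdot))$ is nowhere zero on $[0,\infty)$, and $$\frac{\det\big(I+\overline{M_u(H_{0,+}^N-z)^{-1}M_v}\big)}{\det\big(I+\overline{M_u(H_{0,+}^D-z)^{-1}M_v}\big)} =\frac{W(f_+(z,\cdot),\phi_+^N(z,\cdot))}{iz^{1/2}\,W(f_+(z,\cdot),\phi_+^D(z,\cdot))} =\frac{f_+'(z,0)}{iz^{1/2}f_+(z,0)}=\frac{m_+^D(z)}{m_{0,+}^D(z)}=\frac{m_{0,+}^N(z)}{m_+^N(z)}$$ $$=1-\Big(\overline{\gamma_N(H_+^D-z)^{-1}M_V\big[\gamma_D(H_{0,+}^N-\overline z)^{-1}\big]^*}\Big)1 .$$ The Wronskians may be evaluated at any $x\ge0$; the quotient $m_{0,+}^N(z)/m_+^N(z)$ is read as $0$ if $f_+'(z,0)=0$ (a pole of $m_+^N$); and the operator in the last expression, acting in $\mathbb C$, is the product $\overline{\gamma_N(H_+^D-z)^{-1}M_u}\;M_v\,\big[\gamma_D(H_{0,+}^N-\overline z)^{-1}\big]^*$, whose domain contains $1$. -/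

import Mathlib

open MeasureTheory Set Filter Topology

noncomputable section

namespace HalfLine

/-! ### The Hilbert space and some general operator theory -/

/-- Lebesgue measure on the open half-line `(0, ∞)`. -/
abbrev halfLineMeasure : Measure ℝ := volume.restrict (Ioi (0 : ℝ))

/-- The Hilbert space `L²((0, ∞); dx)` of complex-valued functions. -/
abbrev L2 : Type := Lp ℂ 2 halfLineMeasure

section Operators

variable {E F G : Type*} [NormedAddCommGroup E] [NormedSpace ℂ E]
  [NormedAddCommGroup F] [NormedSpace ℂ F] [NormedAddCommGroup G] [NormedSpace ℂ G]

/-- The product `S T` of two partially defined operators, on its natural domain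
`{x ∈ dom T | T x ∈ dom S}`. -/
def pcomp (S : F →ₗ.[ℂ] G) (T : E →ₗ.[ℂ] F) : E →ₗ.[ℂ] G where
  domain := (S.domain.comap T.toFun).map T.domain.subtype
  toFun :=
    { toFun := fun x => S ⟨T ⟨x.1, by
          obtain ⟨y, _, hy⟩ := x.2
          exact hy ▸ y.2⟩, by
          obtain ⟨x, y, hy, rfl⟩ := x
          exact hy⟩
      map_add' := by
        rintro ⟨_, x, hx, rfl⟩ ⟨_, y, hy, rfl⟩
        rw [← S.map_add]
        congr 1
        exact Subtype.ext (T.map_add x y)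
      map_smul' := by
        rintro c ⟨_, x, hx, rfl⟩
        rw [RingHom.id_apply, ← S.map_smul]
        congr 1
        exact Subtype.ext (T.map_smul c x) }

/-- `A - z I` on the domain of `A`. -/
def shift (A : E →ₗ.[ℂ] E) (z : ℂ) : E →ₗ.[ℂ] E :=
  (-(z • (LinearMap.id : E →ₗ[ℂ] E))) +ᵥ A

/-- The operator `(A - z I)⁻¹`, defined on the range of `A - z I`. -/
def pinv (A : E →ₗ.[ℂ] E) (z : ℂ) : E →ₗ.[ℂ] E := (shift A z).inverse

/-- The resolvent set of `A`: those `z` for which `A - z I` is a bijection from `dom A` onto the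
whole space, with bounded inverse `R`. -/
def resolventSet (A : E →ₗ.[ℂ] E) : Set ℂ :=
  {z | ∃ R : E →L[ℂ] E,
    (∀ y : E, ∃ h : R y ∈ A.domain, A ⟨R y, h⟩ - z • R y = y) ∧
    ∀ x : A.domain, R (A x - z • (x : E)) = x}

/-- The spectrum of `A`. -/
def opSpectrum (A : E →ₗ.[ℂ] E) : Set ℂ := (resolventSet A)ᶜ

/-- The closure of `S` is the bounded, everywhere defined operator `K`. -/
def HasBoundedClosure (S : E →ₗ.[ℂ] F) (K : E →L[ℂ] F) : Prop :=
  S.closure = (K : E →ₗ[ℂ] F).toPMap ⊤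

end Operators

section Determinant

variable {E : Type} [NormedAddCommGroup E] [InnerProductSpace ℂ E]

/-- Trace class operators on a Hilbert space, i.e. operators with an expansion
`T f = ∑ₙ ⟪xₙ, f⟫ yₙ` where `∑ₙ ‖xₙ‖ ‖yₙ‖ < ∞` (on a Hilbert space the nuclear operators are
exactly the trace class operators). -/
def IsTraceClass (T : E →L[ℂ] E) : Prop :=
  ∃ x y : ℕ → E, Summable (fun n => ‖x n‖ * ‖y n‖) ∧
    ∀ f : E, HasSum (fun n => inner ℂ (x n) f • y n) (T f)

open Classical in
/-- `d` is the Fredholm determinant `det (I + T)` of a (trace class) operator `T`: for every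
orthonormal basis `(bᵢ)`, the determinants of the compressions of `I + T` to the spans of finite
subfamilies converge to `d`. The determinant of the compression to the span of `(bᵢ)_{i ∈ s}` is
`∑_{t ⊆ s} det (⟪bᵢ, T bⱼ⟫)_{i, j ∈ t}`, so that for trace class `T` the limit exists and is
`∑ₖ tr (Λᵏ T)`, the sum of all principal minors of `T`. -/
def HasFredholmDet (T : E →L[ℂ] E) (d : ℂ) : Prop :=
  ∀ (ι : Type) (b : HilbertBasis ι ℂ E),
    Tendsto (fun s : Finset ι =>
      Matrix.det ((1 : Matrix s s ℂ) + Matrix.of fun i j : s => inner ℂ (b i) (T (b j))))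
      atTop (𝓝 d)

end Determinant

/-! ### Multiplication operators and traces in `L²((0, ∞))` -/

/-- The maximally defined operator `M_w` of multiplication by `w` in `L²((0, ∞))`. -/
def mulOp (w : ℝ → ℂ) : L2 →ₗ.[ℂ] L2 where
  domain :=
    { carrier := {g | MemLp (fun x => w x * g x) 2 halfLineMeasure}
      zero_mem' := by
        refine (memLp_congr_ae ?_).2 (MemLp.zero (p := 2) (μ := halfLineMeasure) (ε := ℂ))
        filter_upwards [Lp.coeFn_zero ℂ 2 halfLineMeasure] with x hx
        simp only [hx, Pi.zero_apply, mul_zero]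
      add_mem' := by
        intro f g hf hg
        refine (memLp_congr_ae ?_).2 (MemLp.add hf hg)
        filter_upwards [Lp.coeFn_add f g] with x hx
        simp only [hx, Pi.add_apply, mul_add]
      smul_mem' := by
        intro c f hf
        refine (memLp_congr_ae ?_).2 (MemLp.const_smul hf c)
        filter_upwards [Lp.coeFn_smul c f] with x hx
        simp only [hx, Pi.smul_apply, smul_eq_mul]
        ring }
  toFun :=
    { toFun := fun g => MemLp.toLp (fun x => w x * (g : L2) x) g.2
      map_add' := by
        intro f g
        rw [← MemLp.toLp_add]
        refine MemLp.toLp_congr _ _ ?_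
        filter_upwards [Lp.coeFn_add (f : L2) (g : L2)] with x hx
        simp only [Submodule.coe_add, hx, Pi.add_apply, mul_add]
      map_smul' := by
        intro c f
        rw [RingHom.id_apply, ← MemLp.toLp_const_smul]
        refine MemLp.toLp_congr _ _ ?_
        filter_upwards [Lp.coeFn_smul c (f : L2)] with x hx
        simp only [Submodule.coe_smul, hx, Pi.smul_apply, smul_eq_mul]
        ring }

lemma eqOn_zero_of_ae {G : ℝ → ℂ} (hc : ContinuousOn G (Ici 0))
    (h0 : G =ᵐ[halfLineMeasure] 0) : EqOn G 0 (Ici 0) := by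
  have h1 : EqOn G 0 (Ioi 0) :=
    Measure.eqOn_open_of_ae_eq h0 isOpen_Ioi (hc.mono Ioi_subset_Ici_self) continuousOn_const
  refine h1.of_subset_closure hc continuousOn_const Ioi_subset_Ici_self ?_
  rw [closure_Ioi]

/-- The graph of the Dirichlet trace `γ_D g = g(0)`, for `g ∈ L²` that are continuous on
`[0, ∞)`. -/
def traceDGraph : Submodule ℂ (L2 × ℂ) where
  carrier := {p | ∃ G : ℝ → ℂ, p.1 =ᵐ[halfLineMeasure] G ∧ ContinuousOn G (Ici 0) ∧ p.2 = G 0}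
  zero_mem' := ⟨0, Lp.coeFn_zero ℂ 2 halfLineMeasure, continuousOn_const, rfl⟩
  add_mem' := by
    rintro p q ⟨G, hG, cG, eG⟩ ⟨K, hK, cK, eK⟩
    exact ⟨G + K, (Lp.coeFn_add p.1 q.1).trans (hG.add hK), cG.add cK, by simp [eG, eK]⟩
  smul_mem' := by
    rintro c p ⟨G, hG, cG, eG⟩
    exact ⟨c • G, (Lp.coeFn_smul c p.1).trans (hG.const_smul c), cG.const_smul c, by simp [eG]⟩

/-- The graph of the Neumann trace `γ_N g = -g'(0)`, for `g ∈ L²` that are `C¹` on `[0, ∞)`. -/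
def traceNGraph : Submodule ℂ (L2 × ℂ) where
  carrier := {p | ∃ G : ℝ → ℂ, p.1 =ᵐ[halfLineMeasure] G ∧ ContDiffOn ℝ 1 G (Ici 0) ∧
    p.2 = -derivWithin G (Ici 0) 0}
  zero_mem' := ⟨0, Lp.coeFn_zero ℂ 2 halfLineMeasure, contDiffOn_const, by simp⟩
  add_mem' := by
    rintro p q ⟨G, hG, cG, eG⟩ ⟨K, hK, cK, eK⟩
    refine ⟨G + K, (Lp.coeFn_add p.1 q.1).trans (hG.add hK), cG.add cK, ?_⟩
    rw [derivWithin_add (cG.differentiableOn (by simp) 0 self_mem_Ici)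
      (cK.differentiableOn (by simp) 0 self_mem_Ici)]
    simp only [Prod.snd_add, eG, eK]
    ring
  smul_mem' := by
    rintro c p ⟨G, hG, cG, eG⟩
    refine ⟨c • G, (Lp.coeFn_smul c p.1).trans (hG.const_smul c), cG.const_smul c, ?_⟩
    rw [derivWithin_const_smul c (cG.differentiableOn (by simp) 0 self_mem_Ici)]
    simp [eG]

/-- The Dirichlet trace, as a partially defined functional on `L²((0, ∞))`. -/
def traceD : L2 →ₗ.[ℂ] ℂ := traceDGraph.toLinearPMap

/-- The Neumann trace, as a partially defined functional on `L²((0, ∞))`. -/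
def traceN : L2 →ₗ.[ℂ] ℂ := traceNGraph.toLinearPMap

lemma ae_zero_of_fst {g : L2} {G : ℝ → ℂ} (h : g =ᵐ[halfLineMeasure] G) (h0 : g = 0) :
    G =ᵐ[halfLineMeasure] 0 := by
  subst h0
  exact h.symm.trans (Lp.coeFn_zero ℂ 2 halfLineMeasure)

/-- The graph of `traceD` is the one prescribed. -/
lemma traceD_graph : traceD.graph = traceDGraph := by
  refine Submodule.toLinearPMap_graph_eq _ ?_
  rintro p ⟨G, hG, cG, eG⟩ h0
  rw [eG]
  exact eqOn_zero_of_ae cG (ae_zero_of_fst hG h0) self_mem_Ici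

/-- The graph of `traceN` is the one prescribed. -/
lemma traceN_graph : traceN.graph = traceNGraph := by
  refine Submodule.toLinearPMap_graph_eq _ ?_
  rintro p ⟨G, hG, cG, eG⟩ h0
  have h := eqOn_zero_of_ae cG.continuousOn (ae_zero_of_fst hG h0)
  rw [eG, derivWithin_congr h (h self_mem_Ici)]
  simp

/-! ### Schrödinger operators on the half-line -/

/-- `G`, with derivative `G'` and almost everywhere defined second derivative `G''`, represents
`g ∈ L²`; both `G` and `G'` are absolutely continuous on all intervals `[0, R]`; and
`h = -G'' + V G`. -/
structure IsSchrodingerRep (V : ℝ → ℂ) (g h : L2) (G G' G'' : ℝ → ℂ) : Prop where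
  eq_left : g =ᵐ[halfLineMeasure] G
  hasDeriv : ∀ x ∈ Ici (0 : ℝ), HasDerivWithinAt G (G' x) (Ici 0) x
  ac : ∀ R : ℝ, 0 < R → AbsolutelyContinuousOnInterval G 0 R
  ac' : ∀ R : ℝ, 0 < R → AbsolutelyContinuousOnInterval G' 0 R
  hasDeriv' : ∀ᵐ x ∂halfLineMeasure, HasDerivAt G' (G'' x) x
  eq_right : h =ᵐ[halfLineMeasure] fun x => -G'' x + V x * G x

/-- The graph `{(g, -g'' + V g)}` of the operator `-d²/dx² + V` in `L²((0, ∞))` with the boundary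
condition `a g(0) + b g'(0) = 0`: here `g` runs through all elements of `L²` such that `g, g'` are
absolutely continuous on each `[0, R]`, `-g'' + V g ∈ L²`, and the boundary condition holds. -/
def schrodingerGraph (V : ℝ → ℂ) (a b : ℂ) : Submodule ℂ (L2 × L2) where
  carrier := {p | ∃ G G' G'' : ℝ → ℂ, IsSchrodingerRep V p.1 p.2 G G' G'' ∧
    a * G 0 + b * G' 0 = 0}
  zero_mem' := by
    refine ⟨0, 0, 0, ⟨Lp.coeFn_zero ℂ 2 halfLineMeasure, fun x _ => ?_, fun R _ => ?_,
      fun R _ => ?_, ?_, ?_⟩, by simp⟩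
    · exact hasDerivWithinAt_const x _ (0 : ℂ)
    · exact (contDiff_const (c := (0 : ℂ))).contDiffOn.absolutelyContinuousOnInterval
    · exact (contDiff_const (c := (0 : ℂ))).contDiffOn.absolutelyContinuousOnInterval
    · exact Eventually.of_forall fun x => hasDerivAt_const x (0 : ℂ)
    · filter_upwards [Lp.coeFn_zero ℂ 2 halfLineMeasure] with x hx
      simpa using hx
  add_mem' := by
    rintro p q ⟨G, G', G'', hG, bG⟩ ⟨K, K', K'', hK, bK⟩
    refine ⟨G + K, G' + K', G'' + K'',
      ⟨(Lp.coeFn_add p.1 q.1).trans (hG.eq_left.add hK.eq_left),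
      fun x hx => (hG.hasDeriv x hx).add (hK.hasDeriv x hx),
      fun R hR => (hG.ac R hR).add (hK.ac R hR), fun R hR => (hG.ac' R hR).add (hK.ac' R hR),
      ?_, ?_⟩, ?_⟩
    · filter_upwards [hG.hasDeriv', hK.hasDeriv'] with x h1 h2 using h1.add h2
    · filter_upwards [Lp.coeFn_add p.2 q.2, hG.eq_right, hK.eq_right] with x h1 h2 h3
      simp only [Prod.snd_add, h1, Pi.add_apply, h2, h3]
      ring
    · simp only [Pi.add_apply]
      linear_combination bG + bK
  smul_mem' := by
    rintro c p ⟨G, G', G'', hG, bG⟩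
    refine ⟨c • G, c • G', c • G'',
      ⟨(Lp.coeFn_smul c p.1).trans (hG.eq_left.const_smul c),
      fun x hx => (hG.hasDeriv x hx).const_smul c,
      fun R hR => (hG.ac R hR).const_smul c, fun R hR => (hG.ac' R hR).const_smul c,
      ?_, ?_⟩, ?_⟩
    · filter_upwards [hG.hasDeriv'] with x h1 using h1.const_smul c
    · filter_upwards [Lp.coeFn_smul c p.2, hG.eq_right] with x h1 h2
      simp only [Prod.smul_snd, h1, Pi.smul_apply, h2, smul_eq_mul]
      ring
    · simp only [Pi.smul_apply, smul_eq_mul]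
      linear_combination c * bG

/-- The operator `-d²/dx² + V` in `L²((0, ∞))` with boundary condition `a g(0) + b g'(0) = 0`. -/
def schrodingerOp (V : ℝ → ℂ) (a b : ℂ) : L2 →ₗ.[ℂ] L2 := (schrodingerGraph V a b).toLinearPMap

/-- The graph of `schrodingerOp` is the one prescribed. -/
lemma schrodingerOp_graph (V : ℝ → ℂ) (a b : ℂ) :
    (schrodingerOp V a b).graph = schrodingerGraph V a b := by
  refine Submodule.toLinearPMap_graph_eq _ ?_
  rintro p ⟨G, G', G'', hG, -⟩ h0
  have h : EqOn G 0 (Ici 0) :=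
    eqOn_zero_of_ae (fun x hx => (hG.hasDeriv x hx).continuousWithinAt)
      (ae_zero_of_fst hG.eq_left h0)
  have h' : EqOn G' 0 (Ici 0) := by
    intro x hx
    have h1 := (hG.hasDeriv x hx).congr (fun y hy => (h hy).symm) (h hx).symm
    exact (uniqueDiffOn_Ici (0 : ℝ) x hx).eq_deriv _ h1 (hasDerivWithinAt_const x _ (0 : ℂ))
  refine Lp.ext ?_
  filter_upwards [hG.eq_right, hG.hasDeriv', Lp.coeFn_zero ℂ 2 halfLineMeasure,
    ae_restrict_mem measurableSet_Ioi] with x h1 h2 h3 hx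
  have h4 : G'' x = 0 := by
    refine h2.unique ((hasDerivAt_const x (0 : ℂ)).congr_of_eventuallyEq ?_)
    filter_upwards [Ioi_mem_nhds hx] with y hy using h' (Ioi_subset_Ici_self hy)
  rw [h1, h3, h4, h (Ioi_subset_Ici_self hx)]
  simp

/-- `H_+^D`, the Dirichlet Schrödinger operator with potential `V` (boundary condition
`g(0) = 0`). For `V = 0` this is `H_{0,+}^D`. -/
def opD (V : ℝ → ℂ) : L2 →ₗ.[ℂ] L2 := schrodingerOp V 1 0

/-- `H_+^N`, the Neumann Schrödinger operator with potential `V` (boundary condition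
`g'(0) = 0`). For `V = 0` this is `H_{0,+}^N`. -/
def opN (V : ℝ → ℂ) : L2 →ₗ.[ℂ] L2 := schrodingerOp V 0 1

/-! ### Solutions of the Schrödinger equation -/

/-- The branch of `z^{1/2}` with `Im z^{1/2} ≥ 0`. -/
def sqrtUp (z : ℂ) : ℂ := Complex.I * (-z) ^ (1 / 2 : ℂ)

lemma sqrtUp_sq (z : ℂ) : sqrtUp z ^ 2 = z := by
  rw [sqrtUp, mul_pow, Complex.I_sq, ← Complex.cpow_nat_mul]
  norm_num

lemma sqrtUp_im_nonneg (z : ℂ) : 0 ≤ (sqrtUp z).im := by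
  have h : 0 ≤ ((-z) ^ (1 / 2 : ℂ)).re := by
    rcases eq_or_ne (-z) 0 with h0 | h0
    · rw [h0]
      simp
    · rw [Complex.cpow_def_of_ne_zero h0, Complex.exp_re]
      refine mul_nonneg (Real.exp_pos _).le (Real.cos_nonneg_of_mem_Icc ?_)
      have h1 := Complex.neg_pi_lt_arg (-z)
      have h2 := Complex.arg_le_pi (-z)
      have h3 : (Complex.log (-z) * (1 / 2 : ℂ)).im = Complex.arg (-z) / 2 := by
        rw [show (1 / 2 : ℂ) = ((1 / 2 : ℝ) : ℂ) by push_cast; rfl, Complex.im_mul_ofReal,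
          Complex.log_im]
        ring
      rw [h3]
      constructor <;> linarith
  simpa [sqrtUp, Complex.mul_im] using h

/-- The kernel `g_+^{(0)}(z, x, x') = z^{-1/2} sin(z^{1/2} (x - x'))`. -/
def greenKernel (z : ℂ) (x x' : ℝ) : ℂ :=
  Complex.sin (sqrtUp z * ((x : ℂ) - (x' : ℂ))) / sqrtUp z

/-- `f` is the Jost solution `f_+(z, ·)` on `[0, ∞)`, i.e. the continuous solution of
`f(x) = e^{i z^{1/2} x} - ∫_x^∞ g_+^{(0)}(z, x, x') V(x') f(x') dx'`. -/
def IsJostSolution (V : ℝ → ℂ) (z : ℂ) (f : ℝ → ℂ) : Prop :=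
  ContinuousOn f (Ici 0) ∧ ∀ x : ℝ, 0 ≤ x →
    IntegrableOn (fun x' => greenKernel z x x' * V x' * f x') (Ioi x) ∧
    f x = Complex.exp (Complex.I * sqrtUp z * x)
      - ∫ x' in Ioi x, greenKernel z x x' * V x' * f x'

/-- `φ` is the continuous solution on `[0, ∞)` of the Volterra equation
`φ(x) = φ₀(x) + ∫_0^x g_+^{(0)}(z, x, x') V(x') φ(x') dx'`. -/
def IsVolterraSolution (V : ℝ → ℂ) (z : ℂ) (φ₀ φ : ℝ → ℂ) : Prop :=
  ContinuousOn φ (Ici 0) ∧ ∀ x : ℝ, 0 ≤ x →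
    φ x = φ₀ x + ∫ x' in (0 : ℝ)..x, greenKernel z x x' * V x' * φ x'

/-- The Jost solution `f_+(z, ·)` (only its values on `[0, ∞)` matter, and these are uniquely
determined). -/
def jost (V : ℝ → ℂ) (z : ℂ) : ℝ → ℂ := Classical.epsilon (IsJostSolution V z)

/-- The free solution `z^{-1/2} sin(z^{1/2} x)`. -/
def freeSin (z : ℂ) (x : ℝ) : ℂ := Complex.sin (sqrtUp z * x) / sqrtUp z

/-- The free solution `cos(z^{1/2} x)`. -/
def freeCos (z : ℂ) (x : ℝ) : ℂ := Complex.cos (sqrtUp z * x)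

/-- The solution `φ_+^D(z, ·)`, with `φ(0) = 0`, `φ'(0) = 1`. -/
def phiD (V : ℝ → ℂ) (z : ℂ) : ℝ → ℂ := Classical.epsilon (IsVolterraSolution V z (freeSin z))

/-- The solution `θ_+^D(z, ·)`, with `θ(0) = 1`, `θ'(0) = 0`. -/
def thetaD (V : ℝ → ℂ) (z : ℂ) : ℝ → ℂ := Classical.epsilon (IsVolterraSolution V z (freeCos z))

/-- The solution `φ_+^N(z, ·)` satisfying the Neumann boundary condition, normalized by
`φ(0) = -1`, `φ'(0) = 0`; that is, `φ_+^N = -θ_+^D`. -/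
def phiN (V : ℝ → ℂ) (z : ℂ) : ℝ → ℂ := -thetaD V z

/-- The derivative on `[0, ∞)` (one-sided at `0`). -/
def deriv₀ (f : ℝ → ℂ) (x : ℝ) : ℂ := derivWithin f (Ici 0) x

/-- The Wronskian `W(f, g)(x) = f(x) g'(x) - f'(x) g(x)` for `x ≥ 0`. -/
def wronskian (f g : ℝ → ℂ) (x : ℝ) : ℂ := f x * deriv₀ g x - deriv₀ f x * g x

/-- `m_{0,+}^D(z) = i z^{1/2}`. -/
def m0D (z : ℂ) : ℂ := Complex.I * sqrtUp z

/-- `m_{0,+}^N(z) = -1 / m_{0,+}^D(z)`. -/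
def m0N (z : ℂ) : ℂ := -1 / m0D z

/-- `m_+^D(z) = f_+'(z, 0) / f_+(z, 0)`. -/
def mD (V : ℝ → ℂ) (z : ℂ) : ℂ := deriv₀ (jost V z) 0 / jost V z 0

/-- `m_+^N(z) = -f_+(z, 0) / f_+'(z, 0)`. At a pole (`f_+'(z, 0) = 0`) Lean's value is `0`, and so
is then the quotient `c / m_+^N(z)`, in agreement with the reading `c / ∞ = 0`. -/
def mN (V : ℝ → ℂ) (z : ℂ) : ℂ := -jost V z 0 / deriv₀ (jost V z) 0

/-! ### Birman–Schwinger operators -/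

/-- `v = |V|^{1/2}`. -/
def vFactor (V : ℝ → ℂ) (x : ℝ) : ℂ := (Real.sqrt ‖V x‖ : ℂ)

/-- `u = exp(i arg V) |V|^{1/2}`, so that `V = u v`. -/
def uFactor (V : ℝ → ℂ) (x : ℝ) : ℂ :=
  Complex.exp (Complex.I * (Complex.arg (V x) : ℂ)) * (Real.sqrt ‖V x‖ : ℂ)

lemma uFactor_mul_vFactor (V : ℝ → ℂ) (x : ℝ) : uFactor V x * vFactor V x = V x := by
  rw [uFactor, vFactor, mul_assoc, ← Complex.ofReal_mul, Real.mul_self_sqrt (norm_nonneg _),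
    mul_comm, mul_comm Complex.I]
  exact Complex.norm_mul_exp_arg_mul_I (V x)

/-- The Birman–Schwinger operator `M_u (H₀ - z)⁻¹ M_v`, on its natural domain, before taking the
closure. -/
def birmanSchwinger (H₀ : L2 →ₗ.[ℂ] L2) (V : ℝ → ℂ) (z : ℂ) : L2 →ₗ.[ℂ] L2 :=
  pcomp (mulOp (uFactor V)) (pcomp (pinv H₀ z) (mulOp (vFactor V)))

/-- The closure of `γ_N (H_+^D - z)⁻¹ M_u`, a functional on `L²((0, ∞))`. -/
def neumannFunctional (V : ℝ → ℂ) (z : ℂ) : L2 →ₗ.[ℂ] ℂ :=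
  (pcomp traceN (pcomp (pinv (opD V) z) (mulOp (uFactor V)))).closure

/-- The adjoint `[γ_D (H_{0,+}^N - z̄)⁻¹]^*`, an operator from `ℂ` to `L²((0, ∞))`. -/
def dirichletAdjoint (z : ℂ) : ℂ →ₗ.[ℂ] L2 :=
  (pcomp traceD (pinv (opN 0) (starRingEnd ℂ z))).adjoint

/-- The operator `γ_N (H_+^D - z)⁻¹ M_V [γ_D (H_{0,+}^N - z̄)⁻¹]^*` in `ℂ`, where `M_V = M_u M_v`
and the product `γ_N (H_+^D - z)⁻¹ M_u` is replaced by its closure (in general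
`M_V [γ_D (H_{0,+}^N - z̄)⁻¹]^*` does not map into `L²`, while
`M_v [γ_D (H_{0,+}^N - z̄)⁻¹]^*` does). -/
def boundaryOp (V : ℝ → ℂ) (z : ℂ) : ℂ →ₗ.[ℂ] ℂ :=
  pcomp (neumannFunctional V z) (pcomp (mulOp (vFactor V)) (dirichletAdjoint z))

end HalfLine

end

/-! Write k = z^{1/2} and f = f_+(z, ·). The free Neumann resolvent is the free Dirichlet resolvent
plus the rank one operator with kernel (i/k) e^{ikx} e^{iky}. Sandwiched between u and v, this makes
the Neumann Birman–Schwinger operator equal to K + a⟨b, ·⟩, where K is the Dirichlet one, a = u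
e^{ikx}, and b is the complex conjugate of (i/k) v e^{ikx}. For such a perturbation the quotient of
determinants is 1 + ⟨b, h⟩ as soon as (I + K)h = a (`exists_hasFredholmDet_add_rankOne`), so no
determinant has to be computed: one linear equation has to be solved.

The Jost solution solves it. With G the free Dirichlet Green operator, G(Vf) + f = f(0) e^{ikx}
(`dirichletSol_add_jost`), hence h = u f / f(0), and the quotient is 1 + (i/k) f(0)⁻¹ ∫ e^{iky} V f
dy. The Jost equation also gives f'(0) = ik f(0) - ∫ e^{iky} V f dy (`IsJostSolution.exists_deriv`),
which turns the quotient into f'(0) / (ik f(0)). The Wronskians are constant and are read off at 0.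
For the boundary operator, the adjoint trace maps 1 to (i/k) e^{ikx}, and Lagrange's identity gives
γ_N (H_+^D - z)⁻¹ g = -f(0)⁻¹ ∫ f g, so the same integral appears (`boundaryOp_one`).

That z lies in the resolvent set of H_+^D excludes nonzero square integrable Dirichlet solutions.
Hence f(0) ≠ 0, and I + K is injective; by the Fredholm alternative it is invertible, and then its
determinant is nonzero.

Two analytic inputs remain. K is trace class because the Green function is an inner product of two
truncated exponentials, which exhibits K as a product of Hilbert–Schmidt operators
(`inner_cutExp_cutExp`, `exists_isTraceClass_kernel`). Determinants are controlled through finite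
rank truncations, with error bounds uniform over all compressions (`norm_cutDet_sub_le`), so that
the truncation and compression limits may be interchanged. -/

noncomputable section

namespace HalfLine

/-! ### Size-independent determinant bounds for finite matrices. -/

section MatrixBounds

open Matrix

open scoped ComplexOrder

variable {s : Type*} [Fintype s]

lemma norm_sum_mul_le_l2 (p q : s → ℂ) :
    ‖∑ i, p i * q i‖ ≤ ‖WithLp.toLp 2 p‖ * ‖WithLp.toLp 2 q‖ := by
  have := norm_inner_le_norm (𝕜 := ℂ) (WithLp.toLp 2 (star q)) (WithLp.toLp 2 p)
  have h2 : ‖WithLp.toLp 2 (star q)‖ = ‖WithLp.toLp 2 q‖ := by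
    simp [EuclideanSpace.norm_eq]
  rw [h2] at this
  rw [mul_comm ‖_‖]
  refine le_trans (le_of_eq ?_) this
  simp [PiLp.inner_apply]

variable [DecidableEq s]

/-- |det M|² is the product of the eigenvalues λ of MᴴM, and λ ≤ e^{λ - 1}. Subtracting the size of
the matrix in the exponent is what keeps the bound for 1 + A independent of the dimension. -/
lemma norm_sq_det_le (M : Matrix s s ℂ) :
    ‖M.det‖ ^ 2 ≤ Real.exp ((Mᴴ * M).trace.re - Fintype.card s) := by
  have hH : (Mᴴ * M).IsHermitian := isHermitian_conjTranspose_mul_self M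
  have hP : (Mᴴ * M).PosSemidef := posSemidef_conjTranspose_mul_self M
  have h1 : ((‖M.det‖ ^ 2 : ℝ) : ℂ) = ((∏ i, hH.eigenvalues i : ℝ) : ℂ) := by
    have := hH.det_eq_prod_eigenvalues
    rw [det_mul, det_conjTranspose] at this
    rw [Complex.ofReal_prod]
    rw [← Complex.coe_algebraMap] at *
    refine Eq.trans ?_ this
    rw [Complex.coe_algebraMap, Complex.ofReal_pow, ← Complex.conj_mul']
    rfl
  have h2 : (Mᴴ * M).trace.re = ∑ i, hH.eigenvalues i := by
    rw [hH.trace_eq_sum_eigenvalues]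
    simp
  have h3 : ‖M.det‖ ^ 2 = ∏ i, hH.eigenvalues i := by exact_mod_cast h1
  rw [h3, h2]
  calc ∏ i, hH.eigenvalues i ≤ ∏ i, Real.exp (hH.eigenvalues i - 1) := by
        refine Finset.prod_le_prod (fun i _ => hP.eigenvalues_nonneg i) fun i _ => ?_
        have := Real.add_one_le_exp (hH.eigenvalues i - 1)
        linarith
    _ = _ := by
        rw [← Real.exp_sum, Finset.sum_sub_distrib]
        simp

/-- The sum of the rank one matrices `p k (q k)ᵀ`, `k < n`. -/
def rankSum (p q : ℕ → s → ℂ) (n : ℕ) : Matrix s s ℂ :=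
  ∑ k ∈ Finset.range n, vecMulVec (p k) (q k)

/-- For M = 1 + A, tr(MᴴM) minus the dimension is 2 Re tr A + tr(AᴴA). With S = ∑ c k, the two
traces are at most S and S² in modulus, and half of 2S + S² is the exponent. -/
lemma norm_det_one_add_rankSum_le (p q : ℕ → s → ℂ) (c : ℕ → ℝ)
    (hc : ∀ k, ‖WithLp.toLp 2 (p k)‖ * ‖WithLp.toLp 2 (q k)‖ ≤ c k) (n : ℕ) :
    ‖(1 + rankSum p q n).det‖ ≤
      Real.exp ((∑ k ∈ Finset.range n, c k) + (∑ k ∈ Finset.range n, c k) ^ 2 / 2) := by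
  set S := ∑ k ∈ Finset.range n, c k with hS
  set A := rankSum p q n with hA
  have hc0 : ∀ k, 0 ≤ c k := fun k => le_trans (by positivity) (hc k)
  have hS0 : 0 ≤ S := Finset.sum_nonneg fun k _ => hc0 k
  have htr : ‖A.trace‖ ≤ S := by
    rw [hA, rankSum, trace_sum]
    refine (norm_sum_le _ _).trans (Finset.sum_le_sum fun k _ => ?_)
    rw [trace_vecMulVec]
    exact (norm_sum_mul_le_l2 _ _).trans (hc k)
  have hF : ‖(Aᴴ * A).trace‖ ≤ S ^ 2 := by
    have : (Aᴴ * A).trace = ∑ k ∈ Finset.range n, ∑ l ∈ Finset.range n,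
        (∑ i, star (p k i) * p l i) * (∑ i, q l i * star (q k i)) := by
      rw [hA, rankSum, conjTranspose_sum, Finset.sum_mul, trace_sum]
      refine Finset.sum_congr rfl fun k _ => ?_
      rw [Finset.mul_sum, trace_sum]
      refine Finset.sum_congr rfl fun l _ => ?_
      rw [conjTranspose_vecMulVec, vecMulVec_mul_vecMulVec, vecMulVec_smul, trace_smul,
        trace_vecMulVec]
      simp only [dotProduct, smul_eq_mul, Pi.star_apply]
      congr 1
      exact Finset.sum_congr rfl fun i _ => mul_comm _ _
    rw [this, pow_two, hS, Finset.sum_mul_sum]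
    refine (norm_sum_le _ _).trans (Finset.sum_le_sum fun k _ => ?_)
    refine (norm_sum_le _ _).trans (Finset.sum_le_sum fun l _ => ?_)
    have hst : ∀ r : s → ℂ, ‖WithLp.toLp 2 (star r)‖ = ‖WithLp.toLp 2 r‖ := fun r => by
      simp [EuclideanSpace.norm_eq]
    have e1 := norm_sum_mul_le_l2 (star (p k)) (p l)
    have e2 := norm_sum_mul_le_l2 (q l) (star (q k))
    rw [hst] at e1 e2
    rw [norm_mul]
    calc _ ≤ (‖WithLp.toLp 2 (p k)‖ * ‖WithLp.toLp 2 (p l)‖) *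
          (‖WithLp.toLp 2 (q l)‖ * ‖WithLp.toLp 2 (q k)‖) :=
          mul_le_mul e1 e2 (norm_nonneg _) (by positivity)
      _ = (‖WithLp.toLp 2 (p k)‖ * ‖WithLp.toLp 2 (q k)‖) *
          (‖WithLp.toLp 2 (p l)‖ * ‖WithLp.toLp 2 (q l)‖) := by ring
      _ ≤ c k * c l := mul_le_mul (hc k) (hc l) (by positivity) (hc0 k)
  have hexp : ((1 + A)ᴴ * (1 + A)).trace.re - Fintype.card s ≤ 2 * S + S ^ 2 := by
    have : ((1 + A)ᴴ * (1 + A)).trace = Fintype.card s + A.trace + star A.trace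
        + (Aᴴ * A).trace := by
      rw [conjTranspose_add, conjTranspose_one, add_mul, mul_add, mul_add, one_mul, one_mul,
        mul_one, trace_add, trace_add, trace_add, trace_one, trace_conjTranspose]
      ring
    rw [this]
    simp only [Complex.add_re, Complex.natCast_re, Complex.star_def, Complex.conj_re]
    have := (Complex.re_le_norm _).trans htr
    have := (Complex.re_le_norm _).trans hF
    linarith
  have h2 := (norm_sq_det_le (1 + A)).trans (Real.exp_le_exp.2 hexp)
  have h3 : Real.exp (2 * S + S ^ 2) = Real.exp (S + S ^ 2 / 2) ^ 2 := by
    rw [← Real.exp_nat_mul]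
    congr 1
    push_cast
    ring
  rw [h3] at h2
  exact le_of_sq_le_sq h2 (Real.exp_pos _).le

/-- The determinant is affine along a rank one direction: by the Schur complement it equals a
bordered determinant in which w occurs in a single row. -/
lemma exists_det_add_smul_vecMulVec (A : Matrix s s ℂ) (p q : s → ℂ) :
    ∃ β : ℂ, ∀ w : ℂ, (A + vecMulVec (w • p) q).det = A.det + w * β := by
  set M : Matrix (Unit ⊕ s) (Unit ⊕ s) ℂ := fromBlocks 1 0 (-replicateCol Unit p) A with hM
  have key : ∀ r : s → ℂ, (A + vecMulVec p r).det = (M.updateRow (Sum.inl ()) (Sum.elim 1 r)).det := by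
    intro r
    have : M.updateRow (Sum.inl ()) (Sum.elim 1 r) =
        fromBlocks 1 (replicateRow Unit r) (-replicateCol Unit p) A := by
      ext i j
      rcases i with i | i <;> rcases j with j | j <;> simp [hM, updateRow_apply]
    rw [this, det_fromBlocks_one₁₁, Matrix.neg_mul, sub_neg_eq_add, vecMulVec_eq Unit]
  refine ⟨(M.updateRow (Sum.inl ()) (Sum.elim 0 q)).det, fun w => ?_⟩
  have h1 : vecMulVec (w • p) q = vecMulVec p (w • q) := by
    ext i j
    simp only [vecMulVec_apply, Pi.smul_apply, smul_eq_mul]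
    ring
  have h0 : A.det = (M.updateRow (Sum.inl ()) (Sum.elim 1 0)).det := by
    rw [← key]
    simp
  have h2 : (Sum.elim (1 : Unit → ℂ) (w • q) : Unit ⊕ s → ℂ)
      = Sum.elim (1 : Unit → ℂ) (0 : s → ℂ) + w • Sum.elim (0 : Unit → ℂ) q := by
    ext i
    rcases i with i | i <;> simp
  rw [h1, key, h2, det_updateRow_add, det_updateRow_smul, ← h0]

/-- The difference is the slope β of a function affine in the scaling w of the last term. That
function obeys the exponential bound as long as w c_n ≤ 1, which costs at most one extra unit of
mass (hence B + 1). So |β| is at most c_n times the bound for two determinants. -/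
lemma norm_det_succ_sub_le (p q : ℕ → s → ℂ) (c : ℕ → ℝ)
    (hc : ∀ k, ‖WithLp.toLp 2 (p k)‖ * ‖WithLp.toLp 2 (q k)‖ ≤ c k) (n : ℕ) (B : ℝ)
    (hB : ∑ k ∈ Finset.range n, c k ≤ B) :
    ‖(1 + rankSum p q (n + 1)).det - (1 + rankSum p q n).det‖ ≤
      c n * (2 * Real.exp ((B + 1) + (B + 1) ^ 2 / 2)) := by
  have hc0 : ∀ k, 0 ≤ c k := fun k => le_trans (by positivity) (hc k)
  obtain ⟨β, hβ⟩ := exists_det_add_smul_vecMulVec (1 + rankSum p q n) (p n) (q n)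
  have hS0 : 0 ≤ ∑ k ∈ Finset.range n, c k := Finset.sum_nonneg fun k _ => hc0 k
  have hsucc : 1 + rankSum p q (n + 1) = (1 + rankSum p q n) + vecMulVec ((1 : ℂ) • p n) (q n) := by
    rw [rankSum, Finset.sum_range_succ, rankSum, one_smul, add_assoc]
  rw [hsucc, hβ, one_mul, add_sub_cancel_left]
  -- for every admissible scaling `w`, `w * β` is bounded
  have hbd : ∀ w : ℝ, 0 ≤ w → w * c n ≤ 1 →
      w * ‖β‖ ≤ 2 * Real.exp ((B + 1) + (B + 1) ^ 2 / 2) := by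
    intro w hw hwc
    set p' : ℕ → s → ℂ := fun k => if k = n then (w : ℂ) • p n else p k with hp'
    set c' : ℕ → ℝ := fun k => if k = n then w * c n else c k with hc'
    have hr : ∀ m ≤ n, rankSum p' q m = rankSum p q m := by
      intro m hm
      refine Finset.sum_congr rfl fun k hk => ?_
      have : k ≠ n := ((Finset.mem_range.1 hk).trans_le hm).ne
      simp [hp', this]
    have hcs : ∑ k ∈ Finset.range n, c' k = ∑ k ∈ Finset.range n, c k := by
      refine Finset.sum_congr rfl fun k hk => ?_
      simp [hc', (Finset.mem_range.1 hk).ne]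
    have hcc : ∀ k, ‖WithLp.toLp 2 (p' k)‖ * ‖WithLp.toLp 2 (q k)‖ ≤ c' k := by
      intro k
      by_cases hk : k = n
      · subst hk
        simp only [hp', hc', if_true]
        rw [WithLp.toLp_smul, norm_smul, Complex.norm_real, Real.norm_of_nonneg hw, mul_assoc]
        exact mul_le_mul_of_nonneg_left (hc k) hw
      · simpa [hp', hc', hk] using hc k
    have e0 := norm_det_one_add_rankSum_le p' q c' hcc n
    have e1 := norm_det_one_add_rankSum_le p' q c' hcc (n + 1)
    have hn1 : 1 + rankSum p' q (n + 1)
        = (1 + rankSum p q n) + vecMulVec ((w : ℂ) • p n) (q n) := by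
      rw [rankSum, Finset.sum_range_succ, ← rankSum, hr n le_rfl, add_assoc]
      simp [hp']
    rw [hn1, hβ, Finset.sum_range_succ, hcs] at e1
    rw [hr n le_rfl, hcs] at e0
    have hcn : c' n = w * c n := by simp [hc']
    have mono : ∀ t : ℝ, 0 ≤ t → t ≤ B + 1 →
        Real.exp (t + t ^ 2 / 2) ≤ Real.exp ((B + 1) + (B + 1) ^ 2 / 2) := by
      intro t ht htB
      gcongr
    have e0' := e0.trans (mono _ hS0 (by linarith))
    have e1' := e1.trans (mono _ (by rw [hcn]; have := mul_nonneg hw (hc0 n); linarith)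
      (by rw [hcn]; linarith))
    have : (w : ℂ) * β = (1 + rankSum p q n).det + w * β - (1 + rankSum p q n).det := by ring
    calc w * ‖β‖ = ‖(w : ℂ) * β‖ := by
          rw [norm_mul, Complex.norm_real, Real.norm_of_nonneg hw]
      _ ≤ _ := by
          rw [this]
          refine (norm_sub_le _ _).trans ?_
          linarith
  -- If c n = 0 every w ≥ 0 is admissible, which forces β = 0; otherwise w = 1 / c n is the largest
  -- admissible scaling.
  rcases (hc0 n).eq_or_lt with h0 | h0
  · rw [← h0, zero_mul]
    by_contra! hpos
    have := hbd ((2 * Real.exp ((B + 1) + (B + 1) ^ 2 / 2) + 1) / ‖β‖) (by positivity)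
      (by rw [← h0]; simp)
    rw [div_mul_cancel₀ _ hpos.ne'] at this
    linarith
  · have := hbd (c n)⁻¹ (by positivity) (by rw [inv_mul_cancel₀ h0.ne'])
    rwa [inv_mul_le_iff₀ h0] at this

end MatrixBounds

/-! ### Determinants of finite rank perturbations of the identity. -/

section GramDeterminants

open Matrix InnerProductSpace

variable {E : Type} [NormedAddCommGroup E] [InnerProductSpace ℂ E]

/-- The matrix of inner products `⟪x i, y j⟫`. -/
def gramMat {ι : Type*} (x y : ι → E) : Matrix ι ι ℂ := Matrix.of fun i j => inner ℂ (x i) (y j)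

/-- `det (1 + (⟪x i, y j⟫)_{i, j < n})`. -/
def gramDet (x y : ℕ → E) (n : ℕ) : ℂ :=
  (1 + gramMat (fun i : Fin n => x i) (fun i : Fin n => y i)).det

lemma det_one_add_gramMat_comp {ι κ : Type*} [Fintype ι] [DecidableEq ι] [Fintype κ]
    [DecidableEq κ] (e : ι ≃ κ) (x y : κ → E) :
    (1 + gramMat (x ∘ e) (y ∘ e)).det = (1 + gramMat x y).det := by
  rw [← det_submatrix_equiv_self e (1 + gramMat x y)]
  congr 1
  ext i j
  simp [gramMat, Matrix.one_apply]

/-- The finite rank form of det(I + T + a⟨b, ·⟩) = det(I + T)(1 + ⟨b, (I + T)⁻¹ a⟩). Substituting a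
= h + Th in the new column factors the matrix into block triangular ones; only a solution h is
needed, not invertibility of I + T. -/
lemma det_one_add_gramMat_sum {ι : Type*} [Fintype ι] [DecidableEq ι] (x y : ι → E) (a b h : E)
    (hh : h + ∑ i, inner ℂ (x i) h • y i = a) :
    (1 + gramMat (Sum.elim (fun _ : Fin 1 => b) x) (Sum.elim (fun _ : Fin 1 => a) y)).det =
      (1 + gramMat x y).det * (1 + inner ℂ b h) := by
  have hfac : 1 + gramMat (Sum.elim (fun _ : Fin 1 => b) x) (Sum.elim (fun _ : Fin 1 => a) y) =
      fromBlocks ((1 + inner ℂ b h) • (1 : Matrix (Fin 1) (Fin 1) ℂ))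
        (Matrix.of fun _ j => inner ℂ b (y j)) 0 (1 + gramMat x y) *
      fromBlocks 1 0 (Matrix.of fun i _ => inner ℂ (x i) h) 1 := by
    rw [fromBlocks_multiply]
    ext i j
    rcases i with i | i <;> rcases j with j | j
    · obtain rfl := Subsingleton.elim i 0
      obtain rfl := Subsingleton.elim j 0
      simp only [gramMat, Matrix.add_apply, Matrix.one_apply, if_true, of_apply, Sum.elim_inl,
        fromBlocks_apply₁₁, Matrix.mul_one, Matrix.smul_apply, smul_eq_mul, mul_one, mul_apply]
      rw [← hh, inner_add_right, inner_sum]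
      simp only [inner_smul_right, mul_comm]
      ring
    · simp [gramMat]
    · simp only [gramMat, Matrix.add_apply, Matrix.one_apply, reduceCtorEq, if_false, of_apply,
        Sum.elim_inr, Sum.elim_inl, fromBlocks_apply₂₁, Matrix.zero_mul, mul_apply,
        zero_add, add_mul, Finset.sum_add_distrib, ite_mul, one_mul, zero_mul, Finset.sum_ite_eq,
        Finset.mem_univ, if_true]
      rw [← hh, inner_add_right, inner_sum]
      simp only [inner_smul_right, mul_comm]
    · simp [gramMat, Matrix.one_apply]
  rw [hfac, det_mul, det_fromBlocks_zero₂₁, det_fromBlocks_zero₁₂]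
  simp [mul_comm]

/-- Appending a term at the end serves to bound the limiting determinant from below; prepending one,
as in `gramDet_cons`, serves the rank one perturbation. -/
lemma gramDet_succ (x y : ℕ → E) (n : ℕ) (h : E)
    (hh : h + ∑ i ∈ Finset.range n, inner ℂ (x i) h • y i = y n) :
    gramDet x y (n + 1) = gramDet x y n * (1 + inner ℂ (x n) h) := by
  rw [gramDet, gramDet, ← det_one_add_gramMat_sum (fun i : Fin n => x i) (fun i : Fin n => y i)
    (y n) (x n) h (by rw [← hh, Finset.sum_range]),
    ← det_one_add_gramMat_comp ((Equiv.sumComm (Fin 1) (Fin n)).trans finSumFinEquiv)]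
  congr 3
  · ext i
    rcases i with i | i <;> simp
  · ext i
    rcases i with i | i <;> simp

/-- The sequence `b, x 0, x 1, …`. -/
def consSeq (b : E) (x : ℕ → E) : ℕ → E
  | 0 => b
  | k + 1 => x k

lemma gramDet_cons (x y : ℕ → E) (n : ℕ) (a b h : E)
    (hh : h + ∑ i ∈ Finset.range n, inner ℂ (x i) h • y i = a) :
    gramDet (consSeq b x) (consSeq a y) (n + 1)
      = gramDet x y n * (1 + inner ℂ b h) := by
  rw [gramDet, gramDet, ← det_one_add_gramMat_sum (fun i : Fin n => x i) (fun i : Fin n => y i)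
    a b h (by rw [← hh, Finset.sum_range]),
    ← det_one_add_gramMat_comp (finSumFinEquiv.trans (finCongr (Nat.add_comm 1 n)))]
  congr 3
  · ext i
    rcases i with i | i <;> simp [consSeq]
  · ext i
    rcases i with i | i <;> simp [consSeq]

/-- A null vector c of the matrix produces f = ∑ c_j y_j with ⟨x_i, f⟩ = -c_i, so f solves the
homogeneous equation, and f = 0 gives c = 0. -/
lemma gramDet_ne_zero (x y : ℕ → E) (n : ℕ)
    (hinj : ∀ f : E, f + ∑ i ∈ Finset.range n, inner ℂ (x i) f • y i = 0 → f = 0) :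
    gramDet x y n ≠ 0 := by
  intro h0
  obtain ⟨c, hc, hc0⟩ := Matrix.exists_mulVec_eq_zero_iff.2 h0
  have hk : ∀ i : Fin n, c i + ∑ j : Fin n, inner ℂ (x i) (y j) * c j = 0 := by
    intro i
    have := congrFun hc0 i
    rw [add_mulVec, one_mulVec] at this
    simpa [gramMat, mulVec, dotProduct] using this
  set f : E := ∑ j : Fin n, c j • y j with hf
  have hxf : ∀ i : Fin n, inner ℂ (x i) f = -c i := by
    intro i
    have h1 := hk i
    rw [hf, inner_sum]
    simp only [inner_smul_right]
    simp only [mul_comm] at h1 ⊢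
    linear_combination h1
  have hf0 : f = 0 := by
    apply hinj
    rw [Finset.sum_range]
    simp only [hxf, neg_smul, Finset.sum_neg_distrib, ← hf, add_neg_cancel]
  apply hc
  ext i
  have := hxf i
  rw [hf0, inner_zero_right] at this
  simpa using this.symm

end GramDeterminants

/-! ### The Fredholm determinant as a limit of finite rank determinants. -/

section FredholmDeterminant

open Matrix InnerProductSpace

variable {E : Type} [NormedAddCommGroup E] [InnerProductSpace ℂ E]

/-- The matrix of coefficients with respect to a finite part of an orthonormal basis. -/
lemma norm_coeff_le {ι : Type} {b : ι → E} (hb : Orthonormal ℂ b) (s : Finset ι) (y : E) :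
    ‖WithLp.toLp 2 (fun i : s => inner ℂ (b i) y)‖ ≤ ‖y‖ := by
  rw [EuclideanSpace.norm_eq]
  refine Real.sqrt_le_iff.2 ⟨norm_nonneg _, ?_⟩
  have := hb.sum_inner_products_le y (s := s)
  rw [← Finset.sum_coe_sort] at this
  exact this

lemma norm_coeff_le' {ι : Type} {b : ι → E} (hb : Orthonormal ℂ b) (s : Finset ι) (x : E) :
    ‖WithLp.toLp 2 (fun i : s => inner ℂ x (b i))‖ ≤ ‖x‖ := by
  refine le_trans (le_of_eq ?_) (norm_coeff_le hb s x)
  simp only [EuclideanSpace.norm_eq]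
  congr 1
  refine Finset.sum_congr rfl fun i _ => ?_
  rw [norm_inner_symm]

open Classical in
/-- `det (1 + P Tₙ P)` for `Tₙ = ∑_{k < n} ⟪x k, ·⟫ y k` and `P` the projection onto the span of
`(b i)_{i ∈ s}`. -/
def cutDet {ι : Type} (b : ι → E) (x y : ℕ → E) (n : ℕ) (s : Finset ι) : ℂ :=
  (1 + rankSum (fun k (i : s) => inner ℂ (b i) (y k)) (fun k (i : s) => inner ℂ (x k) (b i)) n).det

/-- The point is that C does not depend on s: the coefficient vectors in any finite orthonormal
family are no longer than the vectors themselves, by Bessel. This uniformity lets the limits in n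
and s be exchanged. -/
lemma norm_cutDet_sub_le {ι : Type} {b : ι → E} (hb : Orthonormal ℂ b) (x y : ℕ → E)
    (hs : Summable fun k => ‖x k‖ * ‖y k‖) :
    ∃ C : ℝ, 0 ≤ C ∧ ∀ (s : Finset ι) (n m : ℕ), n ≤ m →
      ‖cutDet b x y m s - cutDet b x y n s‖ ≤
        C * ∑ k ∈ Finset.Ico n m, ‖x k‖ * ‖y k‖ := by
  set B := ∑' k, ‖x k‖ * ‖y k‖
  refine ⟨2 * Real.exp ((B + 1) + (B + 1) ^ 2 / 2), by positivity, fun s n m hnm => ?_⟩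
  induction m, hnm using Nat.le_induction with
  | base => simp
  | succ m hnm ih =>
    rw [Finset.sum_Ico_succ_top hnm, mul_add]
    classical
    have h1 := norm_det_succ_sub_le (fun k (i : s) => inner ℂ (b i) (y k))
      (fun k (i : s) => inner ℂ (x k) (b i)) (fun k => ‖x k‖ * ‖y k‖) (fun k => by
        rw [mul_comm ‖x k‖]
        exact mul_le_mul (norm_coeff_le hb s (y k)) (norm_coeff_le' hb s (x k))
          (norm_nonneg _) (norm_nonneg _)) m B
      (hs.sum_le_tsum _ fun k _ => by positivity)
    have h2 : cutDet b x y (m + 1) s - cutDet b x y n s =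
        (cutDet b x y m s - cutDet b x y n s) + (cutDet b x y (m + 1) s - cutDet b x y m s) := by
      ring
    rw [h2]
    refine (norm_add_le _ _).trans (add_le_add ih ?_)
    rw [mul_comm _ (‖x m‖ * ‖y m‖)]
    exact h1

/-- det(1 + AB) = det(1 + BA) replaces the growing s × s matrix by an n × n one, whose entries
converge by Parseval. -/
lemma tendsto_cutDet_gramDet {ι : Type} (b : HilbertBasis ι ℂ E) (x y : ℕ → E) (n : ℕ) :
    Tendsto (cutDet b x y n) atTop (𝓝 (gramDet x y n)) := by
  classical
  have h1 : ∀ s, cutDet b x y n s = (1 + Matrix.of fun k l : Fin n =>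
      ∑ i ∈ s, inner ℂ (x k) (b i) * inner ℂ (b i) (y l)).det := by
    intro s
    have hA : rankSum (fun k (i : s) => inner ℂ (b i) (y k))
        (fun k (i : s) => inner ℂ (x k) (b i)) n =
        (Matrix.of fun (i : s) (k : Fin n) => inner ℂ (b i) (y k)) *
        (Matrix.of fun (k : Fin n) (i : s) => inner ℂ (x k) (b i)) := by
      ext i j
      simp only [rankSum, Finset.sum_range, Matrix.sum_apply, vecMulVec_apply, mul_apply, of_apply]
    rw [cutDet, hA, det_one_add_mul_comm]
    congr 2
    ext k l
    simp only [mul_apply, of_apply]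
    exact Finset.sum_coe_sort s (fun i => inner ℂ (x k) (b i) * inner ℂ (b i) (y l))
  simp only [funext h1]
  refine ((continuous_id.matrix_det).tendsto _).comp ?_
  refine tendsto_const_nhds.add ?_
  refine tendsto_pi_nhds.2 fun k => tendsto_pi_nhds.2 fun l => ?_
  exact b.hasSum_inner_mul_inner (x k) (y l)

open Classical in
lemma tendsto_cutDet_compression {ι : Type} (b : ι → E) {T : E →L[ℂ] E} {x y : ℕ → E}
    (hT : ∀ f, HasSum (fun n => inner ℂ (x n) f • y n) (T f)) (s : Finset ι) :
    Tendsto (fun n => cutDet b x y n s) atTop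
      (𝓝 ((1 : Matrix s s ℂ) + Matrix.of fun i j : s => inner ℂ (b i) (T (b j))).det) := by
  refine ((continuous_id.matrix_det).tendsto _).comp ?_
  refine tendsto_const_nhds.add ?_
  refine tendsto_pi_nhds.2 fun i => tendsto_pi_nhds.2 fun j => ?_
  have h1 := ((hT (b j)).mapL (innerSL ℂ (b i))).tendsto_sum_nat
  refine h1.congr fun n => ?_
  simp only [rankSum, Matrix.sum_apply, vecMulVec_apply, innerSL_apply_apply,
    inner_smul_right, mul_comm]

/-- An arbitrary orthonormal basis is chosen only to carry the uniform estimate for compressions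
over to the Gram determinants, which are then Cauchy. -/
lemma exists_tendsto_gramDet [CompleteSpace E] {x y : ℕ → E}
    (hs : Summable fun k => ‖x k‖ * ‖y k‖) : ∃ d, Tendsto (gramDet x y) atTop (𝓝 d) := by
  obtain ⟨w, b, -⟩ := exists_hilbertBasis ℂ E
  obtain ⟨C, hC, hle⟩ := norm_cutDet_sub_le b.orthonormal x y hs
  refine cauchySeq_tendsto_of_complete (cauchySeq_of_le_tendsto_0'
    (fun n => C * ∑' k, ‖x (k + n)‖ * ‖y (k + n)‖) (fun n m hnm => ?_) ?_)
  · rw [dist_comm, dist_eq_norm]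
    refine le_of_tendsto ((tendsto_cutDet_gramDet b x y m).sub
      (tendsto_cutDet_gramDet b x y n)).norm (Eventually.of_forall fun s => ?_)
    refine (hle s n m hnm).trans (mul_le_mul_of_nonneg_left ?_ hC)
    rw [Finset.sum_Ico_eq_sum_range]
    simp only [Nat.add_comm n]
    exact ((summable_nat_add_iff n).2 hs).sum_le_tsum _ fun k _ => by positivity
  · simpa using (tendsto_sum_nat_add fun k => ‖x k‖ * ‖y k‖).const_mul C

/-- A three-epsilon argument: compression of T, compression of its n-th truncation, Gram
determinant, d. The first distance is small uniformly in s, so n is fixed before s grows. -/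
lemma hasFredholmDet_of_tendsto {T : E →L[ℂ] E} {x y : ℕ → E}
    (hs : Summable fun k => ‖x k‖ * ‖y k‖)
    (hT : ∀ f, HasSum (fun n => inner ℂ (x n) f • y n) (T f)) {d : ℂ}
    (hd : Tendsto (gramDet x y) atTop (𝓝 d)) : HasFredholmDet T d := by
  intro ι b
  obtain ⟨C, hC, hle⟩ := norm_cutDet_sub_le b.orthonormal x y hs
  have htail : Tendsto (fun n => C * ∑' k, ‖x (k + n)‖ * ‖y (k + n)‖) atTop (𝓝 0) := by
    simpa using (tendsto_sum_nat_add fun k => ‖x k‖ * ‖y k‖).const_mul C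
  classical
  have hunif : ∀ (s : Finset ι) (n : ℕ), ‖((1 : Matrix s s ℂ) + Matrix.of fun i j : s =>
      inner ℂ (b i) (T (b j))).det - cutDet b x y n s‖ ≤
      C * ∑' k, ‖x (k + n)‖ * ‖y (k + n)‖ := by
    intro s n
    refine le_of_tendsto ((tendsto_cutDet_compression b hT s).sub_const _).norm ?_
    filter_upwards [eventually_ge_atTop n] with m hnm
    refine (hle s n m hnm).trans (mul_le_mul_of_nonneg_left ?_ hC)
    rw [Finset.sum_Ico_eq_sum_range]
    simp only [Nat.add_comm n]
    exact ((summable_nat_add_iff n).2 hs).sum_le_tsum _ fun k _ => by positivity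
  rw [Metric.tendsto_nhds]
  intro ε hε
  obtain ⟨n, hn1, hn2⟩ := ((htail.eventually (gt_mem_nhds (show 0 < ε / 3 by positivity))).and
    (Metric.tendsto_nhds.1 hd (ε / 3) (by positivity))).exists
  filter_upwards [Metric.tendsto_nhds.1 (tendsto_cutDet_gramDet b x y n) (ε / 3) (by positivity)]
    with s hsε
  have h1 := hunif s n
  rw [← dist_eq_norm] at h1
  calc _ ≤ _ := dist_triangle4 _ (cutDet b x y n s) (gramDet x y n) d
    _ < ε / 3 + ε / 3 + ε / 3 := by
      refine add_lt_add (add_lt_add (h1.trans_lt hn1) hsε) hn2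
    _ = ε := by ring

end FredholmDeterminant

/-! ### Determinants under a rank one perturbation. -/

section RankOnePerturbation

open InnerProductSpace

variable {E : Type} [NormedAddCommGroup E] [InnerProductSpace ℂ E]

lemma isTraceClass_add_rankOne {T : E →L[ℂ] E} (hT : IsTraceClass T) (a b : E) :
    IsTraceClass (T + rankOne ℂ a b) := by
  obtain ⟨x, y, hs, hxy⟩ := hT
  refine ⟨consSeq b x, consSeq a y, (summable_nat_add_iff 1).1 hs, fun f => ?_⟩
  rw [← hasSum_nat_add_iff' 1]
  simpa [consSeq] using hxy f

variable [CompleteSpace E]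

lemma tendsto_sum_rankOne {T : E →L[ℂ] E} {x y : ℕ → E}
    (hs : Summable fun k => ‖x k‖ * ‖y k‖)
    (hT : ∀ f, HasSum (fun n => inner ℂ (x n) f • y n) (T f)) :
    Tendsto (fun n => ∑ k ∈ Finset.range n, rankOne ℂ (y k) (x k)) atTop (𝓝 T) := by
  have h1 : Summable fun k => rankOne ℂ (y k) (x k) :=
    Summable.of_norm_bounded hs fun k => by rw [norm_rankOne, mul_comm]
  have h2 : ∑' k, rankOne ℂ (y k) (x k) = T := by
    ext f
    have h3 := h1.hasSum.mapL (ContinuousLinearMap.apply ℂ E f)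
    exact h3.unique (by simpa using hT f)
  simpa [h2] using h1.hasSum.tendsto_sum_nat

omit [CompleteSpace E] in
lemma isCompactOperator_rankOne (a b : E) : IsCompactOperator (rankOne ℂ a b) := by
  have h : IsCompactOperator (ContinuousLinearMap.toSpanSingleton ℂ a) :=
    isCompactOperator_of_locallyCompactSpace_rng _
  exact h.comp_clm (innerSL ℂ b)

omit [CompleteSpace E] in
lemma isCompactOperator_sum_rankOne (x y : ℕ → E) (n : ℕ) :
    IsCompactOperator (∑ k ∈ Finset.range n, rankOne ℂ (y k) (x k) : E →L[ℂ] E) := by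
  induction n with
  | zero => simpa using! (isCompactOperator_zero : IsCompactOperator (0 : E → E))
  | succ n ih =>
    rw [Finset.sum_range_succ]
    exact ih.add (isCompactOperator_rankOne _ _)

/-- The Fredholm alternative at the spectral value -1. -/
lemma isUnit_one_add_of_injective {T : E →L[ℂ] E} (hT : IsCompactOperator T)
    (hinj : ∀ f, f + T f = 0 → f = 0) : IsUnit (1 + T) := by
  rcases hT.hasEigenvalue_or_mem_resolventSet (μ := (-1 : ℂ)) (by norm_num) with h | h
  · obtain ⟨f, hf⟩ := h.exists_hasEigenvector
    refine absurd (hinj f ?_) hf.2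
    have := hf.apply_eq_smul
    simp only [ContinuousLinearMap.coe_coe] at this
    rw [this]
    simp
  · have h2 : IsUnit (algebraMap ℂ (E →L[ℂ] E) (-1) - T) := h
    rw [map_neg, map_one] at h2
    convert h2.neg using 1
    abel

/-- Determinants of `I + T` and of a rank one perturbation, when `I + T` is injective. -/
theorem exists_hasFredholmDet_add_rankOne {T : E →L[ℂ] E} (hT : IsTraceClass T)
    (hinj : ∀ f, f + T f = 0 → f = 0) (a b h : E) (hh : h + T h = a) :
    ∃ d d' : ℂ, HasFredholmDet T d ∧ HasFredholmDet (T + rankOne ℂ a b) d' ∧ d ≠ 0 ∧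
      d' / d = 1 + inner ℂ b h := by
  obtain ⟨x, y, hs, hxy⟩ := hT
  obtain ⟨d, hd⟩ := exists_tendsto_gramDet hs
  set A : ℕ → E →L[ℂ] E := fun n => ∑ k ∈ Finset.range n, rankOne ℂ (y k) (x k) with hA
  have hAT : Tendsto A atTop (𝓝 T) := tendsto_sum_rankOne hs hxy
  have hAf : ∀ n f, A n f = ∑ k ∈ Finset.range n, inner ℂ (x k) f • y k := by
    intro n f
    simp [hA]
  have hunit : IsUnit (1 + T) := by
    refine isUnit_one_add_of_injective (isCompactOperator_of_tendsto hAT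
      (Eventually.of_forall fun n => ?_)) hinj
    exact isCompactOperator_sum_rankOne x y n
  have hAT1 : Tendsto (fun n => 1 + A n) atTop (𝓝 (1 + T)) := tendsto_const_nhds.add hAT
  have hunits : ∀ᶠ n in atTop, IsUnit (1 + A n) :=
    hAT1.eventually (Units.isOpen.mem_nhds hunit)
  set S : ℕ → E →L[ℂ] E := fun n => Ring.inverse (1 + A n) with hSdef
  have hS : Tendsto S atTop (𝓝 (Ring.inverse (1 + T))) := by
    obtain ⟨u, hu⟩ := hunit
    have := NormedRing.inverse_continuousAt u
    rw [hu] at this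
    exact this.tendsto.comp hAT1
  have hSeq : ∀ n, IsUnit (1 + A n) → ∀ g : E,
      S n g + ∑ k ∈ Finset.range n, inner ℂ (x k) (S n g) • y k = g := by
    intro n hn g
    have h1 : S n g + A n (S n g) = g := congrArg (fun B : E →L[ℂ] E => B g)
      (Ring.mul_inverse_cancel _ hn)
    rw [hAf] at h1
    exact h1
  have hSinj : ∀ n, IsUnit (1 + A n) → gramDet x y n ≠ 0 := by
    intro n hn
    refine gramDet_ne_zero x y n fun f hf => ?_
    have h1 : S n (f + A n f) = f := congrArg (fun B : E →L[ℂ] E => B f)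
      (Ring.inverse_mul_cancel _ hn)
    rw [hAf, hf, map_zero] at h1
    exact h1.symm
  have hha : Ring.inverse (1 + T) a = h := by
    have h1 : Ring.inverse (1 + T) (h + T h) = h := congrArg (fun B : E →L[ℂ] E => B h)
      (Ring.inverse_mul_cancel _ hunit)
    rwa [hh] at h1
  -- Consecutive Gram determinants have quotient 1 + ⟨x_m, S_m y_m⟩, where S_m inverts the
  -- truncation and is eventually bounded by C. Beyond an N at which the tail C ∑ ‖x_k‖‖y_k‖ is
  -- below 1/2, the product of these quotients keeps at least half of the nonzero value at N.
  have hd0 : d ≠ 0 := by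
    obtain ⟨C, hC⟩ : ∃ C : ℝ, ∀ᶠ n in atTop, ‖S n‖ ≤ C :=
      ⟨‖Ring.inverse (1 + T)‖ + 1, hS.norm.eventually_le_const (by linarith)⟩
    have hC0 : 0 ≤ C := by
      obtain ⟨n, hn⟩ := hC.exists
      exact (norm_nonneg _).trans hn
    have htail : ∀ᶠ N in atTop, C * ∑' k, ‖x (k + N)‖ * ‖y (k + N)‖ < 1 / 2 := by
      have : Tendsto (fun n => C * ∑' k, ‖x (k + n)‖ * ‖y (k + n)‖) atTop (𝓝 0) := by
        simpa using (tendsto_sum_nat_add fun k => ‖x k‖ * ‖y k‖).const_mul C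
      exact this.eventually (gt_mem_nhds (by norm_num))
    obtain ⟨N, ⟨hN1, hN2⟩, hN3⟩ :=
      ((eventually_forall_ge_atTop.2 hC).and (eventually_forall_ge_atTop.2 hunits)).and htail
      |>.exists
    have hpart : ∀ m, N ≤ m → C * ∑ k ∈ Finset.Ico N m, ‖x k‖ * ‖y k‖ ≤ 1 / 2 := by
      intro m _
      refine le_trans (mul_le_mul_of_nonneg_left ?_ hC0) hN3.le
      rw [Finset.sum_Ico_eq_sum_range]
      simp only [Nat.add_comm N]
      exact ((summable_nat_add_iff N).2 hs).sum_le_tsum _ fun k _ => by positivity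
    -- This is ∏ (1 - t_k) ≥ 1 - ∑ t_k in inductive form.
    have hlow : ∀ m, N ≤ m → ‖gramDet x y N‖ * (1 - C * ∑ k ∈ Finset.Ico N m, ‖x k‖ * ‖y k‖)
        ≤ ‖gramDet x y m‖ := by
      intro m hm
      induction m, hm using Nat.le_induction with
      | base => simp
      | succ m hm ih =>
        rw [gramDet_succ x y m (S m (y m)) (hSeq m (hN2 m hm) _), norm_mul]
        have h1 : ‖inner ℂ (x m) (S m (y m))‖ ≤ C * (‖x m‖ * ‖y m‖) := by
          calc _ ≤ ‖x m‖ * ‖S m (y m)‖ := norm_inner_le_norm _ _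
            _ ≤ ‖x m‖ * (C * ‖y m‖) := by
                gcongr
                exact (S m).le_of_opNorm_le (hN1 m hm) _
            _ = _ := by ring
        have h2 : 1 - C * (‖x m‖ * ‖y m‖) ≤ ‖1 + inner ℂ (x m) (S m (y m))‖ := by
          have := norm_sub_le (1 + inner ℂ (x m) (S m (y m))) (inner ℂ (x m) (S m (y m)))
          rw [add_sub_cancel_right, norm_one] at this
          linarith
        have h3 := hpart m hm
        have h4 := hpart (m + 1) (by omega)
        rw [Finset.sum_Ico_succ_top hm, mul_add] at h4 ⊢
        have h6 : 0 ≤ C * ∑ k ∈ Finset.Ico N m, ‖x k‖ * ‖y k‖ :=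
          mul_nonneg hC0 (Finset.sum_nonneg fun k _ => by positivity)
        have h7 : 0 ≤ C * (‖x m‖ * ‖y m‖) := by positivity
        set σ := C * ∑ k ∈ Finset.Ico N m, ‖x k‖ * ‖y k‖
        set τ := C * (‖x m‖ * ‖y m‖)
        calc ‖gramDet x y N‖ * (1 - (σ + τ)) ≤ ‖gramDet x y N‖ * ((1 - σ) * (1 - τ)) := by
              refine mul_le_mul_of_nonneg_left ?_ (norm_nonneg _)
              nlinarith [mul_nonneg h6 h7]
          _ = (‖gramDet x y N‖ * (1 - σ)) * (1 - τ) := by ring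
          _ ≤ ‖gramDet x y m‖ * ‖1 + inner ℂ (x m) (S m (y m))‖ :=
              mul_le_mul ih h2 (by linarith) (norm_nonneg _)
    have hge : ‖gramDet x y N‖ / 2 ≤ ‖d‖ := by
      refine ge_of_tendsto hd.norm ?_
      filter_upwards [eventually_ge_atTop N] with m hm
      refine le_trans ?_ (hlow m hm)
      have := hpart m hm
      rw [div_eq_mul_inv]
      refine mul_le_mul_of_nonneg_left ?_ (norm_nonneg _)
      linarith
    have := norm_pos_iff.2 (hSinj N (hN2 N le_rfl))
    exact norm_pos_iff.1 (lt_of_lt_of_le (by positivity) hge)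
  refine ⟨d, d * (1 + inner ℂ b h), hasFredholmDet_of_tendsto hs hxy hd, ?_, hd0, by field_simp⟩
  refine hasFredholmDet_of_tendsto (x := consSeq b x) (y := consSeq a y)
    ((summable_nat_add_iff 1).1 hs) (fun f => ?_) ((tendsto_add_atTop_iff_nat 1).1 ?_)
  · rw [← hasSum_nat_add_iff' 1]
    simpa [consSeq] using hxy f
  -- The exact identity holds for each invertible truncation with its own solution S_n a, and S_n a
  -- → (1 + T)⁻¹ a = h.
  · have h1 : Tendsto (fun n => gramDet x y n * (1 + inner ℂ b (S n a))) atTop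
        (𝓝 (d * (1 + inner ℂ b h))) := by
      refine hd.mul (tendsto_const_nhds.add ?_)
      rw [← hha]
      refine ((innerSL ℂ b).continuous.tendsto _).comp ?_
      exact ((ContinuousLinearMap.apply ℂ E a).continuous.tendsto _).comp hS
    refine h1.congr' ?_
    filter_upwards [hunits] with n hn
    exact (gramDet_cons x y n a b _ (hSeq n hn a)).symm

end RankOnePerturbation

/-! ### Graphs of products, closures and resolvents of partial operators. -/

section Operators

variable {E F G : Type*} [NormedAddCommGroup E] [NormedSpace ℂ E]
  [NormedAddCommGroup F] [NormedSpace ℂ F] [NormedAddCommGroup G] [NormedSpace ℂ G]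

/-- On graphs a product of partial operators is a composition of relations, which removes the domain
proofs from later computations. -/
lemma mem_pcomp_graph {S : F →ₗ.[ℂ] G} {T : E →ₗ.[ℂ] F} {x : E} {w : G} :
    (x, w) ∈ (pcomp S T).graph ↔ ∃ y, (x, y) ∈ T.graph ∧ (y, w) ∈ S.graph := by
  simp only [LinearPMap.mem_graph_iff]
  constructor
  · rintro ⟨⟨_, x, hx, rfl⟩, rfl, rfl⟩
    exact ⟨T x, ⟨x, rfl, rfl⟩, ⟨⟨T x, hx⟩, rfl, rfl⟩⟩
  · rintro ⟨y, ⟨x, rfl, rfl⟩, ⟨y, hy, rfl⟩⟩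
    have hx : x ∈ S.domain.comap T.toFun := by
      change T x ∈ S.domain
      exact hy ▸ y.2
    refine ⟨⟨x, x, hx, rfl⟩, rfl, ?_⟩
    exact congrArg S (Subtype.ext hy.symm)

lemma mem_toPMap_top_graph {K : E →L[ℂ] F} {x : E} {y : F} :
    (x, y) ∈ ((K : E →ₗ[ℂ] F).toPMap ⊤).graph ↔ y = K x := by
  rw [LinearPMap.mem_graph_iff]
  constructor
  · rintro ⟨x, rfl, rfl⟩
    rfl
  · rintro rfl
    exact ⟨⟨x, trivial⟩, rfl, rfl⟩

/-- The graph of K is closed and contains that of S; conversely x ↦ (x, Kx) is continuous and maps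
the dense domain of S into the graph of S. -/
lemma hasBoundedClosure_of_graph {S : E →ₗ.[ℂ] F} {K : E →L[ℂ] F}
    (hd : Dense (S.domain : Set E)) (hS : ∀ x y, (x, y) ∈ S.graph → y = K x) :
    HasBoundedClosure S K := by
  have hle : S.graph ≤ ((K : E →ₗ[ℂ] F).toPMap ⊤).graph := fun ⟨x, y⟩ hxy =>
    mem_toPMap_top_graph.2 (hS x y hxy)
  have hcl : IsClosed ((((K : E →ₗ[ℂ] F).toPMap ⊤).graph : Submodule ℂ (E × F)) : Set (E × F)) := by
    have : ((((K : E →ₗ[ℂ] F).toPMap ⊤).graph : Submodule ℂ (E × F)) : Set (E × F)) =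
        {p | p.2 = K p.1} := by
      ext ⟨x, y⟩
      exact mem_toPMap_top_graph
    rw [this]
    exact isClosed_eq continuous_snd (K.continuous.comp continuous_fst)
  have heq : S.graph.topologicalClosure = ((K : E →ₗ[ℂ] F).toPMap ⊤).graph := by
    refine le_antisymm (Submodule.topologicalClosure_minimal _ hle hcl) ?_
    rintro ⟨x, y⟩ hxy
    rw [mem_toPMap_top_graph] at hxy
    subst hxy
    change (x, K x) ∈ closure (S.graph : Set (E × F))
    have hc : Continuous fun x : E => (x, K x) := by fun_prop
    have hmaps : MapsTo (fun x : E => (x, K x)) (S.domain : Set E) (S.graph : Set (E × F)) := by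
      intro x hx
      have h1 := S.mem_graph ⟨x, hx⟩
      rw [hS _ _ h1] at h1
      exact h1
    exact hmaps.closure hc (hd x)
  have hclos : S.IsClosable := ⟨_, heq⟩
  refine LinearPMap.eq_of_eq_graph ?_
  rw [← hclos.graph_closure_eq_closure_graph, heq]

/-- `R` is a bounded inverse of `A - z I`. -/
def IsResolventAt (A : E →ₗ.[ℂ] E) (z : ℂ) (R : E →L[ℂ] E) : Prop :=
  (∀ y : E, ∃ h : R y ∈ A.domain, A ⟨R y, h⟩ - z • R y = y) ∧
    ∀ x : A.domain, R (A x - z • (x : E)) = x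

lemma IsResolventAt.mem_graph {A : E →ₗ.[ℂ] E} {z : ℂ} {R : E →L[ℂ] E}
    (hR : IsResolventAt A z R) (y : E) : (R y, y + z • R y) ∈ A.graph := by
  obtain ⟨h, hy⟩ := hR.1 y
  rw [LinearPMap.mem_graph_iff]
  exact ⟨⟨R y, h⟩, rfl, sub_eq_iff_eq_add.1 hy⟩

lemma IsResolventAt.eq_of_mem_graph {A : E →ₗ.[ℂ] E} {z : ℂ} {R : E →L[ℂ] E}
    (hR : IsResolventAt A z R) {x y : E} (h : (x, y) ∈ A.graph) : R (y - z • x) = x := by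
  obtain ⟨x, rfl, rfl⟩ := (LinearPMap.mem_graph_iff _).1 h
  exact hR.2 x

/-- Criterion for a bounded inverse in terms of the graph. -/
lemma isResolventAt_of_graph {A : E →ₗ.[ℂ] E} {z : ℂ} {R : E →L[ℂ] E}
    (h1 : ∀ y, (R y, y + z • R y) ∈ A.graph) (h2 : ∀ x, (x, z • x) ∈ A.graph → x = 0) :
    IsResolventAt A z R := by
  refine ⟨fun y => ?_, fun x => ?_⟩
  · obtain ⟨x, hx, hy⟩ := (LinearPMap.mem_graph_iff _).1 (h1 y)
    have hmem : R y ∈ A.domain := by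
      rw [← show (x : E) = R y from hx]
      exact x.2
    refine ⟨hmem, ?_⟩
    have : (⟨R y, hmem⟩ : A.domain) = x := Subtype.ext hx.symm
    rw [this, hy]
    exact add_sub_cancel_right _ _
  · have e1 := h1 (A x - z • (x : E))
    have e2 := A.graph.sub_mem e1 (A.mem_graph x)
    rw [Prod.mk_sub_mk] at e2
    have := h2 (R (A x - z • (x : E)) - x) (by
      convert e2 using 2
      rw [smul_sub]
      abel)
    rwa [sub_eq_zero] at this

lemma IsResolventAt.mem_pinv_graph {A : E →ₗ.[ℂ] E} {z : ℂ} {R : E →L[ℂ] E}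
    (hR : IsResolventAt A z R) {x y : E} : (y, x) ∈ (pinv A z).graph ↔ x = R y := by
  have hval : ∀ x : (shift A z).domain, shift A z x = A ⟨x, x.2⟩ - z • (x : E) := by
    intro x
    change (-(z • (LinearMap.id : E →ₗ[ℂ] E))) (x : E) + A ⟨x, x.2⟩ = _
    simp only [LinearMap.neg_apply, LinearMap.smul_apply, LinearMap.id_coe, id_eq]
    abel
  have hker : LinearMap.ker (shift A z).toFun = ⊥ := by
    rw [LinearMap.ker_eq_bot']
    intro x hx
    have h1 : A ⟨x, x.2⟩ - z • (x : E) = 0 := (hval x).symm.trans hx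
    have h2 := hR.2 ⟨x, x.2⟩
    rw [h1, map_zero] at h2
    exact Subtype.ext h2.symm
  rw [pinv, LinearPMap.inverse_graph hker]
  simp only [Submodule.mem_map, Prod.exists, LinearPMap.mem_graph_iff]
  constructor
  · rintro ⟨a, b, ⟨x', rfl, rfl⟩, heq⟩
    have h3 : shift A z x' = y := congrArg Prod.fst heq
    have h4 : (x' : E) = x := congrArg Prod.snd heq
    rw [← h4, ← h3, hval]
    exact (hR.2 ⟨x', x'.2⟩).symm
  · rintro rfl
    obtain ⟨h, hy⟩ := hR.1 y
    exact ⟨R y, y, ⟨⟨R y, h⟩, rfl, (hval ⟨R y, h⟩).trans hy⟩, rfl⟩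

end Operators

/-! ### Multiplication operators, and countability of orthonormal families. -/

lemma mem_mulOp_graph {w : ℝ → ℂ} {f g : L2} :
    (f, g) ∈ (mulOp w).graph ↔ g =ᵐ[halfLineMeasure] fun x => w x * f x := by
  rw [LinearPMap.mem_graph_iff]
  constructor
  · rintro ⟨f, rfl, rfl⟩
    exact MemLp.coeFn_toLp f.2
  · intro h
    have hm : MemLp (fun x => w x * f x) 2 halfLineMeasure := (memLp_congr_ae h).1 (Lp.memLp g)
    refine ⟨⟨f, hm⟩, rfl, ?_⟩
    exact Lp.ext ((MemLp.coeFn_toLp hm).trans h.symm)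

/-- Simple functions are dense in L² and bounded, so their product with w stays in L². -/
lemma dense_mulOp_domain {w : ℝ → ℂ} (hw : MemLp w 2 halfLineMeasure) :
    Dense ((mulOp w).domain : Set L2) := by
  have h1 := Lp.simpleFunc.denseRange (E := ℂ) (p := 2) (μ := halfLineMeasure) (by norm_num)
  refine Dense.mono ?_ h1
  rintro _ ⟨f, rfl⟩
  change MemLp (fun x => w x * (f : L2) x) 2 halfLineMeasure
  have h2 : MemLp (Lp.simpleFunc.toSimpleFunc f) ⊤ halfLineMeasure :=
    SimpleFunc.memLp_top _ _
  refine (memLp_congr_ae ?_).1 (h2.mul hw (r := 2))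
  filter_upwards [Lp.simpleFunc.toSimpleFunc_eq_toFun f] with x hx
  simp only [Pi.mul_apply, hx]

/-- Distinct members are at distance at least 1, since ⟨v_i, v_i - v_j⟩ = 1, so the balls of radius
1/2 are disjoint. Countability lets expansions in a basis be indexed by ℕ, as `IsTraceClass`
demands. -/
lemma countable_of_orthonormal {E ι : Type*} [NormedAddCommGroup E] [InnerProductSpace ℂ E]
    [TopologicalSpace.SeparableSpace E] {v : ι → E} (hv : Orthonormal ℂ v) : Countable ι := by
  have h1 : (univ : Set ι).Countable := by
    refine Set.PairwiseDisjoint.countable_of_isOpen (s := fun i => Metric.ball (v i) (1 / 2))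
      (fun i _ j _ hij => ?_) (fun i _ => Metric.isOpen_ball)
      (fun i _ => Metric.nonempty_ball.2 (by norm_num))
    refine Metric.ball_disjoint_ball ?_
    have h2 : inner ℂ (v i) (v i - v j) = 1 := by
      rw [inner_sub_right, hv.2 hij, inner_self_eq_norm_sq_to_K, hv.1 i]
      simp
    have h3 := norm_inner_le_norm (𝕜 := ℂ) (v i) (v i - v j)
    rw [h2, hv.1 i, norm_one, one_mul] at h3
    rw [dist_eq_norm]
    linarith
  exact countable_univ_iff.1 h1

/-! ### Trace class operators as products of Hilbert–Schmidt operators. -/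

section TraceClass

variable {E : Type} [NormedAddCommGroup E] [InnerProductSpace ℂ E]

lemma isTraceClass_of_hasSum {ι : Type} [Countable ι] {T : E →L[ℂ] E} {x y : ι → E}
    (hs : Summable fun i => ‖x i‖ * ‖y i‖)
    (hT : ∀ f, HasSum (fun i => inner ℂ (x i) f • y i) (T f)) : IsTraceClass T := by
  obtain ⟨e, he⟩ := exists_injective_nat ι
  have hx : ∀ {F : Type} [NormedAddCommGroup F] (φ : E → E → F) (_ : φ 0 0 = 0),
      (fun n => φ (Function.extend e x 0 n) (Function.extend e y 0 n)) =
        Function.extend e (fun i => φ (x i) (y i)) 0 := by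
    intro F _ φ h0
    ext n
    by_cases hn : ∃ i, e i = n
    · obtain ⟨i, rfl⟩ := hn
      simp only [he.extend_apply]
    · simp only [Function.extend_apply' _ _ _ hn, Pi.zero_apply, h0]
  refine ⟨Function.extend e x 0, Function.extend e y 0, ?_, fun f => ?_⟩
  · have h1 := hx (fun a b => ‖a‖ * ‖b‖) (by simp)
    rw [h1]
    exact ⟨_, (hasSum_extend_zero he).2 hs.hasSum⟩
  · have h1 := hx (fun a b => inner ℂ a f • b) (by simp)
    rw [h1]
    exact (hasSum_extend_zero he).2 (hT f)

/-- The product of two Hilbert–Schmidt operators is of trace class. -/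
lemma isTraceClass_comp_adjoint [CompleteSpace E] {ι : Type} [Countable ι] (b : HilbertBasis ι ℂ E)
    (A B : E →L[ℂ] E) (hA : Summable fun i => ‖A (b i)‖ ^ 2)
    (hB : Summable fun i => ‖B (b i)‖ ^ 2) : IsTraceClass (A ∘L B.adjoint) := by
  refine isTraceClass_of_hasSum (x := fun i => B (b i)) (y := fun i => A (b i)) ?_ fun f => ?_
  · refine Summable.of_nonneg_of_le (fun i => by positivity) (fun i => ?_) (hA.add hB)
    nlinarith [sq_nonneg (‖A (b i)‖ - ‖B (b i)‖), sq_nonneg ‖A (b i)‖, sq_nonneg ‖B (b i)‖]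
  · have h1 := (b.hasSum_repr (B.adjoint f)).mapL A
    simp only [map_smul, b.repr_apply_apply, ContinuousLinearMap.adjoint_inner_right] at h1
    exact h1

end TraceClass

/-! ### Operators on L²((0, ∞)) given by pointwise formulas and kernels. -/

lemma norm_sq_eq_integral (f : L2) : ‖f‖ ^ 2 = ∫ x, ‖f x‖ ^ 2 ∂halfLineMeasure := by
  have h1 : inner ℂ f f = ((‖f‖ ^ 2 : ℝ) : ℂ) := by
    rw [inner_self_eq_norm_sq_to_K]
    push_cast
    rfl
  rw [L2.inner_def] at h1
  have h2 : ∀ x, inner ℂ (f x) (f x) = ((‖f x‖ ^ 2 : ℝ) : ℂ) := by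
    intro x
    rw [inner_self_eq_norm_sq_to_K]
    push_cast
    rfl
  simp only [h2] at h1
  rw [integral_complex_ofReal] at h1
  exact_mod_cast h1.symm

lemma inner_eq_integral (f g : L2) :
    inner ℂ f g = ∫ x, starRingEnd ℂ (f x) * g x ∂halfLineMeasure := by
  rw [L2.inner_def]
  refine integral_congr_ae (Eventually.of_forall fun x => ?_)
  simp [mul_comm]

lemma exists_clm_of_ae (Φ : L2 → ℝ → ℂ) (hadd : ∀ f g, Φ (f + g) =ᵐ[halfLineMeasure] Φ f + Φ g)
    (hsmul : ∀ (c : ℂ) f, Φ (c • f) =ᵐ[halfLineMeasure] c • Φ f)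
    (hmem : ∀ f, MemLp (Φ f) 2 halfLineMeasure) (C : ℝ) (hC : 0 ≤ C)
    (hb : ∀ f, ∫ x, ‖Φ f x‖ ^ 2 ∂halfLineMeasure ≤ C ^ 2 * ‖f‖ ^ 2) :
    ∃ T : L2 →L[ℂ] L2, ∀ f, T f =ᵐ[halfLineMeasure] Φ f := by
  let T₀ : L2 →ₗ[ℂ] L2 :=
    { toFun := fun f => (hmem f).toLp (Φ f)
      map_add' := by
        intro f g
        rw [← MemLp.toLp_add]
        exact MemLp.toLp_congr _ _ (hadd f g)
      map_smul' := by
        intro c f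
        rw [RingHom.id_apply, ← MemLp.toLp_const_smul]
        exact MemLp.toLp_congr _ _ (hsmul c f) }
  refine ⟨T₀.mkContinuous C fun f => ?_, fun f => MemLp.coeFn_toLp (hmem f)⟩
  refine le_of_sq_le_sq ?_ (by positivity)
  rw [norm_sq_eq_integral, mul_pow]
  refine le_trans (le_of_eq ?_) (hb f)
  refine integral_congr_ae ?_
  filter_upwards [MemLp.coeFn_toLp (hmem f)] with x hx
  rw [show (T₀ f) x = _ from hx]

/-- A bounded operator defined by a weakly measurable square integrable family of vectors is a
Hilbert–Schmidt operator. -/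
lemma exists_hilbertSchmidt (α : ℝ → L2) (g : ℝ → ℝ) (hg : MemLp g 2 halfLineMeasure)
    (hα : ∀ h, AEStronglyMeasurable (fun x => inner ℂ (α x) h) halfLineMeasure)
    (hαg : ∀ x, ‖α x‖ ≤ g x) :
    ∃ A : L2 →L[ℂ] L2, (∀ h, A h =ᵐ[halfLineMeasure] fun x => inner ℂ (α x) h) ∧
      ∀ (ι : Type) (b : ι → L2), Orthonormal ℂ b → Summable fun i => ‖A (b i)‖ ^ 2 := by
  have hint : Integrable (fun x => g x ^ 2) halfLineMeasure := hg.integrable_sq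
  have hle : ∀ h x, ‖(inner ℂ (α x) h : ℂ)‖ ≤ ‖‖h‖ * g x‖ := by
    intro h x
    have h0 : 0 ≤ g x := (norm_nonneg _).trans (hαg x)
    rw [Real.norm_of_nonneg (by positivity), mul_comm]
    exact (norm_inner_le_norm _ _).trans (by gcongr; exact hαg x)
  have hmem : ∀ h, MemLp (fun x => (inner ℂ (α x) h : ℂ)) 2 halfLineMeasure := fun h =>
    (hg.const_mul ‖h‖).of_le (hα h) (Eventually.of_forall (hle h))
  obtain ⟨A, hA⟩ := exists_clm_of_ae (fun h x => inner ℂ (α x) h)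
    (fun f h => Eventually.of_forall fun x => inner_add_right _ _ _)
    (fun c f => Eventually.of_forall fun x => inner_smul_right _ _ _) hmem
    (Real.sqrt (∫ x, g x ^ 2 ∂halfLineMeasure)) (Real.sqrt_nonneg _) (fun h => by
      rw [Real.sq_sqrt (integral_nonneg fun x => by positivity), mul_comm, ← integral_const_mul]
      refine integral_mono_of_nonneg (Eventually.of_forall fun x => by positivity)
        (hint.const_mul _) (Eventually.of_forall fun x => ?_)
      have := hle h x
      calc ‖(inner ℂ (α x) h : ℂ)‖ ^ 2 ≤ ‖‖h‖ * g x‖ ^ 2 := by gcongr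
        _ = _ := by rw [Real.norm_eq_abs, sq_abs, mul_pow])
  refine ⟨A, hA, fun ι b hb => ?_⟩
  refine summable_of_sum_le (c := ∫ x, g x ^ 2 ∂halfLineMeasure) (fun i => by positivity)
    fun s => ?_
  have h1 : ∀ i, ‖A (b i)‖ ^ 2 = ∫ x, ‖(inner ℂ (α x) (b i) : ℂ)‖ ^ 2 ∂halfLineMeasure := by
    intro i
    rw [norm_sq_eq_integral]
    refine integral_congr_ae ?_
    filter_upwards [hA (b i)] with x hx
    rw [hx]
  simp only [h1]
  rw [← integral_finsetSum _ fun i _ => (memLp_two_iff_integrable_sq_norm (hα _)).1 (hmem _)]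
  refine integral_mono_of_nonneg (Eventually.of_forall fun x => by positivity)
    hint (Eventually.of_forall fun x => ?_)
  -- Bessel's inequality is used at each fixed x and integrated afterwards, so ∫ g² bounds every
  -- finite partial sum.
  have h2 := hb.sum_inner_products_le (α x) (s := s)
  have h3 : ‖α x‖ ^ 2 ≤ g x ^ 2 := by
    gcongr
    exact hαg x
  refine le_trans (le_of_eq ?_) (h2.trans h3)
  refine Finset.sum_congr rfl fun i _ => ?_
  rw [norm_inner_symm]

/-- Operators whose integral kernel is `⟪α x, β y⟫` with square integrable families `α`, `β`. -/
theorem exists_isTraceClass_kernel (α β : ℝ → L2) (g h : ℝ → ℝ)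
    (hg : MemLp g 2 halfLineMeasure) (hh : MemLp h 2 halfLineMeasure)
    (hα : ∀ f, AEStronglyMeasurable (fun x => inner ℂ (α x) f) halfLineMeasure)
    (hβ : ∀ f, AEStronglyMeasurable (fun x => inner ℂ (β x) f) halfLineMeasure)
    (hαg : ∀ x, ‖α x‖ ≤ g x) (hβh : ∀ x, ‖β x‖ ≤ h x) :
    ∃ K : L2 →L[ℂ] L2, IsTraceClass K ∧ ∀ f, K f =ᵐ[halfLineMeasure]
      fun x => ∫ y, inner ℂ (α x) (β y) * f y ∂halfLineMeasure := by
  obtain ⟨A, hA, hA2⟩ := exists_hilbertSchmidt α g hg hα hαg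
  obtain ⟨B, hB, hB2⟩ := exists_hilbertSchmidt β h hh hβ hβh
  obtain ⟨w, b, -⟩ := exists_hilbertBasis ℂ L2
  have : Fact ((2 : ENNReal) ≠ ⊤) := ⟨by norm_num⟩
  have hc : Countable w := countable_of_orthonormal b.orthonormal
  refine ⟨A ∘L B.adjoint, isTraceClass_comp_adjoint b A B (hA2 _ _ b.orthonormal)
    (hB2 _ _ b.orthonormal), fun f => ?_⟩
  filter_upwards [hA (B.adjoint f)] with x hx
  rw [ContinuousLinearMap.comp_apply, hx, ContinuousLinearMap.adjoint_inner_right,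
    inner_eq_integral]
  refine integral_congr_ae ?_
  filter_upwards [hB (α x)] with y hy
  rw [hy, inner_conj_symm]

/-! ### Absolutely continuous functions on the half-line. -/

section AbsolutelyContinuous

lemma absolutelyContinuousOnInterval_of_dist_le {X Y : Type*} [PseudoMetricSpace X]
    [PseudoMetricSpace Y] {f : ℝ → X} {g : ℝ → Y} {a b : ℝ}
    (hg : AbsolutelyContinuousOnInterval g a b) (h : ∀ x y, dist (f x) (f y) ≤ dist (g x) (g y)) :
    AbsolutelyContinuousOnInterval f a b := by
  rw [absolutelyContinuousOnInterval_iff] at hg ⊢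
  intro ε hε
  obtain ⟨δ, hδ, h1⟩ := hg ε hε
  exact ⟨δ, hδ, fun E hE hd => (Finset.sum_le_sum fun i _ => h _ _).trans_lt (h1 E hE hd)⟩

lemma intervalIntegrable_of_locallyIntegrable {q : ℝ → ℂ} (hq : LocallyIntegrable q) (a b : ℝ) :
    IntervalIntegrable q volume a b :=
  (hq.integrableOn_isCompact isCompact_uIcc).intervalIntegrable

lemma absolutelyContinuousOnInterval_integral {q : ℝ → ℂ} (hq : LocallyIntegrable q) (R : ℝ) :
    AbsolutelyContinuousOnInterval (fun x => ∫ t in (0 : ℝ)..x, q t) 0 R := by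
  have hi : ∀ a b, IntervalIntegrable q volume a b := intervalIntegrable_of_locallyIntegrable hq
  refine absolutelyContinuousOnInterval_of_dist_le
    ((hi 0 R).norm.absolutelyContinuousOnInterval_intervalIntegral left_mem_uIcc) fun x y => ?_
  rw [dist_eq_norm, dist_eq_norm, intervalIntegral.integral_interval_sub_left (hi _ _) (hi _ _),
    intervalIntegral.integral_interval_sub_left (hi _ _).norm (hi _ _).norm, Real.norm_eq_abs]
  exact intervalIntegral.norm_integral_le_abs_integral_norm

lemma continuous_integral_of_locallyIntegrable {q : ℝ → ℂ} (hq : LocallyIntegrable q) :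
    Continuous fun x => ∫ t in (0 : ℝ)..x, q t :=
  intervalIntegral.continuous_primitive (intervalIntegrable_of_locallyIntegrable hq) 0

/-- The fundamental theorem of calculus for absolutely continuous functions on the half-line. -/
lemma eq_add_integral_of_ae_hasDerivAt {F d : ℝ → ℂ} (hd : LocallyIntegrable d)
    (hF : ∀ R, 0 < R → AbsolutelyContinuousOnInterval F 0 R)
    (hder : ∀ᵐ x ∂halfLineMeasure, HasDerivAt F (d x) x) (x : ℝ) (hx : 0 ≤ x) :
    F x = F 0 + ∫ t in (0 : ℝ)..x, d t := by
  rcases hx.eq_or_lt with rfl | hx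
  · simp
  have h1 : AbsolutelyContinuousOnInterval (fun y => F y - ∫ t in (0 : ℝ)..y, d t) 0 x :=
    (hF x hx).sub (absolutelyContinuousOnInterval_integral hd x)
  obtain ⟨C, hC⟩ := h1.const_of_ae_hasDerivAt_zero (by
    have h2 := (ae_restrict_iff' measurableSet_Ioi).1 hder
    have h3 := LocallyIntegrable.ae_hasDerivAt_integral hd
    have h4 : ∀ᵐ y : ℝ, y ≠ 0 := by simp [ae_iff, measure_singleton]
    filter_upwards [h2, h3, h4] with y h2 h3 h4 hy
    rw [uIcc_of_le hx.le] at hy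
    have h5 := (h2 (lt_of_le_of_ne hy.1 (Ne.symm h4))).sub (h3 0)
    rwa [sub_self] at h5)
  have e1 := hC x right_mem_uIcc
  have e2 := hC 0 left_mem_uIcc
  simp only [intervalIntegral.integral_same, sub_zero] at e2
  rw [e2, ← e1]
  ring

end AbsolutelyContinuous

/-! ### Wronskians and their behaviour at infinity. -/

/-- `F` is continuously differentiable on `[0, ∞)` with derivative `F'`, which is locally absolutely
continuous with almost everywhere defined derivative `F''`. -/
structure IsC1AC (F F' F'' : ℝ → ℂ) : Prop where
  hasDeriv : ∀ x ∈ Ici (0 : ℝ), HasDerivWithinAt F (F' x) (Ici 0) x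
  ac : ∀ R : ℝ, 0 < R → AbsolutelyContinuousOnInterval F 0 R
  ac' : ∀ R : ℝ, 0 < R → AbsolutelyContinuousOnInterval F' 0 R
  hasDeriv' : ∀ᵐ x ∂halfLineMeasure, HasDerivAt F' (F'' x) x

lemma IsSchrodingerRep.isC1AC {V : ℝ → ℂ} {g h : L2} {G G' G'' : ℝ → ℂ}
    (hG : IsSchrodingerRep V g h G G' G'') : IsC1AC G G' G'' :=
  ⟨hG.hasDeriv, hG.ac, hG.ac', hG.hasDeriv'⟩

lemma continuousOn_of_ac {F : ℝ → ℂ} (hF : ∀ R, 0 < R → AbsolutelyContinuousOnInterval F 0 R) :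
    ContinuousOn F (Ici 0) := by
  intro x hx
  have hx0 : (0 : ℝ) ≤ x := hx
  have h1 := (hF (x + 1) (by linarith)).continuousOn x (by
    rw [uIcc_of_le (show (0 : ℝ) ≤ x + 1 by linarith)]
    exact ⟨hx0, by linarith⟩)
  refine h1.mono_of_mem_nhdsWithin ?_
  rw [uIcc_of_le (show (0 : ℝ) ≤ x + 1 by linarith)]
  rw [← Ici_inter_Iic]
  exact inter_mem_nhdsWithin _ (Iic_mem_nhds (by linarith))

lemma IsC1AC.hasDerivAt {F F' F'' : ℝ → ℂ} (hF : IsC1AC F F' F'') {x : ℝ} (hx : 0 < x) :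
    HasDerivAt F (F' x) x :=
  (hF.hasDeriv x hx.le).hasDerivAt (Ici_mem_nhds hx)

lemma IsC1AC.continuousOn {F F' F'' : ℝ → ℂ} (hF : IsC1AC F F' F'') : ContinuousOn F (Ici 0) :=
  continuousOn_of_ac hF.ac

lemma IsC1AC.continuousOn' {F F' F'' : ℝ → ℂ} (hF : IsC1AC F F' F'') : ContinuousOn F' (Ici 0) :=
  continuousOn_of_ac hF.ac'

lemma IsC1AC.deriv₀ {F F' F'' : ℝ → ℂ} (hF : IsC1AC F F' F'') {x : ℝ} (hx : 0 ≤ x) :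
    deriv₀ F x = F' x :=
  (hF.hasDeriv x hx).derivWithin (uniqueDiffOn_Ici 0 x hx)

lemma IsC1AC.congr {F F' F'' G : ℝ → ℂ} (hF : IsC1AC F F' F'') (h : EqOn G F (Ici 0)) :
    IsC1AC G F' F'' := by
  refine ⟨fun x hx => (hF.hasDeriv x hx).congr h (h hx), fun R hR => ?_, hF.ac', hF.hasDeriv'⟩
  have h1 := hF.ac R hR
  rw [absolutelyContinuousOnInterval_iff] at h1 ⊢
  intro ε hε
  obtain ⟨δ, hδ, h2⟩ := h1 ε hε
  refine ⟨δ, hδ, fun E hE hd => ?_⟩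
  refine (Finset.sum_congr rfl fun i hi => ?_).trans_lt (h2 E hE hd)
  have h3 := hE.1 i hi
  rw [uIcc_of_le hR.le] at h3
  rw [h h3.1.1, h h3.2.1]

/-- The Wronskian of two functions is the integral of its almost everywhere derivative. -/
lemma wronskian_eq_add_integral {f f' f'' h h' h'' w : ℝ → ℂ} (hf : IsC1AC f f' f'')
    (hh : IsC1AC h h' h'') (hw : LocallyIntegrable w)
    (hfh : ∀ᵐ x ∂halfLineMeasure, f x * h'' x - f'' x * h x = w x) (x : ℝ) (hx : 0 ≤ x) :
    f x * h' x - f' x * h x = (f 0 * h' 0 - f' 0 * h 0) + ∫ t in (0 : ℝ)..x, w t := by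
  refine eq_add_integral_of_ae_hasDerivAt (F := fun x => f x * h' x - f' x * h x) hw
    (fun R hR => ?_) ?_ x hx
  · exact ((hf.ac R hR).fun_smul (hh.ac' R hR)).fun_sub ((hf.ac' R hR).fun_smul (hh.ac R hR))
  · filter_upwards [hfh, hf.hasDeriv', hh.hasDeriv', ae_restrict_mem measurableSet_Ioi]
      with y h1 h2 h3 hy
    have h4 := ((hf.hasDerivAt hy).mul h3).sub (h2.mul (hh.hasDerivAt hy))
    refine h4.congr_deriv ?_
    rw [← h1]
    ring

/-- The Wronskian of two square integrable functions, if it has a limit at infinity, tends to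
zero. -/
lemma wronskian_limit_eq_zero {f f' f'' h h' h'' : ℝ → ℂ} (hf : IsC1AC f f' f'')
    (hh : IsC1AC h h' h'') (hi : IntegrableOn (fun x => f x * h x) (Ioi 0))
    (hi' : IntegrableOn (fun x => f' x * h x) (Ioi 0)) {ℓ : ℂ}
    (hlim : Tendsto (fun x => f x * h' x - f' x * h x) atTop (𝓝 ℓ)) : ℓ = 0 := by
  by_contra hℓ
  set m : ℝ := ‖ℓ‖ ^ 2 / 2 with hm
  have hm0 : 0 < m := by positivity
  -- the real part of `conj ℓ * W` is eventually at least `m`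
  have hW : ∀ᶠ x in atTop, m ≤ (starRingEnd ℂ ℓ * (f x * h' x - f' x * h x)).re := by
    have h1 : Tendsto (fun x => (starRingEnd ℂ ℓ * (f x * h' x - f' x * h x)).re) atTop
        (𝓝 ((starRingEnd ℂ ℓ * ℓ).re)) :=
      (Complex.continuous_re.tendsto _).comp (hlim.const_mul _)
    refine h1.eventually (le_mem_nhds ?_)
    rw [Complex.conj_mul', ← Complex.ofReal_pow, Complex.ofReal_re, hm]
    have : 0 < ‖ℓ‖ ^ 2 := by positivity
    linarith
  obtain ⟨X, hX⟩ := eventually_atTop.1 (hW.and (eventually_ge_atTop (0 : ℝ)))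
  have hX0 : 0 ≤ X := (hX X le_rfl).2
  -- Since (fh)' = W + 2f'h, the derivative of u is at least m up to a term bounded by 2‖ℓ‖‖f'h‖,
  -- which is integrable. So u grows at least linearly, against integrability of fh. No information
  -- on h' is needed, which matters because h will be a general domain element.
  set u : ℝ → ℝ := fun x => (starRingEnd ℂ ℓ * (f x * h x)).re with hu
  have hder : ∀ x, 0 < x → HasDerivAt u ((starRingEnd ℂ ℓ * (f' x * h x + f x * h' x)).re) x := by
    intro x hx
    have h1 := ((hf.hasDerivAt hx).mul (hh.hasDerivAt hx)).const_mul (starRingEnd ℂ ℓ)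
    exact Complex.reCLM.hasFDerivAt.comp_hasDerivAt x h1
  set I : ℝ := ∫ x in Ioi (0 : ℝ), ‖f' x * h x‖ with hI
  have hlow : ∀ x, X + 1 ≤ x → u (X + 1) + m * (x - (X + 1)) - 2 * ‖ℓ‖ * I ≤ u x := by
    intro x hx
    have hsub : Icc (X + 1) x ⊆ Ici 0 := fun y hy => by
      have := hy.1
      simp only [mem_Ici]
      linarith
    have hcont : ContinuousOn (fun x => (starRingEnd ℂ ℓ * (f' x * h x + f x * h' x)).re)
        (Icc (X + 1) x) := by
      refine Complex.continuous_re.comp_continuousOn (continuousOn_const.mul ?_)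
      exact ((hf.continuousOn'.mul hh.continuousOn).add
        (hf.continuousOn.mul hh.continuousOn')).mono hsub
    have h1 : ∫ y in (X + 1)..x, (starRingEnd ℂ ℓ * (f' y * h y + f y * h' y)).re
        = u x - u (X + 1) := by
      refine intervalIntegral.integral_eq_sub_of_hasDerivAt (fun y hy => ?_) ?_
      · rw [uIcc_of_le hx] at hy
        exact hder y (by linarith [hy.1])
      · rw [← uIcc_of_le hx] at hcont
        exact hcont.intervalIntegrable
    have hI' : IntervalIntegrable (fun y => ‖f' y * h y‖) volume (X + 1) x := by
      rw [intervalIntegrable_iff_integrableOn_Ioc_of_le hx]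
      exact (hi'.mono_set fun y hy => by
        simp only [mem_Ioi]
        linarith [hy.1]).norm
    have h2 : ∫ y in (X + 1)..x, (m - 2 * ‖ℓ‖ * ‖f' y * h y‖) ≤
        ∫ y in (X + 1)..x, (starRingEnd ℂ ℓ * (f' y * h y + f y * h' y)).re := by
      refine intervalIntegral.integral_mono_on hx (by
        exact (intervalIntegrable_const).sub (hI'.const_mul _)) (by
        rw [← uIcc_of_le hx] at hcont
        exact hcont.intervalIntegrable) fun y hy => ?_
      have h3 := (hX y (by linarith [hy.1])).1
      have h4 : starRingEnd ℂ ℓ * (f' y * h y + f y * h' y) =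
          starRingEnd ℂ ℓ * (f y * h' y - f' y * h y) + 2 * (starRingEnd ℂ ℓ * (f' y * h y)) := by
        ring
      have h5 := Complex.abs_re_le_norm (2 * (starRingEnd ℂ ℓ * (f' y * h y)))
      rw [norm_mul, norm_mul, Complex.norm_conj, Complex.norm_ofNat] at h5
      rw [h4, Complex.add_re]
      have h6 := (abs_le.1 h5).1
      nlinarith
    rw [intervalIntegral.integral_sub intervalIntegrable_const (hI'.const_mul _),
      intervalIntegral.integral_const, intervalIntegral.integral_const_mul, h1, smul_eq_mul] at h2
    have h7 : ∫ y in (X + 1)..x, ‖f' y * h y‖ ≤ I := by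
      rw [intervalIntegral.integral_of_le hx, hI]
      refine setIntegral_mono_set hi'.norm (Eventually.of_forall fun y => norm_nonneg _) ?_
      exact (show Ioc (X + 1) x ⊆ Ioi 0 from fun y hy => by
        simp only [mem_Ioi]
        linarith [hy.1]).eventuallyLE
    have h8 : 2 * ‖ℓ‖ * ∫ y in (X + 1)..x, ‖f' y * h y‖ ≤ 2 * ‖ℓ‖ * I := by gcongr
    linarith
  have hlarge : ∀ᶠ x in atTop, 1 ≤ u x := by
    have h1 : Tendsto (fun x => u (X + 1) + m * (x - (X + 1)) - 2 * ‖ℓ‖ * I) atTop atTop := by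
      refine tendsto_atTop_add_const_right _ _ (tendsto_atTop_add_const_left _ _ ?_)
      exact (tendsto_atTop_add_const_right _ _ tendsto_id).const_mul_atTop hm0
    filter_upwards [h1.eventually_ge_atTop 1, eventually_ge_atTop (X + 1)] with x h2 h3
    exact h2.trans (hlow x h3)
  have huint : IntegrableOn u (Ioi 0) := (hi.const_mul _).re
  obtain ⟨Y, hY⟩ := eventually_atTop.1 (hlarge.and (eventually_ge_atTop (0 : ℝ)))
  have hY0 := (hY Y le_rfl).2
  have h1 : IntegrableOn (fun _ : ℝ => (1 : ℝ)) (Ioi Y) := by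
    refine Integrable.mono' (huint.mono_set (Ioi_subset_Ioi hY0))
      aestronglyMeasurable_const ?_
    filter_upwards [ae_restrict_mem measurableSet_Ioi] with x hx
    rw [norm_one]
    exact (hY x (le_of_lt hx)).1
  rw [integrableOn_const_iff] at h1
  simp at h1

/-- The boundary value of the Wronskian of two square integrable functions. -/
lemma wronskian_zero_add_integral {f f' f'' h h' h'' w : ℝ → ℂ} (hf : IsC1AC f f' f'')
    (hh : IsC1AC h h' h'') (hf2 : MemLp f 2 halfLineMeasure) (hf2' : MemLp f' 2 halfLineMeasure)
    (hh2 : MemLp h 2 halfLineMeasure) (hw : Integrable w halfLineMeasure)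
    (hfh : ∀ᵐ x ∂halfLineMeasure, f x * h'' x - f'' x * h x = w x) :
    (f 0 * h' 0 - f' 0 * h 0) + ∫ x, w x ∂halfLineMeasure = 0 := by
  -- w is controlled only on the half-line, while the integral formula for the Wronskian asks for
  -- local integrability on ℝ.
  have hw' : LocallyIntegrable ((Ioi (0 : ℝ)).indicator w) :=
    (integrable_indicator_iff measurableSet_Ioi).2 hw |>.locallyIntegrable
  have h1 := wronskian_eq_add_integral hf hh hw' (by
    filter_upwards [hfh, ae_restrict_mem measurableSet_Ioi] with x h1 hx
    rw [indicator_of_mem hx, h1])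
  refine wronskian_limit_eq_zero hf hh (hf2.integrable_mul hh2) (hf2'.integrable_mul hh2) ?_
  have h2 : Tendsto (fun x => ∫ t in (0 : ℝ)..x, w t) atTop
      (𝓝 (∫ x, w x ∂halfLineMeasure)) :=
    intervalIntegral_tendsto_integral_Ioi 0 hw tendsto_id
  refine (h2.const_add _).congr' ?_
  filter_upwards [eventually_ge_atTop 0] with x hx
  rw [h1 x hx]
  congr 1
  rw [intervalIntegral.integral_of_le hx, intervalIntegral.integral_of_le hx]
  refine setIntegral_congr_fun measurableSet_Ioc fun t ht => ?_
  exact (indicator_of_mem (show t ∈ Ioi (0 : ℝ) from ht.1) w).symm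

/-! ### Variation of constants for the inhomogeneous free equation. -/

section InhomogeneousEquation

variable {k : ℂ} {q : ℝ → ℂ}

lemma hasDerivAt_sin_mul (k : ℂ) (x : ℝ) :
    HasDerivAt (fun x : ℝ => Complex.sin (k * x)) (k * Complex.cos (k * x)) x := by
  have h1 : HasDerivAt (fun x : ℝ => k * (x : ℂ)) k x := by
    simpa using (Complex.ofRealCLM.hasDerivAt (x := x)).const_mul k
  have h2 := (Complex.hasDerivAt_sin (k * x)).comp x h1
  rw [mul_comm] at h2
  exact h2

lemma hasDerivAt_cos_mul (k : ℂ) (x : ℝ) :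
    HasDerivAt (fun x : ℝ => Complex.cos (k * x)) (-k * Complex.sin (k * x)) x := by
  have h1 : HasDerivAt (fun x : ℝ => k * (x : ℂ)) k x := by
    simpa using (Complex.ofRealCLM.hasDerivAt (x := x)).const_mul k
  refine ((Complex.hasDerivAt_cos (k * x)).comp x h1).congr_deriv ?_
  ring

lemma absolutelyContinuousOnInterval_sin_mul (k : ℂ) (a b : ℝ) :
    AbsolutelyContinuousOnInterval (fun x : ℝ => Complex.sin (k * x)) a b := by
  refine ContDiffOn.absolutelyContinuousOnInterval (ContDiff.contDiffOn ?_)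
  exact (Complex.contDiff_sin.restrict_scalars ℝ).comp
    ((contDiff_const (c := k)).mul Complex.ofRealCLM.contDiff)

lemma absolutelyContinuousOnInterval_cos_mul (k : ℂ) (a b : ℝ) :
    AbsolutelyContinuousOnInterval (fun x : ℝ => Complex.cos (k * x)) a b := by
  refine ContDiffOn.absolutelyContinuousOnInterval (ContDiff.contDiffOn ?_)
  exact (Complex.contDiff_cos.restrict_scalars ℝ).comp
    ((contDiff_const (c := k)).mul Complex.ofRealCLM.contDiff)

/-- The solution of `-F'' = k² F - q` with `F(0) = a`, `F'(0) = b`. -/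
def inhomSol (k a b : ℂ) (q : ℝ → ℂ) (x : ℝ) : ℂ :=
  a * Complex.cos (k * x) + b * (Complex.sin (k * x) / k) +
    ∫ y in (0 : ℝ)..x, Complex.sin (k * ((x : ℂ) - (y : ℂ))) / k * q y

/-- The derivative of `inhomSol`. -/
def inhomSolDeriv (k a b : ℂ) (q : ℝ → ℂ) (x : ℝ) : ℂ :=
  -k * a * Complex.sin (k * x) + b * Complex.cos (k * x) +
    ∫ y in (0 : ℝ)..x, Complex.cos (k * ((x : ℂ) - (y : ℂ))) * q y

lemma inhomSol_zero (k a b : ℂ) (q : ℝ → ℂ) : inhomSol k a b q 0 = a := by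
  simp [inhomSol]

lemma inhomSolDeriv_zero (k a b : ℂ) (q : ℝ → ℂ) : inhomSolDeriv k a b q 0 = b := by
  simp [inhomSolDeriv]

lemma locallyIntegrable_continuous_mul {c : ℝ → ℂ} (hc : Continuous c)
    (hq : LocallyIntegrable q) : LocallyIntegrable fun y => c y * q y := by
  have := (locallyIntegrableOn_univ.2 hq).continuousOn_mul hc.continuousOn isOpen_univ.isLocallyClosed
  exact locallyIntegrableOn_univ.1 this

/-- The addition theorem takes x out of the integrand, so regularity in x reduces to that of
primitives. -/
lemma inhomSol_eq (hk : k ≠ 0) (hq : LocallyIntegrable q) (a b : ℂ) (x : ℝ) :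
    inhomSol k a b q x = a * Complex.cos (k * x) + k⁻¹ * b * Complex.sin (k * x) +
      (k⁻¹ * Complex.sin (k * x) * (∫ y in (0 : ℝ)..x, Complex.cos (k * y) * q y)
        - k⁻¹ * Complex.cos (k * x) * ∫ y in (0 : ℝ)..x, Complex.sin (k * y) * q y) := by
  have h1 := intervalIntegrable_of_locallyIntegrable
    (locallyIntegrable_continuous_mul (c := fun y : ℝ => Complex.cos (k * y)) (by fun_prop) hq) 0 x
  have h2 := intervalIntegrable_of_locallyIntegrable
    (locallyIntegrable_continuous_mul (c := fun y : ℝ => Complex.sin (k * y)) (by fun_prop) hq) 0 x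
  rw [← intervalIntegral.integral_const_mul, ← intervalIntegral.integral_const_mul,
    ← intervalIntegral.integral_sub (h1.const_mul _) (h2.const_mul _), inhomSol]
  congr 1
  · field_simp
  · refine intervalIntegral.integral_congr fun y _ => ?_
    simp only [mul_sub, Complex.sin_sub]
    field_simp

lemma inhomSolDeriv_eq (hq : LocallyIntegrable q) (a b : ℂ) (x : ℝ) :
    inhomSolDeriv k a b q x = -k * a * Complex.sin (k * x) + b * Complex.cos (k * x) +
      (Complex.cos (k * x) * (∫ y in (0 : ℝ)..x, Complex.cos (k * y) * q y)
        + Complex.sin (k * x) * ∫ y in (0 : ℝ)..x, Complex.sin (k * y) * q y) := by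
  have h1 := intervalIntegrable_of_locallyIntegrable
    (locallyIntegrable_continuous_mul (c := fun y : ℝ => Complex.cos (k * y)) (by fun_prop) hq) 0 x
  have h2 := intervalIntegrable_of_locallyIntegrable
    (locallyIntegrable_continuous_mul (c := fun y : ℝ => Complex.sin (k * y)) (by fun_prop) hq) 0 x
  rw [← intervalIntegral.integral_const_mul, ← intervalIntegral.integral_const_mul,
    ← intervalIntegral.integral_add (h1.const_mul _) (h2.const_mul _), inhomSolDeriv]
  congr 1
  refine intervalIntegral.integral_congr fun y _ => ?_
  simp only [mul_sub, Complex.cos_sub]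
  ring

lemma continuous_inhomSolDeriv (hq : LocallyIntegrable q) (a b : ℂ) :
    Continuous (inhomSolDeriv k a b q) := by
  have h1 := continuous_integral_of_locallyIntegrable
    (locallyIntegrable_continuous_mul (c := fun y : ℝ => Complex.cos (k * y)) (by fun_prop) hq)
  have h2 := continuous_integral_of_locallyIntegrable
    (locallyIntegrable_continuous_mul (c := fun y : ℝ => Complex.sin (k * y)) (by fun_prop) hq)
  simp only [funext (inhomSolDeriv_eq (k := k) hq a b)]
  fun_prop

lemma continuous_inhomSol (hk : k ≠ 0) (hq : LocallyIntegrable q) (a b : ℂ) :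
    Continuous (inhomSol k a b q) := by
  have h1 := continuous_integral_of_locallyIntegrable
    (locallyIntegrable_continuous_mul (c := fun y : ℝ => Complex.cos (k * y)) (by fun_prop) hq)
  have h2 := continuous_integral_of_locallyIntegrable
    (locallyIntegrable_continuous_mul (c := fun y : ℝ => Complex.sin (k * y)) (by fun_prop) hq)
  simp only [funext (inhomSol_eq hk hq a b)]
  fun_prop

/-- As q is only locally integrable, both derivatives are first computed almost everywhere. Absolute
continuity then makes the solution the integral of `inhomSolDeriv`, and continuity of the latter
upgrades the first derivative to every point. -/
theorem isC1AC_inhomSol (hk : k ≠ 0) (hq : LocallyIntegrable q) (a b : ℂ) :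
    IsC1AC (inhomSol k a b q) (inhomSolDeriv k a b q) (fun x => q x - k ^ 2 * inhomSol k a b q x) := by
  have hc := locallyIntegrable_continuous_mul (c := fun y : ℝ => Complex.cos (k * y))
    (by fun_prop) hq
  have hs := locallyIntegrable_continuous_mul (c := fun y : ℝ => Complex.sin (k * y))
    (by fun_prop) hq
  have hsin := absolutelyContinuousOnInterval_sin_mul k
  have hcos := absolutelyContinuousOnInterval_cos_mul k
  have hac : ∀ R : ℝ, 0 < R → AbsolutelyContinuousOnInterval (inhomSol k a b q) 0 R := by
    intro R _
    rw [funext (inhomSol_eq hk hq a b)]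
    exact (((hcos 0 R).const_smul a).fun_add ((hsin 0 R).const_smul (k⁻¹ * b))).fun_add
      ((((hsin 0 R).const_smul k⁻¹).fun_smul (absolutelyContinuousOnInterval_integral hc R)).fun_sub
      (((hcos 0 R).const_smul k⁻¹).fun_smul (absolutelyContinuousOnInterval_integral hs R)))
  have hac' : ∀ R : ℝ, 0 < R → AbsolutelyContinuousOnInterval (inhomSolDeriv k a b q) 0 R := by
    intro R _
    rw [funext (inhomSolDeriv_eq (k := k) hq a b)]
    exact (((hsin 0 R).const_smul (-k * a)).fun_add ((hcos 0 R).const_smul b)).fun_add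
      (((hcos 0 R).fun_smul (absolutelyContinuousOnInterval_integral hc R)).fun_add
      ((hsin 0 R).fun_smul (absolutelyContinuousOnInterval_integral hs R)))
  have hd : ∀ᵐ x, HasDerivAt (inhomSol k a b q) (inhomSolDeriv k a b q x) x := by
    filter_upwards [_root_.LocallyIntegrable.ae_hasDerivAt_integral hc,
      _root_.LocallyIntegrable.ae_hasDerivAt_integral hs] with x h1 h2
    have hS := hasDerivAt_sin_mul k x
    have hC := hasDerivAt_cos_mul k x
    rw [funext (inhomSol_eq hk hq a b), inhomSolDeriv_eq hq]
    have h3 := ((hC.const_mul a).add (hS.const_mul (k⁻¹ * b))).add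
      (((hS.const_mul k⁻¹).mul (h1 0)).sub ((hC.const_mul k⁻¹).mul (h2 0)))
    refine h3.congr_deriv ?_
    field_simp
    ring
  have hd' : ∀ᵐ x, HasDerivAt (inhomSolDeriv k a b q) (q x - k ^ 2 * inhomSol k a b q x) x := by
    filter_upwards [_root_.LocallyIntegrable.ae_hasDerivAt_integral hc,
      _root_.LocallyIntegrable.ae_hasDerivAt_integral hs] with x h1 h2
    have hS := hasDerivAt_sin_mul k x
    have hC := hasDerivAt_cos_mul k x
    rw [funext (inhomSolDeriv_eq (k := k) hq a b), inhomSol_eq hk hq]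
    have h3 := ((hS.const_mul (-k * a)).add (hC.const_mul b)).add
      ((hC.mul (h1 0)).add (hS.mul (h2 0)))
    refine h3.congr_deriv ?_
    have h4 : q x = (Complex.sin (k * x) ^ 2 + Complex.cos (k * x) ^ 2) * q x := by
      rw [Complex.sin_sq_add_cos_sq, one_mul]
    conv_rhs => rw [h4]
    field_simp
    ring
  have hcont := continuous_inhomSolDeriv (k := k) hq a b
  refine ⟨fun x hx => ?_, hac, hac', ae_restrict_of_ae hd'⟩
  have h1 := eq_add_integral_of_ae_hasDerivAt hcont.locallyIntegrable hac (ae_restrict_of_ae hd)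
  have h2 : HasDerivAt (fun x => inhomSol k a b q 0 + ∫ t in (0 : ℝ)..x, inhomSolDeriv k a b q t)
      (inhomSolDeriv k a b q x) x :=
    (hcont.integral_hasStrictDerivAt 0 x).hasDerivAt.const_add _
  exact h2.hasDerivWithinAt.congr (fun y hy => h1 y hy) (h1 x hx)

end InhomogeneousEquation

/-! ### Linear integral equations solved by a weighted contraction. -/

section FixedPoint

open BoundedContinuousFunction

/-- A linear integral equation on the half-line whose kernel is contracting with respect to a
weight has a bounded continuous solution. -/
theorem exists_solution_of_weight (K : ℝ → ℝ → ℂ) (η₀ : ℝ → ℂ) (W D : ℝ → ℝ) (M C : ℝ)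
    (hη₀ : ContinuousOn η₀ (Ici 0)) (hM : ∀ x, 0 ≤ x → ‖η₀ x‖ ≤ M)
    (hW : Continuous W) (hW1 : ∀ x, 1 ≤ W x) (hWC : ∀ x, W x ≤ C)
    (hmeas : ∀ x, 0 ≤ x → AEStronglyMeasurable (K x) halfLineMeasure)
    (hD : Integrable D halfLineMeasure)
    (hKD : ∀ x, 0 ≤ x → ∀ᵐ y ∂halfLineMeasure, ‖K x y‖ ≤ D y)
    (hcont : ∀ x₀, 0 ≤ x₀ → ∀ᵐ y ∂halfLineMeasure,
      ContinuousWithinAt (fun x => K x y) (Ici 0) x₀)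
    (hhalf : ∀ x, 0 ≤ x → ∫ y, ‖K x y‖ * W y ∂halfLineMeasure ≤ W x / 2) :
    ∃ η : ℝ → ℂ, Continuous η ∧ (∃ B, ∀ x, ‖η x‖ ≤ B) ∧
      ∀ x, 0 ≤ x → η x = η₀ x + ∫ y, K x y * η y ∂halfLineMeasure := by
  have hmax : Continuous fun x : ℝ => max x 0 := by fun_prop
  have hC1 : 1 ≤ C := (hW1 0).trans (hWC 0)
  have hW0 : ∀ x, 0 < W x := fun x => one_pos.trans_le (hW1 x)
  have hKint : ∀ x, 0 ≤ x → Integrable (K x) halfLineMeasure := fun x hx =>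
    hD.mono' (hmeas x hx) (hKD x hx)
  have hKχ : ∀ (χ : ℝ →ᵇ ℂ) x, 0 ≤ x →
      Integrable (fun y => K x y * (W y * χ y)) halfLineMeasure := by
    intro χ x hx
    refine (hKint x hx).mul_bdd (c := C * ‖χ‖) (by
      refine Continuous.aestronglyMeasurable ?_
      fun_prop) (Eventually.of_forall fun y => ?_)
    rw [norm_mul, Complex.norm_real, Real.norm_of_nonneg (hW0 y).le]
    exact mul_le_mul (hWC y) (χ.norm_coe_le_norm y) (norm_nonneg _) (by linarith)
  have hKW : ∀ x, 0 ≤ x → Integrable (fun y => ‖K x y‖ * W y) halfLineMeasure := by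
    intro x hx
    refine (hKint x hx).norm.mul_bdd (c := C) hW.aestronglyMeasurable (Eventually.of_forall fun y => ?_)
    rw [Real.norm_of_nonneg (hW0 y).le]
    exact hWC y
  have hbd : ∀ (χ : ℝ → ℂ) (B : ℝ), (∀ y, ‖χ y‖ ≤ B) → ∀ x, 0 ≤ x →
      ‖∫ y, K x y * (W y * χ y) ∂halfLineMeasure‖ ≤ B * (W x / 2) := by
    intro χ B hB x hx
    have hB0 : 0 ≤ B := (norm_nonneg _).trans (hB 0)
    refine (norm_integral_le_of_norm_le ((hKW x hx).const_mul B)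
      (Eventually.of_forall fun y => ?_)).trans ?_
    · rw [norm_mul, norm_mul, Complex.norm_real, Real.norm_of_nonneg (hW0 y).le]
      calc ‖K x y‖ * (W y * ‖χ y‖) = ‖χ y‖ * (‖K x y‖ * W y) := by ring
        _ ≤ _ := mul_le_mul_of_nonneg_right (hB y) (mul_nonneg (norm_nonneg _) (hW0 y).le)
    · rw [integral_const_mul]
      exact mul_le_mul_of_nonneg_left (hhalf x hx) hB0
  have hcI : ∀ χ : ℝ →ᵇ ℂ,
      ContinuousOn (fun x => ∫ y, K x y * (W y * χ y) ∂halfLineMeasure) (Ici 0) := by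
    intro χ x₀ hx₀
    refine continuousWithinAt_of_dominated (bound := fun y => D y * (C * ‖χ‖)) ?_ ?_
      (hD.mul_const _) ?_
    · filter_upwards [self_mem_nhdsWithin] with x hx using (hKχ χ x hx).aestronglyMeasurable
    · filter_upwards [self_mem_nhdsWithin] with x hx
      filter_upwards [hKD x hx] with y hy
      rw [norm_mul, norm_mul, Complex.norm_real, Real.norm_of_nonneg (hW0 y).le]
      exact mul_le_mul hy (mul_le_mul (hWC y) (χ.norm_coe_le_norm y) (norm_nonneg _)
        (by linarith)) (mul_nonneg (hW0 y).le (norm_nonneg _)) ((norm_nonneg _).trans hy)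
    · filter_upwards [hcont x₀ hx₀] with y hy using hy.mul continuousWithinAt_const
  -- The unknown is χ = η / W: since the kernel maps W to at most W / 2, the map contracts by 1/2 in
  -- the plain sup norm. Evaluating at max x 0 extends everything constantly to negative x, so that
  -- bounded continuous functions on ℝ can be used.
  let Ψ : (ℝ →ᵇ ℂ) → ℝ → ℂ := fun χ x =>
    (W (max x 0) : ℂ)⁻¹ * (η₀ (max x 0) + ∫ y, K (max x 0) y * (W y * χ y) ∂halfLineMeasure)
  have hΨc : ∀ χ, Continuous (Ψ χ) := by
    intro χ
    have h1 : Continuous fun x : ℝ => (W (max x 0) : ℂ)⁻¹ :=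
      (Complex.continuous_ofReal.comp (hW.comp hmax)).inv₀ fun x =>
        Complex.ofReal_ne_zero.2 (hW0 _).ne'
    refine h1.mul (Continuous.add ?_ ?_)
    · exact hη₀.comp_continuous hmax fun x => mem_Ici.2 (le_max_right _ _)
    · exact (hcI χ).comp_continuous hmax fun x => mem_Ici.2 (le_max_right _ _)
  have hinv : ∀ x, ‖(W x : ℂ)⁻¹‖ ≤ 1 := by
    intro x
    rw [norm_inv, Complex.norm_real, Real.norm_of_nonneg (hW0 x).le]
    exact inv_le_one_of_one_le₀ (hW1 x)
  have hΨb : ∀ χ x, ‖Ψ χ x‖ ≤ M + ‖χ‖ * (C / 2) := by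
    intro χ x
    have h1 := hbd χ ‖χ‖ χ.norm_coe_le_norm (max x 0) (le_max_right _ _)
    calc ‖Ψ χ x‖ ≤ 1 * ‖η₀ (max x 0) + ∫ y, K (max x 0) y * (W y * χ y) ∂halfLineMeasure‖ := by
          rw [norm_mul]
          exact mul_le_mul_of_nonneg_right (hinv _) (norm_nonneg _)
      _ ≤ M + ‖χ‖ * (W (max x 0) / 2) := by
          rw [one_mul]
          exact (norm_add_le _ _).trans (add_le_add (hM _ (le_max_right _ _)) h1)
      _ ≤ _ := by
          have := hWC (max x 0)
          gcongr
  let Φ : (ℝ →ᵇ ℂ) → (ℝ →ᵇ ℂ) := fun χ =>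
    BoundedContinuousFunction.ofNormedAddCommGroup (Ψ χ) (hΨc χ) _ (hΨb χ)
  have hΦ : ContractingWith (1 / 2) Φ := by
    refine ⟨by norm_num, LipschitzWith.of_dist_le_mul fun χ₁ χ₂ => ?_⟩
    refine (BoundedContinuousFunction.dist_le (by positivity)).2 fun x => ?_
    have hx : 0 ≤ max x 0 := le_max_right _ _
    have h1 := hbd (χ₁ - χ₂) ‖χ₁ - χ₂‖ (fun y => (χ₁ - χ₂).norm_coe_le_norm y) _ hx
    have h2 : ∫ y, K (max x 0) y * (W y * (χ₁ - χ₂ : ℝ → ℂ) y) ∂halfLineMeasure =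
        (∫ y, K (max x 0) y * (W y * χ₁ y) ∂halfLineMeasure) -
        ∫ y, K (max x 0) y * (W y * χ₂ y) ∂halfLineMeasure := by
      rw [← integral_sub (hKχ χ₁ _ hx) (hKχ χ₂ _ hx)]
      refine integral_congr_ae (Eventually.of_forall fun y => ?_)
      simp only [Pi.sub_apply]
      ring
    rw [h2] at h1
    have h3 : Φ χ₁ x - Φ χ₂ x = (W (max x 0) : ℂ)⁻¹ *
        ((∫ y, K (max x 0) y * (W y * χ₁ y) ∂halfLineMeasure) -
        ∫ y, K (max x 0) y * (W y * χ₂ y) ∂halfLineMeasure) := by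
      change Ψ χ₁ x - Ψ χ₂ x = _
      simp only [Ψ]
      ring
    rw [dist_eq_norm, h3, norm_mul, norm_inv, Complex.norm_real,
      Real.norm_of_nonneg (hW0 _).le, inv_mul_le_iff₀ (hW0 _), dist_eq_norm]
    refine h1.trans (le_of_eq ?_)
    push_cast
    ring
  set χ := hΦ.fixedPoint with hχ
  have hfix : ∀ x, χ x = Ψ χ x := fun x =>
    congrArg (fun φ : ℝ →ᵇ ℂ => φ x) hΦ.fixedPoint_isFixedPt.symm
  refine ⟨fun x => W (max x 0) * χ x, ?_, ⟨C * ‖χ‖, fun x => ?_⟩, fun x hx => ?_⟩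
  · exact (Complex.continuous_ofReal.comp (hW.comp hmax)).mul χ.continuous
  · rw [norm_mul, Complex.norm_real, Real.norm_of_nonneg (hW0 _).le]
    exact mul_le_mul (hWC _) (χ.norm_coe_le_norm x) (norm_nonneg _) (by linarith)
  · have h1 : ∫ y, K x y * (W (max y 0) * χ y) ∂halfLineMeasure =
        ∫ y, K x y * (W y * χ y) ∂halfLineMeasure := by
      refine setIntegral_congr_fun measurableSet_Ioi fun y hy => ?_
      simp only [max_eq_left (le_of_lt hy : (0 : ℝ) ≤ y)]
    have h2 := hfix x
    simp only [Ψ, max_eq_left hx] at h2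
    have h3 : (W x : ℂ) ≠ 0 := Complex.ofReal_ne_zero.2 (hW0 x).ne'
    simp only [max_eq_left hx]
    rw [h1, h2]
    field_simp

end FixedPoint

/-! ### Exponential weights built from a primitive. -/

section Weight

variable {p : ℝ → ℝ}

lemma exp_sub_exp_le {a b : ℝ} {B : ℝ} (ha : a ≤ B) (hb : b ≤ B) :
    |Real.exp a - Real.exp b| ≤ Real.exp B * |a - b| := by
  wlog h : b ≤ a generalizing a b
  · rw [abs_sub_comm, abs_sub_comm a]
    exact this hb ha (le_of_not_ge h)
  rw [abs_of_nonneg (sub_nonneg.2 (Real.exp_le_exp.2 h)), abs_of_nonneg (sub_nonneg.2 h)]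
  have h1 : Real.exp b = Real.exp a * Real.exp (b - a) := by
    rw [← Real.exp_add]
    congr 1
    ring
  have h2 := Real.add_one_le_exp (b - a)
  calc Real.exp a - Real.exp b = Real.exp a * (1 - Real.exp (b - a)) := by rw [h1]; ring
    _ ≤ Real.exp a * (a - b) := by
        refine mul_le_mul_of_nonneg_left ?_ (Real.exp_pos _).le
        linarith
    _ ≤ _ := by
        refine mul_le_mul_of_nonneg_right (Real.exp_le_exp.2 ha) (sub_nonneg.2 h)

/-- The primitive of p is merely absolutely continuous, but bounded; exp is Lipschitz on its range,
so the composition is absolutely continuous and the fundamental theorem applies. -/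
lemma integral_mul_exp_primitive (hp : Integrable p) (s a b : ℝ) :
    ∫ x in a..b, s * p x * Real.exp (s * ∫ t in (0 : ℝ)..x, p t) =
      Real.exp (s * ∫ t in (0 : ℝ)..b, p t) - Real.exp (s * ∫ t in (0 : ℝ)..a, p t) := by
  have hi : ∀ c d, IntervalIntegrable p volume c d := fun c d => hp.intervalIntegrable
  obtain ⟨B, hB⟩ : ∃ B, ∀ x, s * (∫ t in (0 : ℝ)..x, p t) ≤ B := by
    refine ⟨|s| * ∫ t, ‖p t‖, fun x => (le_abs_self _).trans ?_⟩
    rw [abs_mul]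
    refine mul_le_mul_of_nonneg_left ?_ (abs_nonneg s)
    exact (intervalIntegral.norm_integral_le_integral_norm_uIoc).trans
      (setIntegral_le_integral hp.norm (Eventually.of_forall fun x => norm_nonneg _))
  have hac : AbsolutelyContinuousOnInterval
      (fun x => Real.exp (s * ∫ t in (0 : ℝ)..x, p t)) a b := by
    have h1 : AbsolutelyContinuousOnInterval (fun x => ∫ t in a..x, p t) a b :=
      (hi a b).absolutelyContinuousOnInterval_intervalIntegral left_mem_uIcc
    refine absolutelyContinuousOnInterval_of_dist_le (h1.const_mul (Real.exp B * |s|))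
      fun x y => ?_
    simp only [Real.dist_eq]
    refine (exp_sub_exp_le (hB x) (hB y)).trans (le_of_eq ?_)
    rw [← mul_sub, ← mul_sub, intervalIntegral.integral_interval_sub_left (hi _ _) (hi _ _),
      intervalIntegral.integral_interval_sub_left (hi _ _) (hi _ _), abs_mul, abs_mul, abs_mul,
      abs_abs, abs_of_pos (Real.exp_pos B), mul_assoc]
  rw [← hac.integral_deriv_eq_sub]
  refine intervalIntegral.integral_congr_ae ?_
  filter_upwards [_root_.LocallyIntegrable.ae_hasDerivAt_integral hp.locallyIntegrable] with x hx _
  have h1 := ((hx 0).const_mul s).exp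
  rw [h1.deriv]
  ring

end Weight

/-! ### Growth bounds for sin, cos and exp with complex frequency. -/

section Bounds

variable {k : ℂ}

lemma norm_exp_I_mul (k : ℂ) (x : ℝ) : ‖Complex.exp (Complex.I * k * x)‖ = Real.exp (-k.im * x) := by
  rw [Complex.norm_exp]
  congr 1
  simp [Complex.mul_re, Complex.mul_im]

lemma norm_exp_I_mul_le_one (hk : 0 < k.im) {x : ℝ} (hx : 0 ≤ x) :
    ‖Complex.exp (Complex.I * k * x)‖ ≤ 1 := by
  rw [norm_exp_I_mul, Real.exp_le_one_iff]
  nlinarith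

lemma norm_exp_neg_I_mul (k : ℂ) (x : ℝ) :
    ‖Complex.exp (-(Complex.I * k * x))‖ = Real.exp (k.im * x) := by
  rw [Complex.norm_exp]
  congr 1
  simp [Complex.mul_re, Complex.mul_im]

lemma sin_mul_eq (k : ℂ) (x : ℝ) : Complex.sin (k * x) =
    (Complex.exp (-(Complex.I * k * x)) - Complex.exp (Complex.I * k * x)) * Complex.I / 2 := by
  rw [Complex.sin]
  congr 4 <;> ring_nf

lemma cos_mul_eq (k : ℂ) (x : ℝ) : Complex.cos (k * x) =
    (Complex.exp (Complex.I * k * x) + Complex.exp (-(Complex.I * k * x))) / 2 := by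
  rw [Complex.cos]
  congr 3 <;> ring_nf

lemma norm_sin_mul_le (hk : 0 < k.im) {x : ℝ} (hx : 0 ≤ x) :
    ‖Complex.sin (k * x)‖ ≤ Real.exp (k.im * x) := by
  rw [sin_mul_eq, norm_div, norm_mul, Complex.norm_I, mul_one, Complex.norm_ofNat,
    div_le_iff₀ two_pos]
  refine (norm_sub_le _ _).trans ?_
  rw [norm_exp_neg_I_mul, norm_exp_I_mul]
  have : Real.exp (-k.im * x) ≤ Real.exp (k.im * x) := Real.exp_le_exp.2 (by nlinarith)
  linarith

lemma norm_cos_mul_le (hk : 0 < k.im) {x : ℝ} (hx : 0 ≤ x) :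
    ‖Complex.cos (k * x)‖ ≤ Real.exp (k.im * x) := by
  rw [cos_mul_eq, norm_div, Complex.norm_ofNat, div_le_iff₀ two_pos]
  refine (norm_add_le _ _).trans ?_
  rw [norm_exp_neg_I_mul, norm_exp_I_mul]
  have : Real.exp (-k.im * x) ≤ Real.exp (k.im * x) := Real.exp_le_exp.2 (by nlinarith)
  linarith

lemma norm_sin_mul_exp_le (hk : 0 < k.im) {t : ℝ} (ht : 0 ≤ t) :
    ‖Complex.sin (k * t) * Complex.exp (Complex.I * k * t)‖ ≤ 1 := by
  rw [norm_mul, norm_exp_I_mul]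
  calc _ ≤ Real.exp (k.im * t) * Real.exp (-k.im * t) := by
        gcongr
        exact norm_sin_mul_le hk ht
    _ = 1 := by rw [← Real.exp_add]; simp

lemma norm_cos_mul_exp_le (hk : 0 < k.im) {t : ℝ} (ht : 0 ≤ t) :
    ‖Complex.cos (k * t) * Complex.exp (Complex.I * k * t)‖ ≤ 1 := by
  rw [norm_mul, norm_exp_I_mul]
  calc _ ≤ Real.exp (k.im * t) * Real.exp (-k.im * t) := by
        gcongr
        exact norm_cos_mul_le hk ht
    _ = 1 := by rw [← Real.exp_add]; simp

end Bounds

/-! ### Existence of the Jost and Volterra solutions. -/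

section Existence

variable {k : ℂ} {V : ℝ → ℂ}

/-- For fixed y the truncated kernel can jump only at x = y, so continuity at x₀ fails for a null
set of y at most. -/
lemma continuousAt_indicator_Ioi {F : ℝ → ℝ → ℂ} {y x₀ : ℝ} (hF : Continuous fun x => F x y)
    (hy : y ≠ x₀) : ContinuousAt (fun x => (Ioi x).indicator (F x) y) x₀ := by
  rcases hy.lt_or_gt with h | h
  · refine continuousAt_const (y := (0 : ℂ)) |>.congr ?_
    filter_upwards [Ioi_mem_nhds h] with x hx
    rw [indicator_of_notMem (by simpa using (le_of_lt hx))]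
  · refine hF.continuousAt.congr ?_
    filter_upwards [Iio_mem_nhds h] with x hx
    rw [indicator_of_mem (by simpa using hx)]

lemma continuousAt_indicator_Iic {F : ℝ → ℝ → ℂ} {y x₀ : ℝ} (hF : Continuous fun x => F x y)
    (hy : y ≠ x₀) : ContinuousAt (fun x => (Iic x).indicator (F x) y) x₀ := by
  have h1 := hF.continuousAt.sub (continuousAt_indicator_Ioi hF hy)
  refine h1.congr (Eventually.of_forall fun x => ?_)
  by_cases hx : x < y
  · simp [hx, not_le.2 hx]
  · simp [hx, not_lt.1 hx]

lemma ae_ne_halfLine (x₀ : ℝ) : ∀ᵐ y ∂halfLineMeasure, y ≠ x₀ :=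
  ae_restrict_of_ae (by simp [ae_iff, measure_singleton])

/-- The primitive of a nonnegative function on the half-line takes values between zero and the
total mass. -/
lemma primitive_mem_Icc {p : ℝ → ℝ} (hp : Integrable p) (h0 : ∀ x, 0 ≤ p x)
    (hneg : ∀ x ≤ 0, p x = 0) (x : ℝ) :
    0 ≤ ∫ t in (0 : ℝ)..x, p t ∧ ∫ t in (0 : ℝ)..x, p t ≤ ∫ t, p t := by
  rcases le_total 0 x with hx | hx
  · rw [intervalIntegral.integral_of_le hx]
    exact ⟨integral_nonneg h0, setIntegral_le_integral hp (Eventually.of_forall h0)⟩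
  · have : ∫ t in (0 : ℝ)..x, p t = 0 := by
      rw [intervalIntegral.integral_symm, intervalIntegral.integral_of_le hx,
        setIntegral_congr_fun (g := fun _ => (0 : ℝ)) measurableSet_Ioc fun t ht => hneg t ht.2]
      simp
    rw [this]
    exact ⟨le_rfl, integral_nonneg h0⟩

/-- Setting f = e^{ikx} ψ makes the kernel bounded by c|V(y)| with c = 1/|k|. With N the primitive
of |V| and I its total mass, the weight e^{2c(I - N)} lies between 1 and e^{2cI}, and the factor 2
in its exponent yields the contraction constant 1/2. -/
theorem exists_isJostSolution (hV : IntegrableOn V (Ioi 0)) {z : ℂ} (hIm : 0 < (sqrtUp z).im) :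
    ∃ f, IsJostSolution V z f := by
  set k := sqrtUp z with hk
  have hk0 : k ≠ 0 := fun h => by rw [h] at hIm; simp at hIm
  set c : ℝ := ‖k‖⁻¹ with hc
  have hc0 : 0 < c := by positivity
  set p : ℝ → ℝ := (Ioi (0 : ℝ)).indicator fun x => ‖V x‖ with hp
  have hpi : Integrable p := (integrable_indicator_iff measurableSet_Ioi).2 hV.norm
  have hp0 : ∀ x, 0 ≤ p x := fun x => indicator_nonneg (fun _ _ => norm_nonneg _) x
  have hpn : ∀ x ≤ 0, p x = 0 := fun x hx => indicator_of_notMem (by simpa using hx) _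
  have hN := primitive_mem_Icc hpi hp0 hpn
  set N : ℝ → ℝ := fun x => ∫ t in (0 : ℝ)..x, p t with hNdef
  have hNc : Continuous N := intervalIntegral.continuous_primitive (fun _ _ => hpi.intervalIntegrable) 0
  set I : ℝ := ∫ t, p t
  set F : ℝ → ℝ → ℂ := fun x y => -(Complex.sin (k * ((x : ℂ) - y)) / k *
    Complex.exp (Complex.I * k * ((y : ℂ) - x)) * V y) with hF
  have hFle : ∀ x y, x ≤ y → ‖F x y‖ ≤ c * ‖V y‖ := by
    intro x y hxy
    have h1 := norm_sin_mul_exp_le hIm (t := y - x) (by linarith)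
    have h2 : F x y = k⁻¹ * (Complex.sin (k * ((y - x : ℝ) : ℂ)) *
        Complex.exp (Complex.I * k * ((y - x : ℝ) : ℂ))) * V y := by
      have : k * ((x : ℂ) - y) = -(k * ((y - x : ℝ) : ℂ)) := by push_cast; ring
      simp only [hF, this, Complex.sin_neg]
      push_cast
      ring
    rw [h2, norm_mul, norm_mul, norm_inv]
    calc ‖k‖⁻¹ * ‖_‖ * ‖V y‖ ≤ ‖k‖⁻¹ * 1 * ‖V y‖ := by gcongr
      _ = _ := by rw [mul_one]
  have hFm : ∀ x, AEStronglyMeasurable (F x) halfLineMeasure := by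
    intro x
    refine (AEStronglyMeasurable.mul ?_ hV.aestronglyMeasurable).neg
    refine Continuous.aestronglyMeasurable ?_
    fun_prop
  have hKle : ∀ x y, ‖(Ioi x).indicator (F x) y‖ ≤ (Ioi x).indicator (fun y => c * ‖V y‖) y := by
    intro x y
    by_cases hxy : x < y
    · rw [indicator_of_mem (mem_Ioi.2 hxy), indicator_of_mem (mem_Ioi.2 hxy)]
      exact hFle x y hxy.le
    · rw [indicator_of_notMem (by simpa using hxy), indicator_of_notMem (by simpa using hxy),
        norm_zero]
  obtain ⟨ψ, hψc, ⟨B, hB⟩, hψ⟩ := exists_solution_of_weight (fun x => (Ioi x).indicator (F x))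
    (fun _ => 1) (fun x => Real.exp (2 * c * I) * Real.exp (-(2 * c) * N x))
    (fun y => c * ‖V y‖) 1 (Real.exp (2 * c * I)) continuousOn_const (fun _ _ => by simp)
    (by fun_prop) (fun x => by
      rw [← Real.exp_add, Real.one_le_exp_iff]
      nlinarith [(hN x).2]) (fun x => by
      refine mul_le_of_le_one_right (Real.exp_pos _).le (Real.exp_le_one_iff.2 ?_)
      nlinarith [(hN x).1]) (fun x _ => (hFm x).indicator measurableSet_Ioi)
    (hV.norm.const_mul c) (fun x _ => Eventually.of_forall fun y => (hKle x y).trans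
      (indicator_le_self' (fun _ _ => by positivity) y))
    (fun x₀ _ => by
      filter_upwards [ae_ne_halfLine x₀] with y hy
      exact (continuousAt_indicator_Ioi (by simp only [hF]; fun_prop) hy).continuousWithinAt)
    (fun x hx => by
      have hWb : ∀ y, Real.exp (-(2 * c) * N y) ≤ 1 := fun y => by
        rw [Real.exp_le_one_iff]
        nlinarith [(hN y).1]
      have hgi : Integrable fun y => c * p y * Real.exp (-(2 * c) * N y) :=
        (hpi.const_mul c).mul_bdd (c := 1) (by
          refine Continuous.aestronglyMeasurable ?_
          fun_prop) (Eventually.of_forall fun y => by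
            rw [Real.norm_of_nonneg (Real.exp_pos _).le]
            exact hWb y)
      -- Up to a finite endpoint b the integral is exactly (e^{-2cN(x)} - e^{-2cN(b)}) / 2; the last
      -- term is dropped and b tends to infinity.
      have h1 : ∫ y in Ioi x, c * p y * Real.exp (-(2 * c) * N y) ≤
          Real.exp (-(2 * c) * N x) / 2 := by
        refine le_of_tendsto (intervalIntegral_tendsto_integral_Ioi x hgi.integrableOn tendsto_id)
          (Eventually.of_forall fun b => ?_)
        have h2 := integral_mul_exp_primitive hpi (-(2 * c)) x b
        have h3 : ∀ y, c * p y * Real.exp (-(2 * c) * N y) =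
            (-1 / 2 : ℝ) * (-(2 * c) * p y * Real.exp (-(2 * c) * ∫ t in (0 : ℝ)..y, p t)) :=
          fun y => by
            simp only [hNdef]
            ring
        simp only [id, h3]
        rw [intervalIntegral.integral_const_mul, h2]
        have h4 := Real.exp_pos (-(2 * c) * ∫ t in (0 : ℝ)..b, p t)
        simp only [hNdef]
        linarith
      calc ∫ y, ‖(Ioi x).indicator (F x) y‖ *
            (Real.exp (2 * c * I) * Real.exp (-(2 * c) * N y)) ∂halfLineMeasure
          ≤ ∫ y, (Ioi x).indicator (fun y => Real.exp (2 * c * I) *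
            (c * p y * Real.exp (-(2 * c) * N y))) y ∂halfLineMeasure := by
            refine integral_mono_of_nonneg (Eventually.of_forall fun y => by positivity)
              ((hgi.const_mul _).integrableOn.integrable.indicator measurableSet_Ioi) ?_
            filter_upwards [ae_restrict_mem measurableSet_Ioi] with y hy
            have h5 := hKle x y
            by_cases hxy : x < y
            · rw [indicator_of_mem (mem_Ioi.2 hxy) (fun y => c * ‖V y‖)] at h5
              rw [indicator_of_mem (mem_Ioi.2 hxy) (fun y => Real.exp (2 * c * I) *
                (c * p y * Real.exp (-(2 * c) * N y)))]
              have h6 : p y = ‖V y‖ := indicator_of_mem hy _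
              rw [h6]
              calc _ ≤ c * ‖V y‖ * (Real.exp (2 * c * I) * Real.exp (-(2 * c) * N y)) := by
                    gcongr
                _ = _ := by ring
            · rw [indicator_of_notMem (by simpa using hxy),
                indicator_of_notMem (by simpa using hxy)]
              simp
        _ = Real.exp (2 * c * I) * ∫ y in Ioi x, c * p y * Real.exp (-(2 * c) * N y) := by
            rw [setIntegral_indicator measurableSet_Ioi, Ioi_inter_Ioi, sup_eq_right.2 hx,
              integral_const_mul]
        _ ≤ _ := by
            rw [mul_div_assoc]
            gcongr)
  have hexp : ∀ x y : ℝ, greenKernel z x y * V y * (Complex.exp (Complex.I * k * y) * ψ y) =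
      -(Complex.exp (Complex.I * k * x) * (F x y * ψ y)) := by
    intro x y
    have : Complex.exp (Complex.I * k * y) = Complex.exp (Complex.I * k * x) *
        Complex.exp (Complex.I * k * ((y : ℂ) - x)) := by
      rw [← Complex.exp_add]
      congr 1
      ring
    simp only [greenKernel, ← hk, hF, this]
    ring
  refine ⟨fun x => Complex.exp (Complex.I * k * x) * ψ x, ?_, fun x hx => ⟨?_, ?_⟩⟩
  · exact Continuous.continuousOn (by fun_prop)
  · simp only [hexp]
    refine Integrable.neg (Integrable.const_mul ?_ _)
    refine Integrable.mono' (((hV.mono_set (Ioi_subset_Ioi hx)).norm.const_mul c).mul_const B)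
      (((hFm x).mono_measure (Measure.restrict_mono (Ioi_subset_Ioi hx) le_rfl)).mul
      hψc.aestronglyMeasurable) ?_
    filter_upwards [ae_restrict_mem measurableSet_Ioi] with y hy
    rw [norm_mul]
    exact mul_le_mul (hFle x y (le_of_lt hy)) (hB y) (norm_nonneg _) (by positivity)
  · simp only [hexp]
    rw [integral_neg, integral_const_mul, hψ x hx, ← hk]
    have : ∫ y, (Ioi x).indicator (F x) y * ψ y ∂halfLineMeasure = ∫ y in Ioi x, F x y * ψ y := by
      have h1 : ∀ y, (Ioi x).indicator (F x) y * ψ y =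
          (Ioi x).indicator (fun y => F x y * ψ y) y := fun y => by
        unfold indicator
        split_ifs <;> simp
      simp only [h1]
      rw [setIntegral_indicator measurableSet_Ioi, Ioi_inter_Ioi, sup_eq_right.2 hx]
    rw [this]
    ring

/-- Solutions may grow like e^{Im k x}, so φ = e^{-ikx} η is substituted. The integration now runs
over y ≤ x, and the weight is the increasing e^{2cN}. -/
theorem exists_isVolterraSolution (hV : IntegrableOn V (Ioi 0)) {z : ℂ} (hIm : 0 < (sqrtUp z).im)
    {φ₀ : ℝ → ℂ} (hφ₀ : Continuous φ₀) {M : ℝ}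
    (hM : ∀ x : ℝ, 0 ≤ x → ‖φ₀ x * Complex.exp (Complex.I * sqrtUp z * x)‖ ≤ M) :
    ∃ φ, IsVolterraSolution V z φ₀ φ := by
  set k := sqrtUp z with hk
  have hk0 : k ≠ 0 := fun h => by rw [h] at hIm; simp at hIm
  set c : ℝ := ‖k‖⁻¹ with hc
  have hc0 : 0 < c := by positivity
  set p : ℝ → ℝ := (Ioi (0 : ℝ)).indicator fun x => ‖V x‖ with hp
  have hpi : Integrable p := (integrable_indicator_iff measurableSet_Ioi).2 hV.norm
  have hp0 : ∀ x, 0 ≤ p x := fun x => indicator_nonneg (fun _ _ => norm_nonneg _) x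
  have hpn : ∀ x ≤ 0, p x = 0 := fun x hx => indicator_of_notMem (by simpa using hx) _
  have hN := primitive_mem_Icc hpi hp0 hpn
  set N : ℝ → ℝ := fun x => ∫ t in (0 : ℝ)..x, p t with hNdef
  have hNc : Continuous N := intervalIntegral.continuous_primitive (fun _ _ => hpi.intervalIntegrable) 0
  set I : ℝ := ∫ t, p t
  set F : ℝ → ℝ → ℂ := fun x y => Complex.sin (k * ((x : ℂ) - y)) / k *
    Complex.exp (Complex.I * k * ((x : ℂ) - y)) * V y with hF
  have hFle : ∀ x y, y ≤ x → ‖F x y‖ ≤ c * ‖V y‖ := by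
    intro x y hxy
    have h1 := norm_sin_mul_exp_le hIm (t := x - y) (by linarith)
    have h2 : F x y = k⁻¹ * (Complex.sin (k * ((x - y : ℝ) : ℂ)) *
        Complex.exp (Complex.I * k * ((x - y : ℝ) : ℂ))) * V y := by
      simp only [hF]
      push_cast
      ring
    rw [h2, norm_mul, norm_mul, norm_inv]
    calc ‖k‖⁻¹ * ‖_‖ * ‖V y‖ ≤ ‖k‖⁻¹ * 1 * ‖V y‖ := by gcongr
      _ = _ := by rw [mul_one]
  have hFm : ∀ x, AEStronglyMeasurable (F x) halfLineMeasure := by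
    intro x
    refine AEStronglyMeasurable.mul ?_ hV.aestronglyMeasurable
    refine Continuous.aestronglyMeasurable ?_
    fun_prop
  have hKle : ∀ x y, ‖(Iic x).indicator (F x) y‖ ≤ (Iic x).indicator (fun y => c * ‖V y‖) y := by
    intro x y
    by_cases hxy : y ≤ x
    · rw [indicator_of_mem (mem_Iic.2 hxy), indicator_of_mem (mem_Iic.2 hxy)]
      exact hFle x y hxy
    · rw [indicator_of_notMem (by simpa using hxy), indicator_of_notMem (by simpa using hxy),
        norm_zero]
  obtain ⟨η, hηc, -, hη⟩ := exists_solution_of_weight (fun x => (Iic x).indicator (F x))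
    (fun x => φ₀ x * Complex.exp (Complex.I * k * x)) (fun x => Real.exp (2 * c * N x))
    (fun y => c * ‖V y‖) M (Real.exp (2 * c * I))
    (Continuous.continuousOn (by fun_prop)) hM
    (by fun_prop) (fun x => by
      rw [Real.one_le_exp_iff]
      nlinarith [(hN x).1]) (fun x => by
      rw [Real.exp_le_exp]
      nlinarith [(hN x).2]) (fun x _ => (hFm x).indicator measurableSet_Iic)
    (hV.norm.const_mul c) (fun x _ => Eventually.of_forall fun y => (hKle x y).trans
      (indicator_le_self' (fun _ _ => by positivity) y))
    (fun x₀ _ => by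
      filter_upwards [ae_ne_halfLine x₀] with y hy
      exact (continuousAt_indicator_Iic (by simp only [hF]; fun_prop) hy).continuousWithinAt)
    (fun x hx => by
      have hgi : Integrable fun y => c * p y * Real.exp (2 * c * N y) :=
        (hpi.const_mul c).mul_bdd (c := Real.exp (2 * c * I)) (by
          refine Continuous.aestronglyMeasurable ?_
          fun_prop) (Eventually.of_forall fun y => by
            rw [Real.norm_of_nonneg (Real.exp_pos _).le, Real.exp_le_exp]
            nlinarith [(hN y).2])
      have h1 : ∫ y in (0 : ℝ)..x, c * p y * Real.exp (2 * c * N y) ≤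
          Real.exp (2 * c * N x) / 2 := by
        have h2 := integral_mul_exp_primitive hpi (2 * c) 0 x
        have h3 : ∀ y, c * p y * Real.exp (2 * c * N y) =
            (1 / 2 : ℝ) * (2 * c * p y * Real.exp (2 * c * ∫ t in (0 : ℝ)..y, p t)) :=
          fun y => by
            simp only [hNdef]
            ring
        simp only [h3]
        rw [intervalIntegral.integral_const_mul, h2]
        have h4 := Real.exp_pos (2 * c * ∫ t in (0 : ℝ)..0, p t)
        simp only [hNdef]
        linarith
      calc ∫ y, ‖(Iic x).indicator (F x) y‖ * Real.exp (2 * c * N y) ∂halfLineMeasure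
          ≤ ∫ y, (Iic x).indicator (fun y =>
            (c * p y * Real.exp (2 * c * N y))) y ∂halfLineMeasure := by
            refine integral_mono_of_nonneg (Eventually.of_forall fun y => by positivity)
              (hgi.integrableOn.integrable.indicator measurableSet_Iic) ?_
            filter_upwards [ae_restrict_mem measurableSet_Ioi] with y hy
            have h5 := hKle x y
            by_cases hxy : y ≤ x
            · rw [indicator_of_mem (mem_Iic.2 hxy) (fun y => c * ‖V y‖)] at h5
              rw [indicator_of_mem (mem_Iic.2 hxy) (fun y =>
                (c * p y * Real.exp (2 * c * N y)))]
              have h6 : p y = ‖V y‖ := indicator_of_mem hy _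
              rw [h6]
              gcongr
            · rw [indicator_of_notMem (by simpa using hxy),
                indicator_of_notMem (by simpa using hxy)]
              simp
        _ = ∫ y in (0 : ℝ)..x, c * p y * Real.exp (2 * c * N y) := by
            rw [setIntegral_indicator measurableSet_Iic, Ioi_inter_Iic,
              intervalIntegral.integral_of_le hx]
        _ ≤ _ := h1)
  have hinv : ∀ x : ℝ, Complex.exp (Complex.I * k * x) * Complex.exp (-(Complex.I * k * x)) = 1 := by
    intro x
    rw [← Complex.exp_add, add_neg_cancel, Complex.exp_zero]
  have hexp : ∀ x y : ℝ, greenKernel z x y * V y * (Complex.exp (-(Complex.I * k * y)) * η y) =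
      Complex.exp (-(Complex.I * k * x)) * (F x y * η y) := by
    intro x y
    have : Complex.exp (-(Complex.I * k * y)) = Complex.exp (-(Complex.I * k * x)) *
        Complex.exp (Complex.I * k * ((x : ℂ) - y)) := by
      rw [← Complex.exp_add]
      congr 1
      ring
    simp only [greenKernel, ← hk, hF, this]
    ring
  refine ⟨fun x => Complex.exp (-(Complex.I * k * x)) * η x, ?_, fun x hx => ?_⟩
  · exact Continuous.continuousOn (by fun_prop)
  · simp only [hexp]
    rw [intervalIntegral.integral_const_mul, hη x hx]
    have : ∫ y, (Iic x).indicator (F x) y * η y ∂halfLineMeasure =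
        ∫ y in (0 : ℝ)..x, F x y * η y := by
      have h1 : ∀ y, (Iic x).indicator (F x) y * η y =
          (Iic x).indicator (fun y => F x y * η y) y := fun y => by
        unfold indicator
        split_ifs <;> simp
      simp only [h1]
      rw [setIntegral_indicator measurableSet_Iic, Ioi_inter_Iic,
        intervalIntegral.integral_of_le hx]
    rw [this]
    linear_combination φ₀ x * hinv x

theorem jost_isJostSolution (hV : IntegrableOn V (Ioi 0)) {z : ℂ} (hIm : 0 < (sqrtUp z).im) :
    IsJostSolution V z (jost V z) :=
  Classical.epsilon_spec (exists_isJostSolution hV hIm)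

theorem phiD_isVolterraSolution (hV : IntegrableOn V (Ioi 0)) {z : ℂ} (hIm : 0 < (sqrtUp z).im) :
    IsVolterraSolution V z (freeSin z) (phiD V z) := by
  refine Classical.epsilon_spec (exists_isVolterraSolution (M := ‖sqrtUp z‖⁻¹) hV hIm ?_
    fun x hx => ?_)
  · unfold freeSin
    fun_prop
  · have h1 := norm_sin_mul_exp_le hIm hx
    rw [freeSin, div_mul_eq_mul_div, norm_div, div_eq_mul_inv]
    exact mul_le_of_le_one_left (by positivity) h1

theorem thetaD_isVolterraSolution (hV : IntegrableOn V (Ioi 0)) {z : ℂ}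
    (hIm : 0 < (sqrtUp z).im) : IsVolterraSolution V z (freeCos z) (thetaD V z) := by
  refine Classical.epsilon_spec (exists_isVolterraSolution (M := 1) hV hIm ?_ fun x hx => ?_)
  · unfold freeCos
    fun_prop
  · exact norm_cos_mul_exp_le hIm hx

end Existence

/-! ### Regularity, decay and initial values of the solutions. -/

section Solutions

variable {k : ℂ} {V : ℝ → ℂ}

lemma locallyIntegrable_indicator_mul (hV : IntegrableOn V (Ioi 0)) {φ : ℝ → ℂ}
    (hφ : ContinuousOn φ (Ici 0)) :
    LocallyIntegrable ((Ioi (0 : ℝ)).indicator fun x => V x * φ x) := by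
  rw [locallyIntegrable_iff]
  intro K hK
  obtain ⟨R, hR⟩ := hK.isBounded.subset_closedBall 0
  rw [Real.closedBall_eq_Icc] at hR
  rw [integrableOn_indicator_iff measurableSet_Ioi]
  have h1 : IntegrableOn (fun x => V x * φ x) (Ioc 0 (0 + R)) :=
    IntegrableOn.mul_continuousOn_of_subset (hV.mono_set Ioc_subset_Ioi_self)
      (hφ.mono Icc_subset_Ici_self) measurableSet_Ioc isCompact_Icc Ioc_subset_Icc_self
  exact h1.mono_set fun x hx => ⟨hx.1, (hR hx.2).2⟩

lemma IsC1AC.congr_ae {F F' F'' G'' : ℝ → ℂ} (hF : IsC1AC F F' F'')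
    (h : G'' =ᵐ[halfLineMeasure] F'') : IsC1AC F F' G'' := by
  refine ⟨hF.hasDeriv, hF.ac, hF.ac', ?_⟩
  filter_upwards [hF.hasDeriv', h] with x h1 h2
  rw [h2]
  exact h1

/-- Bootstrapping: φ occurs on both sides, and mere continuity of φ makes Vφ locally integrable,
which suffices for the regularity of the right-hand side. -/
lemma isC1AC_of_eqOn_inhomSol (hk : k ≠ 0) (hV : IntegrableOn V (Ioi 0)) {φ : ℝ → ℂ}
    (hφ : ContinuousOn φ (Ici 0)) {a b : ℂ}
    (h : EqOn φ (inhomSol k a b ((Ioi (0 : ℝ)).indicator fun x => V x * φ x)) (Ici 0)) :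
    IsC1AC φ (inhomSolDeriv k a b ((Ioi (0 : ℝ)).indicator fun x => V x * φ x))
      (fun x => (V x - k ^ 2) * φ x) := by
  refine ((isC1AC_inhomSol hk (locallyIntegrable_indicator_mul hV hφ) a b).congr h).congr_ae ?_
  filter_upwards [ae_restrict_mem measurableSet_Ioi] with x hx
  rw [indicator_of_mem hx, ← h (mem_Ici.2 (le_of_lt hx))]
  ring

lemma setIntegral_interval_indicator (F : ℝ → ℂ → ℂ) (q : ℝ → ℂ) {x : ℝ}
    (hx : 0 ≤ x) : ∫ y in (0 : ℝ)..x, F y ((Ioi (0 : ℝ)).indicator q y) =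
      ∫ y in (0 : ℝ)..x, F y (q y) := by
  rw [intervalIntegral.integral_of_le hx, intervalIntegral.integral_of_le hx]
  refine setIntegral_congr_fun measurableSet_Ioc fun y hy => ?_
  rw [indicator_of_mem (mem_Ioi.2 hy.1)]

lemma IsVolterraSolution.eqOn_inhomSol {z a b : ℂ} {φ₀ φ : ℝ → ℂ}
    (hφ : IsVolterraSolution V z φ₀ φ)
    (h₀ : ∀ x : ℝ, φ₀ x = a * Complex.cos (sqrtUp z * x) + b * (Complex.sin (sqrtUp z * x) / sqrtUp z)) :
    EqOn φ (inhomSol (sqrtUp z) a b ((Ioi (0 : ℝ)).indicator fun x => V x * φ x)) (Ici 0) := by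
  intro x hx
  rw [hφ.2 x hx, h₀, inhomSol]
  congr 1
  rw [setIntegral_interval_indicator
    (fun y c => Complex.sin (sqrtUp z * ((x : ℂ) - (y : ℂ))) / sqrtUp z * c) _ hx]
  refine intervalIntegral.integral_congr fun y _ => ?_
  simp only [greenKernel]
  ring

/-- Once Im k · y ≥ 1, the growing exponential has modulus E ≥ 2 and the decaying one at most 1, so
|sin| ≥ (E - 1)/2 ≥ E/4. -/
lemma exp_le_four_mul_norm_sin (hk : 0 < k.im) {y : ℝ} (hy : k.im⁻¹ ≤ y) :
    Real.exp (k.im * y) ≤ 4 * ‖Complex.sin (k * y)‖ := by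
  have h0 : 1 ≤ k.im * y := by
    have := mul_le_mul_of_nonneg_left hy hk.le
    rwa [mul_inv_cancel₀ hk.ne'] at this
  have h1 : 2 ≤ Real.exp (k.im * y) := by
    have := Real.add_one_le_exp (k.im * y)
    linarith
  have h2 : Real.exp (-k.im * y) ≤ 1 := Real.exp_le_one_iff.2 (by linarith)
  have h3 := norm_sub_norm_le (Complex.exp (-(Complex.I * k * y))) (Complex.exp (Complex.I * k * y))
  rw [norm_exp_neg_I_mul, norm_exp_I_mul] at h3
  rw [sin_mul_eq, norm_div, norm_mul, Complex.norm_I, mul_one, Complex.norm_ofNat]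
  linarith

lemma integrable_bdd_exp_mul {W c : ℝ → ℂ}
    (hW : IntegrableOn (fun y : ℝ => Complex.exp (-(Complex.I * k * y)) * W y) (Ioi 0))
    (hc : Continuous c) (hle : ∀ y, 0 ≤ y → ‖c y‖ ≤ Real.exp (k.im * y)) :
    IntegrableOn (fun y => c y * W y) (Ioi 0) := by
  have h1 : ∀ y, c y * W y = c y * Complex.exp (Complex.I * k * y) *
      (Complex.exp (-(Complex.I * k * y)) * W y) := fun y => by
    have : Complex.exp (Complex.I * k * y) * Complex.exp (-(Complex.I * k * y)) = 1 := by
      rw [← Complex.exp_add, add_neg_cancel, Complex.exp_zero]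
    linear_combination -(c y * W y) * this
  simp only [h1]
  refine Integrable.bdd_mul (c := 1) hW (Continuous.aestronglyMeasurable (by fun_prop)) ?_
  filter_upwards [ae_restrict_mem measurableSet_Ioi] with y hy
  rw [norm_mul, norm_exp_I_mul]
  calc ‖c y‖ * Real.exp (-k.im * y) ≤ Real.exp (k.im * y) * Real.exp (-k.im * y) := by
        gcongr
        exact hle y (le_of_lt hy)
    _ = 1 := by rw [← Real.exp_add]; simp

lemma memLp_two_of_exp_decay (hk : 0 < k.im) {F : ℝ → ℂ} (hF : ContinuousOn F (Ici 0)) {C : ℝ}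
    (hC : ∀ x, 0 ≤ x → ‖F x‖ ≤ C * Real.exp (-k.im * x)) : MemLp F 2 halfLineMeasure := by
  have hm : AEStronglyMeasurable F halfLineMeasure :=
    (hF.mono Ioi_subset_Ici_self).aestronglyMeasurable measurableSet_Ioi
  rw [memLp_two_iff_integrable_sq_norm hm]
  have h1 : IntegrableOn (fun x => C ^ 2 * Real.exp (-(2 * k.im) * x)) (Ioi 0) :=
    (integrableOn_exp_mul_Ioi (by linarith) 0).const_mul _
  refine Integrable.mono' h1 (hm.norm.pow 2) ?_
  filter_upwards [ae_restrict_mem measurableSet_Ioi] with x hx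
  rw [Real.norm_of_nonneg (by positivity)]
  calc ‖F x‖ ^ 2 ≤ (C * Real.exp (-k.im * x)) ^ 2 := by
        gcongr
        exact hC x (le_of_lt hx)
    _ = _ := by
      rw [mul_pow, ← Real.exp_nat_mul]
      congr 2
      push_cast
      ring

lemma memLp_two_exp (hk : 0 < k.im) :
    MemLp (fun x : ℝ => Complex.exp (Complex.I * k * x)) 2 halfLineMeasure :=
  memLp_two_of_exp_decay hk (C := 1) (Continuous.continuousOn (by fun_prop))
    fun x _ => by rw [norm_exp_I_mul, one_mul]

/-- The growth e^{Im k (y - x)} splits into the desired decay in x and a factor in y that the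
integrability hypothesis absorbs. -/
lemma norm_integral_Ioi_le_exp {W : ℝ → ℂ} {c : ℝ → ℂ}
    (hW : IntegrableOn (fun y : ℝ => Complex.exp (-(Complex.I * k * y)) * W y) (Ioi 0))
    (hle : ∀ t, 0 ≤ t → ‖c t‖ ≤ Real.exp (k.im * t)) {x : ℝ} (hx : 0 ≤ x) :
    ‖∫ y in Ioi x, c (y - x) * W y‖ ≤
      (∫ y in Ioi (0 : ℝ), ‖Complex.exp (-(Complex.I * k * y)) * W y‖) * Real.exp (-k.im * x) := by
  rw [mul_comm, ← integral_const_mul]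
  have h1 : IntegrableOn (fun y : ℝ => Real.exp (-k.im * x) *
      ‖Complex.exp (-(Complex.I * k * y)) * W y‖) (Ioi 0) := hW.norm.const_mul _
  refine (norm_integral_le_of_norm_le (h1.mono_set (Ioi_subset_Ioi hx)) ?_).trans
    (setIntegral_mono_set h1 (Eventually.of_forall fun y => by positivity)
      (Ioi_subset_Ioi hx).eventuallyLE)
  filter_upwards [ae_restrict_mem measurableSet_Ioi] with y hy
  rw [norm_mul, norm_mul, norm_exp_neg_I_mul, ← mul_assoc, ← Real.exp_add]
  gcongr
  refine (hle _ (sub_nonneg.2 (le_of_lt hy))).trans (Real.exp_le_exp.2 (le_of_eq ?_))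
  ring

/-- The Jost solution times the potential decays exponentially in the mean. -/
lemma IsJostSolution.integrableOn_exp {z : ℂ} {f : ℝ → ℂ} (hf : IsJostSolution V z f)
    (hV : IntegrableOn V (Ioi 0)) (hIm : 0 < (sqrtUp z).im) :
    IntegrableOn (fun y : ℝ => Complex.exp (-(Complex.I * sqrtUp z * y)) * (V y * f y)) (Ioi 0) := by
  set k := sqrtUp z with hk
  have hk0 : k ≠ 0 := fun h => by rw [h] at hIm; simp at hIm
  set R := k.im⁻¹ with hR
  have hR0 : 0 < R := by positivity
  have hloc := locallyIntegrable_indicator_mul hV hf.1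
  rw [← Ioc_union_Ioi_eq_Ioi hR0.le]
  refine IntegrableOn.union ?_ ?_
  · have h1 := (locallyIntegrable_continuous_mul
      (c := fun y : ℝ => Complex.exp (-(Complex.I * k * y))) (by fun_prop) hloc).integrableOn_isCompact
      (isCompact_Icc (a := (0 : ℝ)) (b := R))
    refine (h1.mono_set Ioc_subset_Icc_self).congr_fun (fun y hy => ?_) measurableSet_Ioc
    simp only
    rw [indicator_of_mem (mem_Ioi.2 hy.1)]
  -- The equation at x = 0 already contains integrability of sin(ky) V f / k, and beyond 1 / Im k
  -- the sine is comparable to the growing exponential. Thus every solution decays, not just the one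
  -- constructed by contraction.
  · have h1 := ((hf.2 0 le_rfl).1.mono_set (Ioi_subset_Ioi hR0.le)).norm.const_mul (4 * ‖k‖)
    have hm : AEStronglyMeasurable (fun y : ℝ => Complex.exp (-(Complex.I * k * y)) * (V y * f y))
        (volume.restrict (Ioi R)) := by
      refine AEStronglyMeasurable.mul (Continuous.aestronglyMeasurable (by fun_prop)) ?_
      refine (AEStronglyMeasurable.mul hV.aestronglyMeasurable
        ((hf.1.mono Ioi_subset_Ici_self).aestronglyMeasurable measurableSet_Ioi)).mono_measure
        (Measure.restrict_mono (Ioi_subset_Ioi hR0.le) le_rfl)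
    refine Integrable.mono' h1 hm ?_
    filter_upwards [ae_restrict_mem measurableSet_Ioi] with y hy
    have h2 := exp_le_four_mul_norm_sin hIm (le_of_lt hy)
    have h3 : ‖greenKernel z 0 y‖ = ‖Complex.sin (k * y)‖ / ‖k‖ := by
      rw [greenKernel, norm_div, ← hk]
      congr 1
      rw [← norm_neg (Complex.sin (k * y)), ← Complex.sin_neg]
      congr 2
      push_cast
      ring
    rw [norm_mul, norm_exp_neg_I_mul, mul_assoc (greenKernel z 0 y), norm_mul (greenKernel z 0 y), h3]
    calc _ ≤ (4 * ‖Complex.sin (k * y)‖) * ‖V y * f y‖ := by gcongr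
      _ = _ := by
        have : ‖k‖ ≠ 0 := norm_ne_zero_iff.2 hk0
        field_simp

/-- The main properties of the Jost solution. -/
theorem IsJostSolution.exists_deriv {z : ℂ} {f : ℝ → ℂ} (hf : IsJostSolution V z f)
    (hV : IntegrableOn V (Ioi 0)) (hIm : 0 < (sqrtUp z).im) :
    ∃ f' : ℝ → ℂ, IsC1AC f f' (fun x => (V x - z) * f x) ∧ MemLp f 2 halfLineMeasure ∧
      MemLp f' 2 halfLineMeasure ∧ (∃ C, ∀ x, 0 ≤ x → ‖f x‖ ≤ C) ∧
      EqOn f (inhomSol (sqrtUp z) (f 0) (f' 0) ((Ioi (0 : ℝ)).indicator fun x => V x * f x))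
        (Ici 0) ∧
      IntegrableOn (fun y : ℝ => Complex.exp (Complex.I * sqrtUp z * y) * (V y * f y)) (Ioi 0) ∧
      f' 0 = Complex.I * sqrtUp z * f 0 -
        ∫ y in Ioi (0 : ℝ), Complex.exp (Complex.I * sqrtUp z * y) * (V y * f y) := by
  have hexp := hf.integrableOn_exp hV hIm
  set k := sqrtUp z with hk
  have hz : z = k ^ 2 := (sqrtUp_sq z).symm
  have hk0 : k ≠ 0 := fun h => by rw [h] at hIm; simp at hIm
  set W : ℝ → ℂ := fun y => V y * f y with hW
  have hloc := locallyIntegrable_indicator_mul hV hf.1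
  have hsin : IntegrableOn (fun y : ℝ => Complex.sin (k * y) * W y) (Ioi 0) :=
    integrable_bdd_exp_mul hexp (by fun_prop) fun y hy => norm_sin_mul_le hIm hy
  have hcos : IntegrableOn (fun y : ℝ => Complex.cos (k * y) * W y) (Ioi 0) :=
    integrable_bdd_exp_mul hexp (by fun_prop) fun y hy => norm_cos_mul_le hIm hy
  have hE : IntegrableOn (fun y : ℝ => Complex.exp (Complex.I * k * y) * W y) (Ioi 0) :=
    integrable_bdd_exp_mul hexp (by fun_prop) fun y hy => by
      rw [norm_exp_I_mul]
      exact Real.exp_le_exp.2 (by nlinarith)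
  -- a and b are f(0) and f'(0): splitting each integral over (x, ∞) as the one over (0, ∞) minus
  -- the one over (0, x) turns the Jost equation into a Volterra equation with these initial data.
  set a : ℂ := 1 + k⁻¹ * ∫ y in Ioi (0 : ℝ), Complex.sin (k * y) * W y with ha
  set b : ℂ := Complex.I * k - ∫ y in Ioi (0 : ℝ), Complex.cos (k * y) * W y with hb
  have hexpk : ∀ x : ℝ, Complex.exp (Complex.I * k * x) =
      Complex.cos (k * x) + Complex.sin (k * x) * Complex.I := fun x => by
    rw [← Complex.exp_mul_I]
    congr 1
    ring
  have hsplit : ∀ (g : ℝ → ℂ), IntegrableOn g (Ioi 0) → ∀ x : ℝ, 0 ≤ x →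
      ∫ y in Ioi x, g y = (∫ y in Ioi (0 : ℝ), g y) - ∫ y in (0 : ℝ)..x, g y := by
    intro g hg x hx
    rw [intervalIntegral.integral_Ioi_sub_Ioi hg hx |>.symm]
    ring
  have hint : ∀ (c : ℝ → ℂ) (x : ℝ), 0 ≤ x → ∫ y in (0 : ℝ)..x, c y * (Ioi (0 : ℝ)).indicator W y =
      ∫ y in (0 : ℝ)..x, c y * W y := fun c x hx =>
    setIntegral_interval_indicator (fun y d => c y * d) W hx
  have heq : EqOn f (inhomSol k a b ((Ioi (0 : ℝ)).indicator W)) (Ici 0) := by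
    intro x hx
    have h1 : ∫ x' in Ioi x, greenKernel z x x' * V x' * f x' =
        k⁻¹ * Complex.sin (k * x) * (∫ y in Ioi x, Complex.cos (k * y) * W y) -
        k⁻¹ * Complex.cos (k * x) * ∫ y in Ioi x, Complex.sin (k * y) * W y := by
      rw [← integral_const_mul, ← integral_const_mul, ← integral_sub
        ((hcos.mono_set (Ioi_subset_Ioi hx)).const_mul _)
        ((hsin.mono_set (Ioi_subset_Ioi hx)).const_mul _)]
      refine setIntegral_congr_fun measurableSet_Ioi fun y _ => ?_
      simp only [greenKernel, ← hk, mul_sub, Complex.sin_sub, hW]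
      field_simp
    rw [(hf.2 x hx).2, h1, inhomSol_eq hk0 hloc, hint _ x hx, hint _ x hx, hsplit _ hcos x hx,
      hsplit _ hsin x hx, ← hk, hexpk, ha, hb]
    field_simp
    ring
  have hfC := isC1AC_of_eqOn_inhomSol hk0 hV hf.1 heq
  have hf0 : f 0 = a := by rw [heq self_mem_Ici, inhomSol_zero]
  have hfb : ∀ x, 0 ≤ x → ‖f x‖ ≤ (1 + ‖k⁻¹‖ *
      ∫ y in Ioi (0 : ℝ), ‖Complex.exp (-(Complex.I * k * y)) * W y‖) * Real.exp (-k.im * x) := by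
    intro x hx
    have h1 : ∫ x' in Ioi x, greenKernel z x x' * V x' * f x' =
        -k⁻¹ * ∫ y in Ioi x, Complex.sin (k * ((y - x : ℝ) : ℂ)) * W y := by
      rw [← integral_const_mul]
      refine setIntegral_congr_fun measurableSet_Ioi fun y _ => ?_
      have : k * ((x : ℂ) - y) = -(k * ((y - x : ℝ) : ℂ)) := by push_cast; ring
      simp only [greenKernel, ← hk, this, Complex.sin_neg, hW]
      field_simp
    rw [(hf.2 x hx).2, h1]
    refine (norm_sub_le _ _).trans ?_
    rw [← hk, norm_exp_I_mul, norm_mul, norm_neg, add_mul, one_mul, mul_assoc]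
    gcongr
    exact norm_integral_Ioi_le_exp (c := fun t => Complex.sin (k * t)) hexp
      (fun t ht => norm_sin_mul_le hIm ht) hx
  refine ⟨_, by rw [hz]; exact hfC, memLp_two_of_exp_decay hIm hf.1 hfb, ?_, ⟨_, fun x hx =>
    (hfb x hx).trans (mul_le_of_le_one_right (by positivity) (Real.exp_le_one_iff.2 (by
      nlinarith)))⟩, ?_, hE, ?_⟩
  · refine memLp_two_of_exp_decay hIm hfC.continuousOn' (C := ‖Complex.I * k‖ +
      ∫ y in Ioi (0 : ℝ), ‖Complex.exp (-(Complex.I * k * y)) * W y‖) fun x hx => ?_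
    have h1 : inhomSolDeriv k a b ((Ioi (0 : ℝ)).indicator W) x =
        Complex.I * k * Complex.exp (Complex.I * k * x) -
        ∫ y in Ioi x, Complex.cos (k * ((y - x : ℝ) : ℂ)) * W y := by
      have h2 : ∫ y in Ioi x, Complex.cos (k * ((y - x : ℝ) : ℂ)) * W y =
          Complex.cos (k * x) * (∫ y in Ioi x, Complex.cos (k * y) * W y) +
          Complex.sin (k * x) * ∫ y in Ioi x, Complex.sin (k * y) * W y := by
        rw [← integral_const_mul, ← integral_const_mul, ← integral_add
          ((hcos.mono_set (Ioi_subset_Ioi hx)).const_mul _)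
          ((hsin.mono_set (Ioi_subset_Ioi hx)).const_mul _)]
        refine setIntegral_congr_fun measurableSet_Ioi fun y _ => ?_
        simp only [Complex.ofReal_sub, mul_sub, Complex.cos_sub]
        ring
      rw [h2, inhomSolDeriv_eq hloc, hint _ x hx, hint _ x hx, hsplit _ hcos x hx,
        hsplit _ hsin x hx, hexpk, ha, hb]
      field_simp
      linear_combination -(k * Complex.sin (k * x)) * Complex.I_sq
    rw [h1]
    refine (norm_sub_le _ _).trans ?_
    rw [norm_mul, norm_exp_I_mul, add_mul]
    gcongr
    exact norm_integral_Ioi_le_exp (c := fun t => Complex.cos (k * t)) hexp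
      (fun t ht => norm_cos_mul_le hIm ht) hx
  · rw [hf0, inhomSolDeriv_zero]
    exact heq
  · rw [inhomSolDeriv_zero, hf0]
    have h1 : ∫ y in Ioi (0 : ℝ), Complex.exp (Complex.I * k * y) * W y =
        (∫ y in Ioi (0 : ℝ), Complex.cos (k * y) * W y) +
        Complex.I * ∫ y in Ioi (0 : ℝ), Complex.sin (k * y) * W y := by
      rw [← integral_const_mul, ← integral_add hcos (hsin.const_mul _)]
      refine setIntegral_congr_fun measurableSet_Ioi fun y _ => ?_
      simp only [hexpk]
      ring
    rw [h1, ha, hb]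
    field_simp
    ring

/-- The Wronskian of two solutions of the same equation is constant. -/
lemma wronskian_eq_of_isC1AC {z : ℂ} {f f' h h' : ℝ → ℂ}
    (hf : IsC1AC f f' fun x => (V x - z) * f x) (hh : IsC1AC h h' fun x => (V x - z) * h x) {x : ℝ}
    (hx : 0 ≤ x) : wronskian f h x = f 0 * h' 0 - f' 0 * h 0 := by
  rw [wronskian, hf.deriv₀ hx, hh.deriv₀ hx]
  have := wronskian_eq_add_integral hf hh (w := fun _ => 0) (locallyIntegrable_const 0)
    (Eventually.of_forall fun x => by ring) x hx
  simpa using this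

lemma exists_phiD_deriv (hV : IntegrableOn V (Ioi 0)) {z : ℂ} (hIm : 0 < (sqrtUp z).im) :
    ∃ φ', IsC1AC (phiD V z) φ' (fun x => (V x - z) * phiD V z x) ∧ phiD V z 0 = 0 ∧ φ' 0 = 1 := by
  have hk0 : sqrtUp z ≠ 0 := fun h => by rw [h] at hIm; simp at hIm
  have h1 := phiD_isVolterraSolution hV hIm
  have h2 := h1.eqOn_inhomSol (a := 0) (b := 1) fun x => by simp [freeSin]
  have h3 := isC1AC_of_eqOn_inhomSol hk0 hV h1.1 h2
  rw [sqrtUp_sq] at h3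
  exact ⟨_, h3, by rw [h2 self_mem_Ici, inhomSol_zero], inhomSolDeriv_zero _ _ _ _⟩

lemma IsC1AC.neg {F F' F'' : ℝ → ℂ} (hF : IsC1AC F F' F'') : IsC1AC (-F) (-F') (-F'') :=
  ⟨fun x hx => (hF.hasDeriv x hx).neg, fun R hR => (hF.ac R hR).neg, fun R hR => (hF.ac' R hR).neg,
    hF.hasDeriv'.mono fun _ h => h.neg⟩

lemma exists_phiN_deriv (hV : IntegrableOn V (Ioi 0)) {z : ℂ} (hIm : 0 < (sqrtUp z).im) :
    ∃ φ', IsC1AC (phiN V z) φ' (fun x => (V x - z) * phiN V z x) ∧ phiN V z 0 = -1 ∧ φ' 0 = 0 := by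
  have hk0 : sqrtUp z ≠ 0 := fun h => by rw [h] at hIm; simp at hIm
  have h1 := thetaD_isVolterraSolution hV hIm
  have h2 := h1.eqOn_inhomSol (a := 1) (b := 0) fun x => by simp [freeCos]
  have h3 := (isC1AC_of_eqOn_inhomSol hk0 hV h1.1 h2).neg
  rw [sqrtUp_sq] at h3
  refine ⟨_, h3.congr_ae (Eventually.of_forall fun x => ?_), ?_, ?_⟩
  · simp [phiN]
  · simp only [phiN, Pi.neg_apply]
    rw [h2 self_mem_Ici, inhomSol_zero]
  · rw [Pi.neg_apply, inhomSolDeriv_zero, neg_zero]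

end Solutions

/-! ### Convolution with a decaying exponential. -/

section Schur

variable {κ : ℝ}

lemma integral_exp_neg_abs (hκ : 0 < κ) : ∫ x : ℝ, Real.exp (-κ * |x|) = 2 / κ := by
  rw [integral_comp_abs (f := fun x => Real.exp (-κ * x)), integral_exp_mul_Ioi (by linarith)]
  simp
  field_simp

lemma integrable_exp_neg_abs (hκ : 0 < κ) : Integrable fun x : ℝ => Real.exp (-κ * |x|) := by
  by_contra h
  have h1 := integral_exp_neg_abs hκ
  rw [integral_undef h] at h1
  have : 0 < 2 / κ := by positivity
  linarith

lemma integrable_mul_exp_neg_abs_sub (hκ : 0 < κ) {Q : ℝ → ℝ} (hQ : Integrable Q) (x : ℝ) :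
    Integrable fun y => Q y * Real.exp (-κ * |x - y|) := by
  refine hQ.mul_bdd (c := 1) (Continuous.aestronglyMeasurable (by fun_prop))
    (Eventually.of_forall fun y => ?_)
  rw [Real.norm_of_nonneg (Real.exp_pos _).le, Real.exp_le_one_iff]
  have := abs_nonneg (x - y)
  nlinarith

lemma integrable_convolution_exp (hκ : 0 < κ) {Q : ℝ → ℝ} (hQ : Integrable Q) :
    Integrable fun x => ∫ y, Q y * Real.exp (-κ * |x - y|) :=
  hQ.integrable_convolution (ContinuousLinearMap.mul ℝ ℝ) (integrable_exp_neg_abs hκ)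

lemma integral_convolution_exp (hκ : 0 < κ) {Q : ℝ → ℝ} (hQ : Integrable Q) :
    ∫ x, ∫ y, Q y * Real.exp (-κ * |x - y|) = (∫ y, Q y) * (2 / κ) := by
  rw [← integral_exp_neg_abs hκ]
  exact integral_convolution (ContinuousLinearMap.mul ℝ ℝ) hQ (integrable_exp_neg_abs hκ)

/-- Cauchy–Schwarz for the finite measure E dy, E = e^{-κ|x - y|}, of mass S = 2/κ. It follows from
∫ (Q - A/S)² E ≥ 0, where A = ∫ Q E. -/
lemma sq_integral_mul_exp_le (hκ : 0 < κ) {Q : ℝ → ℝ} (hQm : AEStronglyMeasurable Q)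
    (hQ : Integrable fun y => Q y ^ 2) (x : ℝ) :
    Integrable (fun y => Q y * Real.exp (-κ * |x - y|)) ∧
    (∫ y, Q y * Real.exp (-κ * |x - y|)) ^ 2 ≤
      2 / κ * ∫ y, Q y ^ 2 * Real.exp (-κ * |x - y|) := by
  set E : ℝ → ℝ := fun y => Real.exp (-κ * |x - y|) with hE
  have hE0 : ∀ y, 0 < E y := fun y => Real.exp_pos _
  have hEi : Integrable E := (integrable_exp_neg_abs hκ).comp_sub_left x
  have hEv : ∫ y, E y = 2 / κ := by
    rw [← integral_exp_neg_abs hκ]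
    exact integral_sub_left_eq_self (fun t => Real.exp (-κ * |t|)) volume x
  have h2 : Integrable fun y => Q y ^ 2 * E y := integrable_mul_exp_neg_abs_sub hκ hQ x
  have h1 : Integrable fun y => Q y * E y := by
    refine Integrable.mono' ((h2.add hEi).div_const 2) (hQm.mul hEi.aestronglyMeasurable)
      (Eventually.of_forall fun y => ?_)
    rw [norm_mul, Real.norm_of_nonneg (hE0 y).le, Real.norm_eq_abs]
    simp only [Pi.add_apply]
    have : |Q y| ≤ (Q y ^ 2 + 1) / 2 := by
      have := sq_nonneg (|Q y| - 1)
      have h3 := sq_abs (Q y)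
      linarith
    have := mul_le_mul_of_nonneg_right this (hE0 y).le
    change _ ≤ (Q y ^ 2 * E y + E y) / 2
    linarith
  refine ⟨h1, ?_⟩
  set A := ∫ y, Q y * E y
  set S := 2 / κ with hS
  have hS0 : 0 < S := by positivity
  have h3 : 0 ≤ ∫ y, (Q y - A / S) ^ 2 * E y :=
    integral_nonneg fun y => mul_nonneg (sq_nonneg _) (hE0 y).le
  have h4 : ∀ y, (Q y - A / S) ^ 2 * E y =
      Q y ^ 2 * E y - (2 * (A / S)) * (Q y * E y) + (A / S) ^ 2 * E y := fun y => by ring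
  have h7 : ∫ y, (Q y - A / S) ^ 2 * E y = (∫ y, Q y ^ 2 * E y) - 2 * (A / S) * A +
      (A / S) ^ 2 * S := by
    have h8 : Integrable fun y => Q y ^ 2 * E y - (2 * (A / S)) * (Q y * E y) :=
      h2.sub (h1.const_mul _)
    simp only [h4]
    rw [integral_add h8 (hEi.const_mul _), integral_sub h2 (h1.const_mul _), integral_const_mul,
      integral_const_mul, hEv]
  rw [h7] at h3
  have h5 : (∫ y, Q y ^ 2 * E y) - 2 * (A / S) * A + (A / S) ^ 2 * S =
      (∫ y, Q y ^ 2 * E y) - A ^ 2 / S := by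
    field_simp
    ring
  change A ^ 2 ≤ S * ∫ y, Q y ^ 2 * E y
  have h6 : A ^ 2 / S ≤ ∫ y, Q y ^ 2 * E y := by
    rw [← sub_nonneg, ← h5]
    exact h3
  rw [div_le_iff₀ hS0] at h6
  linarith

end Schur

/-! ### The free Dirichlet Green operator on L¹ and L². -/

section GreenOperator

variable {k : ℂ}

/-- The Green function of the free Dirichlet operator. -/
def greenFun (k : ℂ) (x y : ℝ) : ℂ :=
  if y ≤ x then Complex.exp (Complex.I * k * x) * Complex.sin (k * y) / k
  else Complex.sin (k * x) * Complex.exp (Complex.I * k * y) / k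

lemma norm_greenFun_le (hk : 0 < k.im) {x y : ℝ} (hx : 0 ≤ x) (hy : 0 ≤ y) :
    ‖greenFun k x y‖ ≤ ‖k‖⁻¹ * Real.exp (-k.im * |x - y|) := by
  unfold greenFun
  split_ifs with h
  · rw [norm_div, norm_mul, norm_exp_I_mul, div_eq_inv_mul, abs_of_nonneg (sub_nonneg.2 h)]
    gcongr
    calc _ ≤ Real.exp (-k.im * x) * Real.exp (k.im * y) := by
          gcongr
          exact norm_sin_mul_le hk hy
      _ = _ := by
        rw [← Real.exp_add]
        congr 1
        ring
  · rw [norm_div, norm_mul, norm_exp_I_mul, div_eq_inv_mul,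
      abs_of_nonpos (sub_nonpos.2 (not_le.1 h).le)]
    gcongr
    calc _ ≤ Real.exp (k.im * x) * Real.exp (-k.im * y) := by
          gcongr
          exact norm_sin_mul_le hk hx
      _ = _ := by
        rw [← Real.exp_add]
        congr 1
        ring

/-- The functions to which the free Green operator is applied. -/
structure IsSource (k : ℂ) (q : ℝ → ℂ) : Prop where
  loc : LocallyIntegrable ((Ioi (0 : ℝ)).indicator q)
  int : IntegrableOn (fun y : ℝ => Complex.exp (Complex.I * k * y) * q y) (Ioi 0)

lemma isSource_of_integrable (hk : 0 < k.im) {q : ℝ → ℂ} (hq : Integrable q halfLineMeasure) :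
    IsSource k q := by
  refine ⟨((integrable_indicator_iff measurableSet_Ioi).2 hq).locallyIntegrable,
    Integrable.bdd_mul (c := 1) hq (Continuous.aestronglyMeasurable (by fun_prop)) ?_⟩
  filter_upwards [ae_restrict_mem measurableSet_Ioi] with y hy
  exact norm_exp_I_mul_le_one hk (le_of_lt hy)

lemma isSource_of_memLp (hk : 0 < k.im) {q : ℝ → ℂ} (hq : MemLp q 2 halfLineMeasure) :
    IsSource k q :=
  ⟨((memLp_indicator_iff_restrict measurableSet_Ioi).2 hq).locallyIntegrable (by norm_num),
    (memLp_two_exp hk).integrable_mul hq⟩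

/-- The free Dirichlet Green operator applied to `q`. -/
def dirichletSol (k : ℂ) (q : ℝ → ℂ) : ℝ → ℂ :=
  inhomSol k 0 (∫ y in Ioi (0 : ℝ), Complex.exp (Complex.I * k * y) * q y)
    fun y => -(Ioi (0 : ℝ)).indicator q y

lemma exp_I_mul_eq (k : ℂ) (x : ℝ) : Complex.exp (Complex.I * k * x) =
    Complex.cos (k * x) + Complex.sin (k * x) * Complex.I := by
  rw [← Complex.exp_mul_I]
  congr 1
  ring

lemma integral_Ioi_split {g : ℝ → ℂ} (h1 : IntegrableOn g (Ioi 0)) {x : ℝ} (hx : 0 ≤ x) :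
    ∫ y in Ioi (0 : ℝ), g y = (∫ y in (0 : ℝ)..x, g y) + ∫ y in Ioi x, g y := by
  rw [← intervalIntegral.integral_Ioi_sub_Ioi h1 hx]
  ring

lemma IsSource.intervalIntegrable {q : ℝ → ℂ} (hq : IsSource k q) {x : ℝ} (hx : 0 ≤ x) :
    IntervalIntegrable q volume 0 x := by
  refine (intervalIntegrable_of_locallyIntegrable hq.loc 0 x).congr ?_
  rw [uIoc_of_le hx]
  intro y hy
  exact indicator_of_mem (mem_Ioi.2 hy.1) q

lemma integrableOn_greenFun_mul {q : ℝ → ℂ} (hq : IsSource k q) {x : ℝ} (hx : 0 ≤ x) :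
    IntegrableOn (fun y => greenFun k x y * q y) (Ioi 0) := by
  have h1 : EqOn (fun y : ℝ => Complex.exp (Complex.I * k * x) * Complex.sin (k * y) / k * q y)
      (fun y => greenFun k x y * q y) (Ioc 0 x) := fun y hy => by
    simp only [greenFun, if_pos hy.2]
  have h2 : EqOn (fun y : ℝ => Complex.sin (k * x) / k * (Complex.exp (Complex.I * k * y) * q y))
      (fun y => greenFun k x y * q y) (Ioi x) := fun y hy => by
    simp only [greenFun, if_neg (not_le.2 (mem_Ioi.1 hy))]
    ring
  rw [← Ioc_union_Ioi_eq_Ioi hx]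
  exact (IntegrableOn.congr_fun (((intervalIntegrable_iff_integrableOn_Ioc_of_le hx).1
    ((hq.intervalIntegrable hx).continuousOn_mul (Continuous.continuousOn (by fun_prop))))) h1
    measurableSet_Ioc).union
    (IntegrableOn.congr_fun ((hq.int.mono_set (Ioi_subset_Ioi hx)).const_mul _) h2
      measurableSet_Ioi)

/-- Since sin k(x - y) = sin(kx) e^{iky} - e^{ikx} sin(ky), the chosen initial slope ∫ e^{iky} q
cancels the part over (0, x) of the growing term and leaves the Green kernel. -/
lemma dirichletSol_eq {q : ℝ → ℂ} (hq : IsSource k q) {x : ℝ} (hx : 0 ≤ x) :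
    dirichletSol k q x = ∫ y in Ioi (0 : ℝ), greenFun k x y * q y := by
  have hc : ∀ c : ℝ → ℂ, Continuous c → IntervalIntegrable (fun y => c y * q y) volume 0 x :=
    fun c hc => (hq.intervalIntegrable hx).continuousOn_mul hc.continuousOn
  have h1 : EqOn (fun y : ℝ => Complex.exp (Complex.I * k * x) * Complex.sin (k * y) / k * q y)
      (fun y => greenFun k x y * q y) (Ioc 0 x) := fun y hy => by
    simp only [greenFun, if_pos hy.2]
  have h2 : EqOn (fun y : ℝ => Complex.sin (k * x) / k * (Complex.exp (Complex.I * k * y) * q y))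
      (fun y => greenFun k x y * q y) (Ioi x) := fun y hy => by
    simp only [greenFun, if_neg (not_le.2 (mem_Ioi.1 hy))]
    ring
  have h5 := integrableOn_greenFun_mul hq hx
  rw [integral_Ioi_split h5 hx, ← setIntegral_congr_fun measurableSet_Ioi h2, integral_const_mul,
    intervalIntegral.integral_of_le hx, ← setIntegral_congr_fun measurableSet_Ioc h1,
    ← intervalIntegral.integral_of_le hx, dirichletSol, inhomSol, integral_Ioi_split hq.int hx,
    setIntegral_interval_indicator
    (fun y c => Complex.sin (k * ((x : ℂ) - (y : ℂ))) / k * -c) q hx]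
  have h6 : ∫ y in (0 : ℝ)..x, Complex.sin (k * ((x : ℂ) - (y : ℂ))) / k * -q y =
      (∫ y in (0 : ℝ)..x, Complex.exp (Complex.I * k * x) * Complex.sin (k * y) / k * q y) -
      Complex.sin (k * x) / k * ∫ y in (0 : ℝ)..x, Complex.exp (Complex.I * k * y) * q y := by
    rw [← intervalIntegral.integral_const_mul, ← intervalIntegral.integral_sub
      (hc _ (by fun_prop)) ((hc _ (by fun_prop)).const_mul _)]
    refine intervalIntegral.integral_congr fun y _ => ?_
    simp only [mul_sub, Complex.sin_sub, exp_I_mul_eq]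
    ring
  rw [h6]
  ring

lemma continuous_dirichletSol (hk : 0 < k.im) {q : ℝ → ℂ} (hq : IsSource k q) :
    Continuous (dirichletSol k q) :=
  continuous_inhomSol (fun h => by rw [h] at hk; simp at hk) hq.loc.neg _ _

lemma norm_dirichletSol_le (hk : 0 < k.im) {q : ℝ → ℂ} (hq : IsSource k q) {x : ℝ} (hx : 0 ≤ x)
    (hi : Integrable fun y =>
      (Ioi (0 : ℝ)).indicator (fun y => ‖q y‖) y * Real.exp (-k.im * |x - y|)) :
    ‖dirichletSol k q x‖ ≤ ‖k‖⁻¹ *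
      ∫ y, (Ioi (0 : ℝ)).indicator (fun y => ‖q y‖) y * Real.exp (-k.im * |x - y|) := by
  rw [dirichletSol_eq hq hx, ← integral_const_mul]
  have h1 := hi.const_mul ‖k‖⁻¹
  refine (norm_integral_le_of_norm_le (h1.integrableOn (s := Ioi 0)) ?_).trans
    (setIntegral_le_integral h1 (Eventually.of_forall fun y => ?_))
  · filter_upwards [ae_restrict_mem measurableSet_Ioi] with y hy
    rw [norm_mul, indicator_of_mem hy]
    calc _ ≤ ‖k‖⁻¹ * Real.exp (-k.im * |x - y|) * ‖q y‖ := by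
          gcongr
          exact norm_greenFun_le hk hx (le_of_lt hy)
      _ = _ := by ring
  · have : 0 ≤ (Ioi (0 : ℝ)).indicator (fun y => ‖q y‖) y :=
      indicator_nonneg (fun _ _ => norm_nonneg _) y
    positivity

/-- The free Green operator maps `L¹` to `L²`. -/
lemma memLp_dirichletSol_of_integrable (hk : 0 < k.im) {q : ℝ → ℂ}
    (hq : Integrable q halfLineMeasure) : MemLp (dirichletSol k q) 2 halfLineMeasure := by
  have hs := isSource_of_integrable hk hq
  set Q : ℝ → ℝ := (Ioi (0 : ℝ)).indicator (fun y => ‖q y‖) with hQ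
  have hQ0 : ∀ y, 0 ≤ Q y := fun y => indicator_nonneg (fun _ _ => norm_nonneg _) y
  have hQi : Integrable Q := (integrable_indicator_iff measurableSet_Ioi).2 hq.norm
  have hm : AEStronglyMeasurable (dirichletSol k q) halfLineMeasure :=
    (continuous_dirichletSol hk hs).aestronglyMeasurable
  rw [memLp_two_iff_integrable_sq_norm hm]
  have hA : ∀ x, 0 ≤ ∫ y, Q y * Real.exp (-k.im * |x - y|) := fun x =>
    integral_nonneg fun y => mul_nonneg (hQ0 y) (Real.exp_pos _).le
  refine Integrable.mono' (((integrable_convolution_exp hk hQi).const_mul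
    (‖k‖⁻¹ ^ 2 * ∫ y, Q y)).integrableOn (s := Ioi 0)) (hm.norm.pow 2) ?_
  filter_upwards [ae_restrict_mem measurableSet_Ioi] with x hx
  have h1 := norm_dirichletSol_le hk hs (le_of_lt hx) (integrable_mul_exp_neg_abs_sub hk hQi x)
  -- Of the two convolution factors in the square, one is bounded by the total mass of Q; the other
  -- is integrable in x.
  have h2 : ∫ y, Q y * Real.exp (-k.im * |x - y|) ≤ ∫ y, Q y := by
    refine integral_mono (integrable_mul_exp_neg_abs_sub hk hQi x) hQi fun y =>
      mul_le_of_le_one_right (hQ0 y) (Real.exp_le_one_iff.2 ?_)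
    have := abs_nonneg (x - y)
    nlinarith
  rw [Real.norm_of_nonneg (by positivity)]
  calc _ ≤ (‖k‖⁻¹ * ∫ y, Q y * Real.exp (-k.im * |x - y|)) ^ 2 := by gcongr
    _ = ‖k‖⁻¹ ^ 2 * (∫ y, Q y * Real.exp (-k.im * |x - y|)) *
        ∫ y, Q y * Real.exp (-k.im * |x - y|) := by ring
    _ ≤ _ := by
      gcongr
      exact hA x

/-- The free Green operator is bounded on `L²`. -/
lemma memLp_dirichletSol (hk : 0 < k.im) {q : ℝ → ℂ} (hq : MemLp q 2 halfLineMeasure) :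
    MemLp (dirichletSol k q) 2 halfLineMeasure ∧
    ∫ x, ‖dirichletSol k q x‖ ^ 2 ∂halfLineMeasure ≤
      (‖k‖⁻¹ * (2 / k.im)) ^ 2 * ∫ x, ‖q x‖ ^ 2 ∂halfLineMeasure := by
  have hs := isSource_of_memLp hk hq
  set Q : ℝ → ℝ := (Ioi (0 : ℝ)).indicator (fun y => ‖q y‖) with hQ
  have hQm : AEStronglyMeasurable Q :=
    (aestronglyMeasurable_indicator_iff measurableSet_Ioi).2 hq.aestronglyMeasurable.norm
  have hQ2 : ∀ y, Q y ^ 2 = (Ioi (0 : ℝ)).indicator (fun y => ‖q y‖ ^ 2) y := fun y => by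
    simp only [hQ, indicator]
    split_ifs <;> simp
  have hQi : Integrable fun y => Q y ^ 2 := by
    simp only [hQ2]
    exact (integrable_indicator_iff measurableSet_Ioi).2
      ((memLp_two_iff_integrable_sq_norm hq.aestronglyMeasurable).1 hq)
  have hQv : ∫ y, Q y ^ 2 = ∫ x, ‖q x‖ ^ 2 ∂halfLineMeasure := by
    simp only [hQ2]
    exact integral_indicator measurableSet_Ioi
  have hm : AEStronglyMeasurable (dirichletSol k q) halfLineMeasure :=
    (continuous_dirichletSol hk hs).aestronglyMeasurable
  have hb := (integrable_convolution_exp hk hQi).const_mul (‖k‖⁻¹ ^ 2 * (2 / k.im))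
  have hle : ∀ᵐ x ∂halfLineMeasure, ‖dirichletSol k q x‖ ^ 2 ≤ ‖k‖⁻¹ ^ 2 * (2 / k.im) *
      ∫ y, Q y ^ 2 * Real.exp (-k.im * |x - y|) := by
    filter_upwards [ae_restrict_mem measurableSet_Ioi] with x hx
    obtain ⟨h1, h2⟩ := sq_integral_mul_exp_le hk hQm hQi x
    have h3 := norm_dirichletSol_le hk hs (le_of_lt hx) h1
    calc _ ≤ (‖k‖⁻¹ * ∫ y, Q y * Real.exp (-k.im * |x - y|)) ^ 2 := by gcongr
      _ ≤ ‖k‖⁻¹ ^ 2 * (2 / k.im * ∫ y, Q y ^ 2 * Real.exp (-k.im * |x - y|)) := by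
        rw [mul_pow]
        gcongr
      _ = _ := by ring
  refine ⟨?_, ?_⟩
  · rw [memLp_two_iff_integrable_sq_norm hm]
    refine Integrable.mono' (hb.integrableOn (s := Ioi 0)) (hm.norm.pow 2) ?_
    filter_upwards [hle] with x hx
    rwa [Real.norm_of_nonneg (by positivity)]
  · calc _ ≤ ∫ x in Ioi (0 : ℝ), ‖k‖⁻¹ ^ 2 * (2 / k.im) *
          ∫ y, Q y ^ 2 * Real.exp (-k.im * |x - y|) :=
        integral_mono_of_nonneg (Eventually.of_forall fun x => by positivity)
          (hb.integrableOn (s := Ioi 0)) hle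
      _ ≤ ∫ x, ‖k‖⁻¹ ^ 2 * (2 / k.im) * ∫ y, Q y ^ 2 * Real.exp (-k.im * |x - y|) :=
        setIntegral_le_integral hb (Eventually.of_forall fun x => by
          have : 0 ≤ ∫ y, Q y ^ 2 * Real.exp (-k.im * |x - y|) :=
            integral_nonneg fun y => by positivity
          positivity)
      _ = _ := by
        rw [integral_const_mul, integral_convolution_exp hk hQi, hQv]
        ring

lemma IsSource.congr {q q' : ℝ → ℂ} (hq : IsSource k q) (h : q' =ᵐ[halfLineMeasure] q) :
    IsSource k q' := by
  have h1 : (Ioi (0 : ℝ)).indicator q' =ᵐ[volume] (Ioi (0 : ℝ)).indicator q :=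
    (ae_eq_restrict_iff_indicator_ae_eq measurableSet_Ioi).1 h
  refine ⟨(locallyIntegrable_congr h1).2 hq.loc, hq.int.congr ?_⟩
  filter_upwards [h] with x hx
  rw [hx]

lemma dirichletSol_congr {q q' : ℝ → ℂ} (h : q =ᵐ[halfLineMeasure] q') :
    dirichletSol k q = dirichletSol k q' := by
  have h1 : (Ioi (0 : ℝ)).indicator q =ᵐ[volume] (Ioi (0 : ℝ)).indicator q' :=
    (ae_eq_restrict_iff_indicator_ae_eq measurableSet_Ioi).1 h
  funext x
  unfold dirichletSol inhomSol
  congr 1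
  · congr 2
    refine integral_congr_ae ?_
    filter_upwards [h] with y hy
    rw [hy]
  · refine intervalIntegral.integral_congr_ae ?_
    filter_upwards [h1] with y hy _
    rw [hy]

lemma exists_greenOperator (hk : 0 < k.im) :
    ∃ R : L2 →L[ℂ] L2, ∀ f : L2, R f =ᵐ[halfLineMeasure] dirichletSol k f := by
  have hs : ∀ f : L2, IsSource k f := fun f => isSource_of_memLp hk (Lp.memLp f)
  have hgi : ∀ (f : L2) (x : ℝ), 0 ≤ x →
      Integrable (fun y => greenFun k x y * f y) halfLineMeasure :=
    fun f x hx => integrableOn_greenFun_mul (hs f) hx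
  refine exists_clm_of_ae (fun f => dirichletSol k f) (fun f g => ?_) (fun c f => ?_)
    (fun f => (memLp_dirichletSol hk (Lp.memLp f)).1) (‖k‖⁻¹ * (2 / k.im)) (by positivity)
    fun f => ?_
  · rw [dirichletSol_congr (Lp.coeFn_add f g)]
    filter_upwards [ae_restrict_mem measurableSet_Ioi] with x hx
    have hx' : 0 ≤ x := le_of_lt hx
    rw [dirichletSol_eq ((hs (f + g)).congr (Lp.coeFn_add f g).symm) hx', Pi.add_apply,
      dirichletSol_eq (hs f) hx', dirichletSol_eq (hs g) hx',
      ← integral_add (hgi f x hx') (hgi g x hx')]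
    refine integral_congr_ae (Eventually.of_forall fun y => ?_)
    simp only [Pi.add_apply]
    ring
  · rw [dirichletSol_congr (Lp.coeFn_smul c f)]
    filter_upwards [ae_restrict_mem measurableSet_Ioi] with x hx
    have hx' : 0 ≤ x := le_of_lt hx
    rw [dirichletSol_eq ((hs (c • f)).congr (Lp.coeFn_smul c f).symm) hx', Pi.smul_apply,
      dirichletSol_eq (hs f) hx', smul_eq_mul, ← integral_const_mul]
    refine integral_congr_ae (Eventually.of_forall fun y => ?_)
    simp only [Pi.smul_apply, smul_eq_mul]
    ring
  · rw [norm_sq_eq_integral]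
    exact (memLp_dirichletSol hk (Lp.memLp f)).2

end GreenOperator

/-! ### Boundary traces computed on regular representatives. -/

section Traces

lemma mem_traceD_graph {g : L2} {G : ℝ → ℂ} (hg : g =ᵐ[halfLineMeasure] G)
    (hG : ContinuousOn G (Ici 0)) {w : ℂ} : (g, w) ∈ traceD.graph ↔ w = G 0 := by
  have h1 : (g, G 0) ∈ traceD.graph := by
    rw [traceD_graph]
    exact ⟨G, hg, hG, rfl⟩
  exact ⟨fun h => traceD.mem_graph_snd_inj h h1 rfl, fun h => h ▸ h1⟩

lemma IsC1AC.contDiffOn {F F' F'' : ℝ → ℂ} (hF : IsC1AC F F' F'') : ContDiffOn ℝ 1 F (Ici 0) := by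
  rw [contDiffOn_one_iff_derivWithin (uniqueDiffOn_Ici 0)]
  exact ⟨fun x hx => (hF.hasDeriv x hx).differentiableWithinAt,
    hF.continuousOn'.congr fun x hx => hF.deriv₀ hx⟩

lemma mem_traceN_graph {g : L2} {G G' G'' : ℝ → ℂ} (hg : g =ᵐ[halfLineMeasure] G)
    (hG : IsC1AC G G' G'') {w : ℂ} : (g, w) ∈ traceN.graph ↔ w = -G' 0 := by
  have h1 : (g, -G' 0) ∈ traceN.graph := by
    rw [traceN_graph]
    exact ⟨G, hg, hG.contDiffOn, by rw [← hG.deriv₀ le_rfl]; rfl⟩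
  exact ⟨fun h => traceN.mem_graph_snd_inj h h1 rfl, fun h => h ▸ h1⟩

end Traces

/-! ### The free Dirichlet and Neumann resolvents. -/

section FreeResolvents

variable {k : ℂ}

/-- The exponential `e^{ikx}` as an element of `L²`. -/
def expL2 (k : ℂ) (hk : 0 < k.im) : L2 := (memLp_two_exp hk).toLp _

lemma coeFn_expL2 (hk : 0 < k.im) :
    expL2 k hk =ᵐ[halfLineMeasure] fun x : ℝ => Complex.exp (Complex.I * k * x) :=
  MemLp.coeFn_toLp _

lemma neg_conj_im_pos (hk : 0 < k.im) : 0 < (-(starRingEnd ℂ k)).im := by simpa using hk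

lemma conj_exp_neg_conj (k : ℂ) (x : ℝ) :
    starRingEnd ℂ (Complex.exp (Complex.I * -(starRingEnd ℂ k) * x)) =
      Complex.exp (Complex.I * k * x) := by
  rw [← Complex.exp_conj]
  congr 1
  simp

lemma inner_expL2 (hk : 0 < k.im) (f : L2) : inner ℂ (expL2 _ (neg_conj_im_pos hk)) f =
    ∫ y in Ioi (0 : ℝ), Complex.exp (Complex.I * k * y) * f y := by
  rw [inner_eq_integral]
  refine integral_congr_ae ?_
  filter_upwards [coeFn_expL2 (neg_conj_im_pos hk)] with x hx
  rw [hx, conj_exp_neg_conj]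

lemma isC1AC_exp (k : ℂ) : IsC1AC (fun x : ℝ => Complex.exp (Complex.I * k * x))
    (fun x => Complex.I * k * Complex.exp (Complex.I * k * x))
    (fun x => -k ^ 2 * Complex.exp (Complex.I * k * x)) := by
  have h0 : ∀ x : ℝ, HasDerivAt (fun x : ℝ => Complex.exp (Complex.I * k * x))
      (Complex.I * k * Complex.exp (Complex.I * k * x)) x := fun x => by
    have h1 : HasDerivAt (fun x : ℝ => Complex.I * k * (x : ℂ)) (Complex.I * k) x := by
      simpa using (Complex.ofRealCLM.hasDerivAt (x := x)).const_mul (Complex.I * k)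
    refine ((Complex.hasDerivAt_exp (Complex.I * k * x)).comp x h1).congr_deriv ?_
    ring
  have hexp : ContDiff ℝ 1 Complex.exp := (Complex.contDiff_exp (𝕜 := ℂ)).restrict_scalars ℝ
  have hc : ContDiff ℝ 1 fun x : ℝ => Complex.exp (Complex.I * k * x) :=
    ContDiff.comp (g := Complex.exp) hexp
      ((contDiff_const (c := Complex.I * k)).mul Complex.ofRealCLM.contDiff)
  refine ⟨fun x _ => (h0 x).hasDerivWithinAt,
    fun R _ => hc.contDiffOn.absolutelyContinuousOnInterval,
    fun R _ => (contDiff_const.mul hc).contDiffOn.absolutelyContinuousOnInterval,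
    Eventually.of_forall fun x => ((h0 x).const_mul (Complex.I * k)).congr_deriv ?_⟩
  linear_combination k ^ 2 * Complex.exp (Complex.I * k * x) * Complex.I_sq

lemma isSchrodingerRep_inhomSol (hk : k ≠ 0) {q : ℝ → ℂ} (hq : IsSource k q) {g h : L2} {a b : ℂ}
    (hg : g =ᵐ[halfLineMeasure] inhomSol k a b fun y => -(Ioi (0 : ℝ)).indicator q y)
    (hh : h =ᵐ[halfLineMeasure] fun x => q x + k ^ 2 * g x) :
    IsSchrodingerRep 0 g h (inhomSol k a b fun y => -(Ioi (0 : ℝ)).indicator q y)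
      (inhomSolDeriv k a b fun y => -(Ioi (0 : ℝ)).indicator q y)
      (fun x => -(Ioi (0 : ℝ)).indicator q x -
        k ^ 2 * inhomSol k a b (fun y => -(Ioi (0 : ℝ)).indicator q y) x) := by
  have h1 := isC1AC_inhomSol hk hq.loc.neg a b
  refine ⟨hg, h1.hasDeriv, h1.ac, h1.ac', h1.hasDeriv', ?_⟩
  filter_upwards [hg, hh, ae_restrict_mem measurableSet_Ioi] with x h2 h3 h4
  rw [h3, h2, indicator_of_mem h4, Pi.zero_apply]
  ring

lemma memLp_exp_deriv (hk : 0 < k.im) :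
    MemLp (fun x : ℝ => Complex.I * k * Complex.exp (Complex.I * k * x)) 2 halfLineMeasure :=
  (memLp_two_exp hk).const_mul _

/-- The free equation has no square integrable solution with a boundary condition that is not
satisfied by the exponentially decaying solution. -/
lemma eq_zero_of_mem_free_graph (hk : 0 < k.im) {a b : ℂ} (hab : a + b * (Complex.I * k) ≠ 0)
    {g : L2} (hg : (g, k ^ 2 • g) ∈ (schrodingerOp 0 a b).graph) : g = 0 := by
  have hk0 : k ≠ 0 := fun h => by rw [h] at hk; simp at hk
  rw [schrodingerOp_graph] at hg
  obtain ⟨G, G', G'', hG, hbc⟩ := hg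
  have hG2 : MemLp G 2 halfLineMeasure := (memLp_congr_ae hG.eq_left).1 (Lp.memLp g)
  have hode : ∀ᵐ x ∂halfLineMeasure, G'' x = -k ^ 2 * G x := by
    filter_upwards [hG.eq_left, hG.eq_right, Lp.coeFn_smul (k ^ 2) g] with x h1 h2 h3
    rw [h3, Pi.smul_apply, h1, smul_eq_mul, Pi.zero_apply] at h2
    linear_combination h2
  have hC := hG.isC1AC
  -- The Wronskian with e^{ikx} vanishes, so G'(0) = ik G(0); together with the boundary condition
  -- this kills both initial values.
  have h1 := wronskian_zero_add_integral (isC1AC_exp k) hC (memLp_two_exp hk) (memLp_exp_deriv hk)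
    hG2 (w := fun _ => 0) (integrable_zero _ _ _) (by
      filter_upwards [hode] with x hx
      rw [hx]
      ring)
  simp only [integral_zero, add_zero, Complex.ofReal_zero, mul_zero, Complex.exp_zero, one_mul,
    mul_one] at h1
  have h2 : G 0 = 0 := by
    have : (a + b * (Complex.I * k)) * G 0 = 0 := by linear_combination hbc - b * h1
    exact (mul_eq_zero.1 this).resolve_left hab
  have h3 : G' 0 = 0 := by rw [h2] at h1; simpa using h1
  have hzero : EqOn G 0 (Ici 0) := by
    intro x hx
    have hs := isC1AC_inhomSol hk0 (locallyIntegrable_const 0 : LocallyIntegrable fun _ : ℝ => (0 : ℂ))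
    -- The Wronskians with cos(kx) and sin(kx)/k vanish too, and eliminating G' between them gives G
    -- = 0.
    have hw : ∀ a b : ℂ, inhomSol k a b (fun _ => 0) x * G' x -
        inhomSolDeriv k a b (fun _ => 0) x * G x = 0 := fun a b => by
      have h4 := wronskian_eq_add_integral (hs a b) hC (w := fun _ => 0)
        (locallyIntegrable_const 0) (by
          filter_upwards [hode] with x hx
          rw [hx]
          ring) x hx
      rw [h4, h2, h3]
      simp
    have h5 := hw 1 0
    have h6 := hw 0 1
    simp only [inhomSol, inhomSolDeriv, mul_zero, intervalIntegral.integral_zero, add_zero, zero_mul,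
      one_mul, zero_add, mul_one] at h5 h6
    have h7 : Complex.sin (k * x) ^ 2 + Complex.cos (k * x) ^ 2 = 1 := Complex.sin_sq_add_cos_sq _
    have h8 : Complex.sin (k * x) / k * k = Complex.sin (k * x) := by field_simp
    rw [Pi.zero_apply]
    linear_combination Complex.sin (k * x) / k * h5 - Complex.cos (k * x) * h6 - G x * h7 -
      Complex.sin (k * x) * G x * h8
  refine Lp.ext ?_
  filter_upwards [hG.eq_left, Lp.coeFn_zero ℂ 2 halfLineMeasure, ae_restrict_mem measurableSet_Ioi]
    with x h4 h5 h6
  rw [h4, h5]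
  exact hzero (le_of_lt (mem_Ioi.1 h6))

lemma mem_free_graph (hk : 0 < k.im) {a b α β : ℂ} (hab : a * α + b * β = 0) {f g : L2}
    (hg : g =ᵐ[halfLineMeasure] inhomSol k α β fun y => -(Ioi (0 : ℝ)).indicator f y) :
    (g, f + k ^ 2 • g) ∈ (schrodingerOp 0 a b).graph := by
  have hk0 : k ≠ 0 := fun h => by rw [h] at hk; simp at hk
  rw [schrodingerOp_graph]
  refine ⟨_, _, _, isSchrodingerRep_inhomSol hk0 (isSource_of_memLp hk (Lp.memLp f)) hg ?_, ?_⟩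
  · filter_upwards [Lp.coeFn_add f (k ^ 2 • g), Lp.coeFn_smul (k ^ 2) g] with x h1 h2
    rw [h1, Pi.add_apply, h2, Pi.smul_apply, smul_eq_mul]
  · rw [inhomSol_zero, inhomSolDeriv_zero, hab]

/-- The free Dirichlet resolvent. -/
theorem isResolventAt_opD_zero (hk : 0 < k.im) {R : L2 →L[ℂ] L2}
    (hR : ∀ f : L2, R f =ᵐ[halfLineMeasure] dirichletSol k f) : IsResolventAt (opD 0) (k ^ 2) R :=
  isResolventAt_of_graph (fun f => mem_free_graph hk (by ring) (hR f))
    fun g hg => eq_zero_of_mem_free_graph hk (by simp) hg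

/-- The free Neumann resolvent is a rank one perturbation of the Dirichlet resolvent. -/
def neumannResolvent (k : ℂ) (hk : 0 < k.im) (R : L2 →L[ℂ] L2) : L2 →L[ℂ] L2 :=
  R + InnerProductSpace.rankOne ℂ ((Complex.I / k) • expL2 k hk) (expL2 _ (neg_conj_im_pos hk))

lemma neumannResolvent_apply (hk : 0 < k.im) (R : L2 →L[ℂ] L2) (f : L2) :
    neumannResolvent k hk R f = R f + (Complex.I / k *
      ∫ y in Ioi (0 : ℝ), Complex.exp (Complex.I * k * y) * f y) • expL2 k hk := by
  rw [← inner_expL2 hk, mul_comm, mul_smul]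
  rfl

/-- With c = ∫ e^{iky} f, the added term (i/k) c e^{ikx} equals (i/k) c cos(kx) - c sin(kx)/k. Its
sine part cancels the initial slope c of the Dirichlet solution, so the sum satisfies the Neumann
condition. -/
lemma neumannResolvent_ae (hk : 0 < k.im) {R : L2 →L[ℂ] L2}
    (hR : ∀ f : L2, R f =ᵐ[halfLineMeasure] dirichletSol k f) (f : L2) :
    neumannResolvent k hk R f =ᵐ[halfLineMeasure] inhomSol k
      (Complex.I / k * ∫ y in Ioi (0 : ℝ), Complex.exp (Complex.I * k * y) * f y) 0
      fun y => -(Ioi (0 : ℝ)).indicator f y := by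
  have hk0 : k ≠ 0 := fun h => by rw [h] at hk; simp at hk
  rw [neumannResolvent_apply]
  set c := ∫ y in Ioi (0 : ℝ), Complex.exp (Complex.I * k * y) * f y with hc
  filter_upwards [Lp.coeFn_add (R f) ((Complex.I / k * c) • expL2 k hk), hR f,
    Lp.coeFn_smul (Complex.I / k * c) (expL2 k hk), coeFn_expL2 hk] with x h1 h2 h3 h4
  rw [h1, Pi.add_apply, h2, h3, Pi.smul_apply, h4, dirichletSol, ← hc, inhomSol, inhomSol,
    exp_I_mul_eq, smul_eq_mul]
  field_simp
  linear_combination c * Complex.sin (k * x) * Complex.I_sq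

theorem isResolventAt_opN_zero (hk : 0 < k.im) {R : L2 →L[ℂ] L2}
    (hR : ∀ f : L2, R f =ᵐ[halfLineMeasure] dirichletSol k f) :
    IsResolventAt (opN 0) (k ^ 2) (neumannResolvent k hk R) := by
  have hk0 : k ≠ 0 := fun h => by rw [h] at hk; simp at hk
  exact isResolventAt_of_graph (fun f => mem_free_graph hk (by ring) (neumannResolvent_ae hk hR f))
    fun g hg => eq_zero_of_mem_free_graph hk (by simpa using hk0) hg

/-- The adjoint of the Dirichlet trace of the free Neumann resolvent. -/
theorem dirichletAdjoint_eq {z : ℂ} (hk : 0 < (sqrtUp z).im) :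
    dirichletAdjoint z = ((ContinuousLinearMap.adjoint
      (innerSL ℂ ((Complex.I / sqrtUp z) • expL2 (sqrtUp z) hk)) : ℂ →L[ℂ] L2) :
        ℂ →ₗ[ℂ] L2).toPMap ⊤ := by
  set k := sqrtUp z with hkdef
  have hκ := neg_conj_im_pos hk
  -- κ is the square root of z̄ with positive imaginary part. The trace of the Neumann resolvent at
  -- z̄ is (i/κ) ∫ e^{iκy} f, and (i/κ) e^{iκy} is the conjugate of (i/k) e^{iky}.
  set κ := -(starRingEnd ℂ k) with hκdef
  have hzκ : starRingEnd ℂ z = κ ^ 2 := by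
    rw [hκdef, neg_sq, ← map_pow, hkdef, sqrtUp_sq]
  obtain ⟨R, hR⟩ := exists_greenOperator hκ
  have hN := isResolventAt_opN_zero hκ hR
  rw [dirichletAdjoint, ← ContinuousLinearMap.toPMap_adjoint_eq_adjoint_toPMap_of_dense
    (p := ⊤) _ (by simp)]
  congr 1
  refine LinearPMap.eq_of_eq_graph ?_
  ext ⟨f, w⟩
  rw [mem_pcomp_graph, mem_toPMap_top_graph, hzκ]
  simp only [hN.mem_pinv_graph, exists_eq_left]
  have hk0 : κ ≠ 0 := fun h => by rw [h] at hκ; simp at hκ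
  rw [mem_traceD_graph (neumannResolvent_ae hκ hR f) (continuous_inhomSol hk0
    (isSource_of_memLp hκ (Lp.memLp f)).loc.neg _ _).continuousOn, inhomSol_zero, innerSL_apply_apply,
    inner_smul_left, inner_eq_integral]
  have h1 : starRingEnd ℂ (Complex.I / k) = Complex.I / κ := by
    rw [map_div₀, Complex.conj_I, hκdef, neg_div, div_neg]
  have h2 : ∫ x, starRingEnd ℂ (expL2 k hk x) * f x ∂halfLineMeasure =
      ∫ y in Ioi (0 : ℝ), Complex.exp (Complex.I * κ * y) * f y := by
    refine integral_congr_ae ?_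
    filter_upwards [coeFn_expL2 hk] with x hx
    rw [hx, ← Complex.exp_conj]
    congr 2
    simp [hκdef]
  rw [h1, h2]

end FreeResolvents

/-! ### The factors u and v of the potential. -/

section Factors

variable {V : ℝ → ℂ}

lemma norm_vFactor (V : ℝ → ℂ) (x : ℝ) : ‖vFactor V x‖ = Real.sqrt ‖V x‖ := by
  rw [vFactor, Complex.norm_real, Real.norm_of_nonneg (Real.sqrt_nonneg _)]

lemma norm_uFactor (V : ℝ → ℂ) (x : ℝ) : ‖uFactor V x‖ = Real.sqrt ‖V x‖ := by
  rw [uFactor, norm_mul, Complex.norm_real, Real.norm_of_nonneg (Real.sqrt_nonneg _),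
    mul_comm Complex.I, Complex.norm_exp_ofReal_mul_I, one_mul]

lemma conj_vFactor (V : ℝ → ℂ) (x : ℝ) : starRingEnd ℂ (vFactor V x) = vFactor V x :=
  Complex.conj_ofReal _

lemma memLp_vFactor (hV : IntegrableOn V (Ioi 0)) : MemLp (vFactor V) 2 halfLineMeasure := by
  have hm : AEStronglyMeasurable (vFactor V) halfLineMeasure :=
    (Complex.continuous_ofReal.comp (Real.continuous_sqrt.comp
      continuous_norm)).comp_aestronglyMeasurable hV.aestronglyMeasurable
  rw [memLp_two_iff_integrable_sq_norm hm]
  simp only [norm_vFactor, Real.sq_sqrt (norm_nonneg _)]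
  exact hV.norm

lemma memLp_uFactor (hV : IntegrableOn V (Ioi 0)) : MemLp (uFactor V) 2 halfLineMeasure := by
  have hm : AEStronglyMeasurable (uFactor V) halfLineMeasure := by
    refine AEStronglyMeasurable.mul ?_ (memLp_vFactor hV).aestronglyMeasurable
    have h1 : Measurable fun c : ℂ => Complex.exp (Complex.I * (Complex.arg c : ℂ)) :=
      Complex.measurable_exp.comp
        ((Complex.measurable_ofReal.comp Complex.measurable_arg).const_mul Complex.I)
    exact (h1.comp_aemeasurable hV.aestronglyMeasurable.aemeasurable).aestronglyMeasurable
  refine (memLp_vFactor hV).mono hm (Eventually.of_forall fun x => ?_)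
  rw [norm_uFactor, norm_vFactor]

end Factors

/-! ### Factorization of the Green function through truncated exponentials. -/

section HalfGreen

variable {k : ℂ}

/-- What matters is that the bound is uniform in x: the square integrability required of the kernel
families then comes from u and v alone. -/
lemma memLp_cutExp (hk : 0 < k.im) (x : ℝ) :
    MemLp ((Iio x).indicator fun t : ℝ => Complex.exp (Complex.I * k * ((x - t : ℝ) : ℂ))) 2
      halfLineMeasure ∧
    ∫ t, ‖(Iio x).indicator (fun t : ℝ => Complex.exp (Complex.I * k * ((x - t : ℝ) : ℂ))) t‖ ^ 2
      ∂halfLineMeasure ≤ 1 / k.im := by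
  have h2 : 0 < 2 * k.im := by linarith
  have hE : Integrable fun t : ℝ => Real.exp (-(2 * k.im) * |x - t|) :=
    (integrable_exp_neg_abs h2).comp_sub_left x
  have hEv : ∫ t : ℝ, Real.exp (-(2 * k.im) * |x - t|) = 1 / k.im := by
    have h3 : ∫ t : ℝ, Real.exp (-(2 * k.im) * |x - t|) = 2 / (2 * k.im) :=
      (integral_sub_left_eq_self (fun t => Real.exp (-(2 * k.im) * |t|)) volume x).trans
        (integral_exp_neg_abs h2)
    rw [h3]
    field_simp
  have hm : AEStronglyMeasurable
      ((Iio x).indicator fun t : ℝ => Complex.exp (Complex.I * k * ((x - t : ℝ) : ℂ)))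
      halfLineMeasure :=
    (Continuous.aestronglyMeasurable (by fun_prop)).indicator measurableSet_Iio
  have hle : ∀ t : ℝ, ‖(Iio x).indicator
      (fun t : ℝ => Complex.exp (Complex.I * k * ((x - t : ℝ) : ℂ))) t‖ ^ 2 ≤
      Real.exp (-(2 * k.im) * |x - t|) := by
    intro t
    by_cases ht : t < x
    · rw [indicator_of_mem (mem_Iio.2 ht), norm_exp_I_mul, ← Real.exp_nat_mul,
        abs_of_pos (sub_pos.2 ht)]
      refine Real.exp_le_exp.2 (le_of_eq ?_)
      push_cast
      ring
    · rw [indicator_of_notMem (by simpa using ht)]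
      simpa using (Real.exp_pos _).le
  refine ⟨?_, ?_⟩
  · rw [memLp_two_iff_integrable_sq_norm hm]
    refine Integrable.mono' hE.integrableOn.integrable (hm.norm.pow 2)
      (Eventually.of_forall fun t => ?_)
    rw [Real.norm_of_nonneg (by positivity)]
    exact hle t
  · rw [← hEv]
    exact (integral_mono_of_nonneg (Eventually.of_forall fun t => by positivity)
      (hE.integrableOn (s := Ioi 0)) (Eventually.of_forall hle)).trans
      (setIntegral_le_integral hE (Eventually.of_forall fun t => (Real.exp_pos _).le))

/-- The function `t ↦ e^{ik(x - t)}`, cut off at `t = x`, as an element of `L²`. -/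
def cutExp (k : ℂ) (hk : 0 < k.im) (x : ℝ) : L2 := (memLp_cutExp hk x).1.toLp _

lemma coeFn_cutExp (hk : 0 < k.im) (x : ℝ) : cutExp k hk x =ᵐ[halfLineMeasure]
    (Iio x).indicator fun t : ℝ => Complex.exp (Complex.I * k * ((x - t : ℝ) : ℂ)) :=
  MemLp.coeFn_toLp _

lemma norm_cutExp_le (hk : 0 < k.im) (x : ℝ) : ‖cutExp k hk x‖ ≤ Real.sqrt (1 / k.im) := by
  refine Real.le_sqrt_of_sq_le ?_
  rw [norm_sq_eq_integral]
  refine le_trans (le_of_eq (integral_congr_ae ?_)) (memLp_cutExp hk x).2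
  filter_upwards [coeFn_cutExp hk x] with t ht
  rw [ht]

lemma conj_exp_mul_sub (k : ℂ) (x t : ℝ) :
    starRingEnd ℂ (Complex.exp (Complex.I * -(starRingEnd ℂ k) * ((x - t : ℝ) : ℂ))) =
      Complex.exp (Complex.I * k * x) * Complex.exp (-(Complex.I * k * t)) := by
  rw [conj_exp_neg_conj, ← Complex.exp_add]
  congr 1
  push_cast
  ring

lemma inner_cutExp (hk : 0 < k.im) {x : ℝ} (hx : 0 ≤ x) (f : L2) :
    inner ℂ (cutExp _ (neg_conj_im_pos hk) x) f = Complex.exp (Complex.I * k * x) *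
      ∫ t in (0 : ℝ)..x, Complex.exp (-(Complex.I * k * t)) * (Ioi (0 : ℝ)).indicator f t := by
  rw [inner_eq_integral, setIntegral_interval_indicator
    (fun t c => Complex.exp (-(Complex.I * k * t)) * c) _ hx,
    ← intervalIntegral.integral_const_mul, intervalIntegral.integral_of_le hx,
    integral_Ioc_eq_integral_Ioo, ← Ioi_inter_Iio, ← setIntegral_indicator measurableSet_Iio]
  refine integral_congr_ae ?_
  filter_upwards [coeFn_cutExp (neg_conj_im_pos hk) x] with t ht
  rw [ht]
  by_cases htx : t < x
  · rw [indicator_of_mem (mem_Iio.2 htx), conj_exp_mul_sub, indicator_of_mem (mem_Iio.2 htx)]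
    ring
  · rw [indicator_of_notMem (by simpa using htx), indicator_of_notMem (by simpa using htx)]
    simp

lemma aestronglyMeasurable_inner_cutExp (hk : 0 < k.im) (f : L2) :
    AEStronglyMeasurable (fun x => inner ℂ (cutExp k hk x) f) halfLineMeasure := by
  have key : ∀ (κ : ℂ) (hκ : 0 < κ.im), AEStronglyMeasurable
      (fun x => inner ℂ (cutExp _ (neg_conj_im_pos hκ) x) f) halfLineMeasure := by
    intro κ hκ
    have h1 := continuous_integral_of_locallyIntegrable (locallyIntegrable_continuous_mul
      (c := fun t : ℝ => Complex.exp (-(Complex.I * κ * t))) (by fun_prop)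
      (isSource_of_memLp hκ (Lp.memLp f)).loc)
    have h2 : AEStronglyMeasurable (fun x : ℝ => Complex.exp (Complex.I * κ * x) *
        ∫ t in (0 : ℝ)..x, Complex.exp (-(Complex.I * κ * t)) * (Ioi (0 : ℝ)).indicator f t)
        halfLineMeasure := Continuous.aestronglyMeasurable (by fun_prop)
    refine h2.congr ?_
    filter_upwards [ae_restrict_mem measurableSet_Ioi] with x hx
    rw [inner_cutExp hκ (le_of_lt hx)]
  have h3 := key _ (neg_conj_im_pos hk)
  simpa using h3

/-- The factorization of the Green function. -/
lemma inner_cutExp_cutExp (hk : 0 < k.im) {x y : ℝ} (hx : 0 < x) (hy : 0 < y) :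
    inner ℂ (cutExp _ (neg_conj_im_pos hk) x) (cutExp k hk y) = greenFun k x y := by
  have hk0 : k ≠ 0 := fun h => by rw [h] at hk; simp at hk
  set m := min x y with hm
  have hm0 : 0 < m := lt_min hx hy
  have h1 : inner ℂ (cutExp _ (neg_conj_im_pos hk) x) (cutExp k hk y) =
      ∫ t in (0 : ℝ)..m, Complex.exp (Complex.I * k * x) * Complex.exp (Complex.I * k * y) *
        Complex.exp (-2 * Complex.I * k * t) := by
    rw [inner_eq_integral, intervalIntegral.integral_of_le hm0.le, integral_Ioc_eq_integral_Ioo,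
      ← Ioi_inter_Iio, ← setIntegral_indicator measurableSet_Iio]
    refine integral_congr_ae ?_
    filter_upwards [coeFn_cutExp (neg_conj_im_pos hk) x, coeFn_cutExp hk y] with t h1 h2
    rw [h1, h2]
    by_cases htx : t < x
    · by_cases hty : t < y
      · rw [indicator_of_mem (mem_Iio.2 htx), indicator_of_mem (mem_Iio.2 hty),
          indicator_of_mem (mem_Iio.2 (lt_min htx hty)), conj_exp_mul_sub, ← Complex.exp_add,
          ← Complex.exp_add, ← Complex.exp_add, ← Complex.exp_add]
        congr 1
        push_cast
        ring
      · rw [indicator_of_notMem (s := Iio y) (by simpa using hty), mul_zero,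
          indicator_of_notMem (by simp [hm, not_lt.1 hty])]
    · rw [indicator_of_notMem (s := Iio x) (by simpa using htx), map_zero, zero_mul,
        indicator_of_notMem (by simp [hm, not_lt.1 htx])]
  -- Used with m and M the smaller and the larger of x and y: the integrand e^{ik(x + y - 2t)} lives
  -- on (0, m), and integrating it produces the sine of the smaller variable.
  have h2 : ∀ m M : ℝ, Complex.exp (Complex.I * k * m) * Complex.exp (Complex.I * k * M) *
      ((Complex.exp (-2 * Complex.I * k * m) - 1) / (-2 * Complex.I * k)) =
      Complex.exp (Complex.I * k * M) * Complex.sin (k * m) / k := by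
    intro m M
    have h3 : Complex.exp (-2 * Complex.I * k * m) =
        Complex.exp (-(Complex.I * k * m)) * Complex.exp (-(Complex.I * k * m)) := by
      rw [← Complex.exp_add]
      congr 1
      ring
    have h4 : Complex.exp (Complex.I * k * m) * Complex.exp (-(Complex.I * k * m)) = 1 := by
      rw [← Complex.exp_add, add_neg_cancel, Complex.exp_zero]
    rw [h3, sin_mul_eq]
    field_simp
    linear_combination (-1 : ℂ) * Complex.exp (-(Complex.I * k * m)) * h4 +
      (Complex.exp (Complex.I * k * m) - Complex.exp (-(Complex.I * k * m))) * Complex.I_sq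
  rw [h1, intervalIntegral.integral_const_mul, integral_exp_mul_complex (by simp [hk0]),
    Complex.ofReal_zero, mul_zero, Complex.exp_zero]
  unfold greenFun
  split_ifs with h
  · have : m = y := min_eq_right h
    rw [this, mul_comm (Complex.exp (Complex.I * k * x)), h2]
  · have : m = x := min_eq_left (not_le.1 h).le
    rw [this, h2]
    ring

end HalfGreen

/-! ### The Birman–Schwinger operators and their closures. -/

section BirmanSchwinger

variable {V : ℝ → ℂ} {k : ℂ}

lemma integrable_vFactor_mul (hV : IntegrableOn V (Ioi 0)) (f : L2) :
    Integrable (fun x => vFactor V x * f x) halfLineMeasure :=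
  (memLp_vFactor hV).integrable_mul (Lp.memLp f)

/-- The Dirichlet Birman–Schwinger operator is trace class. -/
theorem exists_dirichletBS (hV : IntegrableOn V (Ioi 0)) (hk : 0 < k.im) :
    ∃ K : L2 →L[ℂ] L2, IsTraceClass K ∧ ∀ f : L2, K f =ᵐ[halfLineMeasure]
      fun x => uFactor V x * dirichletSol k (fun y => vFactor V y * f y) x := by
  have hκ := neg_conj_im_pos hk
  -- The conjugate on u and the parameter -k̄ in the first family compensate for antilinearity in
  -- the first slot: the kernel becomes u(x) G(x, y) v(y), with G the Green function.
  obtain ⟨K, hK, hKf⟩ := exists_isTraceClass_kernel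
    (fun x => starRingEnd ℂ (uFactor V x) • cutExp _ hκ x) (fun y => vFactor V y • cutExp k hk y)
    (fun x => Real.sqrt (1 / k.im) * ‖uFactor V x‖) (fun x => Real.sqrt (1 / k.im) * ‖vFactor V x‖)
    ((memLp_uFactor hV).norm.const_mul _) ((memLp_vFactor hV).norm.const_mul _)
    (fun f => by
      simp only [inner_smul_left, Complex.conj_conj]
      exact (memLp_uFactor hV).aestronglyMeasurable.mul (aestronglyMeasurable_inner_cutExp hκ f))
    (fun f => by
      simp only [inner_smul_left, conj_vFactor]
      exact (memLp_vFactor hV).aestronglyMeasurable.mul (aestronglyMeasurable_inner_cutExp hk f))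
    (fun x => by
      rw [norm_smul, RCLike.norm_conj, mul_comm]
      gcongr
      simpa using norm_cutExp_le hκ x)
    (fun x => by
      rw [norm_smul, mul_comm]
      gcongr
      exact norm_cutExp_le hk x)
  refine ⟨K, hK, fun f => ?_⟩
  filter_upwards [hKf f, ae_restrict_mem measurableSet_Ioi] with x h1 hx
  rw [h1, dirichletSol_eq (isSource_of_integrable hk (integrable_vFactor_mul hV f)) (le_of_lt hx),
    ← integral_const_mul]
  refine setIntegral_congr_fun measurableSet_Ioi fun y hy => ?_
  rw [inner_smul_left, inner_smul_right, inner_cutExp_cutExp hk hx hy, Complex.conj_conj]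
  ring

/-- A bounded operator that agrees with the Birman–Schwinger operator is its closure. -/
lemma hasBoundedClosure_birmanSchwinger (hV : IntegrableOn V (Ioi 0)) {H₀ : L2 →ₗ.[ℂ] L2} {z : ℂ}
    {R K : L2 →L[ℂ] L2} (hR : IsResolventAt H₀ z R)
    (hK : ∀ f g : L2, (g =ᵐ[halfLineMeasure] fun x => vFactor V x * f x) →
      K f =ᵐ[halfLineMeasure] fun x => uFactor V x * R g x) :
    HasBoundedClosure (birmanSchwinger H₀ V z) K := by
  refine hasBoundedClosure_of_graph ?_ fun f w hfw => ?_
  · refine (dense_mulOp_domain (memLp_vFactor hV)).mono fun f hf => ?_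
    obtain ⟨g, hg⟩ := LinearPMap.mem_domain_iff.1 hf
    refine LinearPMap.mem_domain_iff.2 ⟨K f, ?_⟩
    rw [birmanSchwinger, mem_pcomp_graph]
    refine ⟨R g, mem_pcomp_graph.2 ⟨g, hg, hR.mem_pinv_graph.2 rfl⟩, ?_⟩
    exact mem_mulOp_graph.2 (hK f g (mem_mulOp_graph.1 hg))
  · rw [birmanSchwinger, mem_pcomp_graph] at hfw
    obtain ⟨r, hr, hw⟩ := hfw
    obtain ⟨g, hg, hgr⟩ := mem_pcomp_graph.1 hr
    rw [hR.mem_pinv_graph] at hgr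
    subst hgr
    exact Lp.ext ((mem_mulOp_graph.1 hw).trans (hK f g (mem_mulOp_graph.1 hg)).symm)

lemma hasBoundedClosure_dirichletBS (hV : IntegrableOn V (Ioi 0)) (hk : 0 < k.im)
    {R K : L2 →L[ℂ] L2} (hR : ∀ f : L2, R f =ᵐ[halfLineMeasure] dirichletSol k f)
    (hK : ∀ f : L2, K f =ᵐ[halfLineMeasure]
      fun x => uFactor V x * dirichletSol k (fun y => vFactor V y * f y) x) :
    HasBoundedClosure (birmanSchwinger (opD 0) V (k ^ 2)) K := by
  refine hasBoundedClosure_birmanSchwinger hV (isResolventAt_opD_zero hk hR) fun f g hg => ?_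
  filter_upwards [hK f, hR g] with x h1 h2
  rw [h1, h2, dirichletSol_congr hg]

lemma memLp_mul_exp (hk : 0 < k.im) {w : ℝ → ℂ} (hw : MemLp w 2 halfLineMeasure) :
    MemLp (fun x : ℝ => w x * Complex.exp (Complex.I * k * x)) 2 halfLineMeasure := by
  refine hw.mono (hw.aestronglyMeasurable.mul
    (Continuous.aestronglyMeasurable (by fun_prop))) ?_
  filter_upwards [ae_restrict_mem measurableSet_Ioi] with x hx
  rw [norm_mul]
  exact mul_le_of_le_one_right (norm_nonneg _) (norm_exp_I_mul_le_one hk (le_of_lt hx))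

/-- The product of a square integrable function with `e^{ikx}`, as an element of `L²`. -/
def mulExpL2 (hk : 0 < k.im) {w : ℝ → ℂ} (hw : MemLp w 2 halfLineMeasure) : L2 :=
  (memLp_mul_exp hk hw).toLp _

lemma coeFn_mulExpL2 (hk : 0 < k.im) {w : ℝ → ℂ} (hw : MemLp w 2 halfLineMeasure) :
    mulExpL2 hk hw =ᵐ[halfLineMeasure] fun x => w x * Complex.exp (Complex.I * k * x) :=
  MemLp.coeFn_toLp _

lemma inner_mulExpL2_vFactor (hV : IntegrableOn V (Ioi 0)) (hk : 0 < k.im) (f : L2) :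
    inner ℂ (mulExpL2 (neg_conj_im_pos hk) (memLp_vFactor hV)) f =
      ∫ y in Ioi (0 : ℝ), Complex.exp (Complex.I * k * y) * (vFactor V y * f y) := by
  rw [inner_eq_integral]
  refine integral_congr_ae ?_
  filter_upwards [coeFn_mulExpL2 (neg_conj_im_pos hk) (memLp_vFactor hV)] with x hx
  rw [hx, map_mul, conj_exp_neg_conj, conj_vFactor]
  ring

/-- The rank one term separating the two free resolvents, multiplied by u on the left and v on the
right, becomes the rank one term here. -/
lemma hasBoundedClosure_neumannBS (hV : IntegrableOn V (Ioi 0)) (hk : 0 < k.im)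
    {R K : L2 →L[ℂ] L2} (hR : ∀ f : L2, R f =ᵐ[halfLineMeasure] dirichletSol k f)
    (hK : ∀ f : L2, K f =ᵐ[halfLineMeasure]
      fun x => uFactor V x * dirichletSol k (fun y => vFactor V y * f y) x) :
    HasBoundedClosure (birmanSchwinger (opN 0) V (k ^ 2))
      (K + InnerProductSpace.rankOne ℂ (mulExpL2 hk (memLp_uFactor hV))
        (starRingEnd ℂ (Complex.I / k) • mulExpL2 (neg_conj_im_pos hk) (memLp_vFactor hV))) := by
  refine hasBoundedClosure_birmanSchwinger hV (isResolventAt_opN_zero hk hR) fun f g hg => ?_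
  set a := mulExpL2 hk (memLp_uFactor hV)
  set b := mulExpL2 (neg_conj_im_pos hk) (memLp_vFactor hV) with hb
  have h1 : (K + InnerProductSpace.rankOne ℂ a (starRingEnd ℂ (Complex.I / k) • b)) f =
      K f + (Complex.I / k * inner ℂ b f) • a := by
    have : (K + InnerProductSpace.rankOne ℂ a (starRingEnd ℂ (Complex.I / k) • b)) f =
      K f + inner ℂ (starRingEnd ℂ (Complex.I / k) • b) f • a := rfl
    rw [this, inner_smul_left, Complex.conj_conj]
  have h2 : inner ℂ b f = ∫ y in Ioi (0 : ℝ), Complex.exp (Complex.I * k * y) * g y := by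
    rw [hb, inner_mulExpL2_vFactor hV hk]
    refine integral_congr_ae ?_
    filter_upwards [hg] with y hy
    rw [hy]
  rw [h1, neumannResolvent_apply, h2]
  set c := Complex.I / k * ∫ y in Ioi (0 : ℝ), Complex.exp (Complex.I * k * y) * g y
  filter_upwards [hK f, hR g, Lp.coeFn_add (K f) (c • a), Lp.coeFn_smul c a,
    coeFn_mulExpL2 hk (memLp_uFactor hV), Lp.coeFn_add (R g) (c • expL2 k hk),
    Lp.coeFn_smul c (expL2 k hk), coeFn_expL2 hk] with x h3 h4 h5 h6 h7 h8 h9 h10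
  rw [h5, Pi.add_apply, h3, h6, Pi.smul_apply, h7, h8, Pi.add_apply, h4, h9, Pi.smul_apply, h10,
    dirichletSol_congr hg, smul_eq_mul, smul_eq_mul]
  ring

end BirmanSchwinger

/-! ### Consequences of z lying in the resolvent set of H_+^D. -/

section Perturbed

variable {V : ℝ → ℂ} {z : ℂ}

/-- A point of the resolvent set of the Dirichlet operator is not an eigenvalue. -/
lemma ae_eq_zero_of_isC1AC {R : L2 →L[ℂ] L2} (hR : IsResolventAt (opD V) z R) {G G' : ℝ → ℂ}
    (hG : IsC1AC G G' fun x => (V x - z) * G x) (hG2 : MemLp G 2 halfLineMeasure) (h0 : G 0 = 0) :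
    G =ᵐ[halfLineMeasure] 0 := by
  have hp := MemLp.coeFn_toLp hG2
  have h1 : (hG2.toLp G, z • hG2.toLp G) ∈ (opD V).graph := by
    rw [opD, schrodingerOp_graph]
    refine ⟨G, G', _, ⟨hp, hG.hasDeriv, hG.ac, hG.ac', hG.hasDeriv', ?_⟩, by simp [h0]⟩
    filter_upwards [hp, Lp.coeFn_smul z (hG2.toLp G)] with x h2 h3
    rw [h3, Pi.smul_apply, h2, smul_eq_mul]
    ring
  have h2 := hR.eq_of_mem_graph h1
  rw [sub_self, map_zero] at h2
  exact hp.symm.trans (h2 ▸ Lp.coeFn_zero ℂ 2 halfLineMeasure)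

lemma isC1AC_dirichletSol {k : ℂ} (hk : k ≠ 0) {q : ℝ → ℂ} (hq : IsSource k q) :
    ∃ P', IsC1AC (dirichletSol k q) P' (fun x => -q x - k ^ 2 * dirichletSol k q x) := by
  refine ⟨_, (isC1AC_inhomSol hk hq.loc.neg _ _).congr_ae ?_⟩
  filter_upwards [ae_restrict_mem measurableSet_Ioi] with x hx
  rw [Pi.neg_apply, indicator_of_mem hx]
  rfl

/-- Injectivity of `I + K` for the Dirichlet Birman–Schwinger operator `K`. -/
lemma dirichletBS_injective (hV : IntegrableOn V (Ioi 0)) (hk : 0 < (sqrtUp z).im)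
    {R K : L2 →L[ℂ] L2} (hR : IsResolventAt (opD V) z R)
    (hK : ∀ f : L2, K f =ᵐ[halfLineMeasure]
      fun x => uFactor V x * dirichletSol (sqrtUp z) (fun y => vFactor V y * f y) x)
    (g : L2) (hg : g + K g = 0) : g = 0 := by
  have hk0 : sqrtUp z ≠ 0 := fun h => by rw [h] at hk; simp at hk
  have hq := integrable_vFactor_mul hV g
  -- The equation says g = -uP, hence -P'' - zP = vg = -VP. Thus P solves the perturbed equation
  -- with P(0) = 0, and it lies in L² although vg is only in L¹.
  set P := dirichletSol (sqrtUp z) (fun y => vFactor V y * g y) with hP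
  obtain ⟨P', hPC⟩ := isC1AC_dirichletSol hk0 (isSource_of_integrable hk hq)
  have h1 : g =ᵐ[halfLineMeasure] fun x => -(uFactor V x * P x) := by
    have : g = -K g := eq_neg_of_add_eq_zero_left hg
    rw [this]
    filter_upwards [Lp.coeFn_neg (K g), hK g] with x h2 h3
    rw [h2, Pi.neg_apply, h3]
  have h2 : IsC1AC P P' fun x => (V x - z) * P x := by
    refine hPC.congr_ae ?_
    filter_upwards [h1] with x hx
    rw [hx, sqrtUp_sq, ← uFactor_mul_vFactor V x]
    ring
  have h3 := ae_eq_zero_of_isC1AC hR h2 (memLp_dirichletSol_of_integrable hk hq)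
    (inhomSol_zero _ _ _ _)
  refine Lp.ext ?_
  filter_upwards [h1, h3, Lp.coeFn_zero ℂ 2 halfLineMeasure] with x h4 h5 h6
  rw [h4, h5, h6]
  simp

/-- The Jost solution does not vanish at the origin on the resolvent set of the Dirichlet
operator. -/
lemma jost_zero_ne_zero {R : L2 →L[ℂ] L2} (hR : IsResolventAt (opD V) z R) {f f' : ℝ → ℂ}
    (hf : IsJostSolution V z f) (hfC : IsC1AC f f' fun x => (V x - z) * f x)
    (hf2 : MemLp f 2 halfLineMeasure) : f 0 ≠ 0 := by
  intro h0
  have h1 := eqOn_zero_of_ae hf.1 (ae_eq_zero_of_isC1AC hR hfC hf2 h0)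
  -- If f vanishes identically, the Jost equation at 0 reads 0 = 1.
  have h2 := (hf.2 0 le_rfl).2
  rw [h0, setIntegral_congr_fun (g := fun _ => (0 : ℂ)) measurableSet_Ioi fun y hy => by
    simp only [h1 (mem_Ici.2 (le_of_lt (mem_Ioi.1 hy))), Pi.zero_apply, mul_zero]] at h2
  simp at h2

lemma dirichletSol_mul_const {k : ℂ} {q : ℝ → ℂ} (hq : IsSource k q) (c : ℂ) {x : ℝ} (hx : 0 ≤ x) :
    dirichletSol k (fun y => q y * c) x = dirichletSol k q x * c := by
  have hq' : IsSource k fun y => q y * c := by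
    refine ⟨?_, ?_⟩
    · have h1 : (Ioi (0 : ℝ)).indicator (fun y => q y * c) = fun y =>
          c * (Ioi (0 : ℝ)).indicator q y := by
        funext y
        unfold indicator
        split_ifs <;> simp [mul_comm]
      rw [h1]
      exact locallyIntegrable_continuous_mul continuous_const hq.loc
    · simp only [← mul_assoc]
      exact hq.int.mul_const c
  rw [dirichletSol_eq hq' hx, dirichletSol_eq hq hx, ← integral_mul_const]
  simp only [mul_assoc]

/-- The Lippmann–Schwinger equation for the Jost solution. -/
lemma dirichletSol_add_jost {k : ℂ} (hk : k ≠ 0) {f W : ℝ → ℂ} {a b : ℂ}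
    (hf : EqOn f (inhomSol k a b ((Ioi (0 : ℝ)).indicator W)) (Ici 0))
    (hb : b = Complex.I * k * a - ∫ y in Ioi (0 : ℝ), Complex.exp (Complex.I * k * y) * W y)
    {x : ℝ} (hx : 0 ≤ x) :
    dirichletSol k W x + f x = a * Complex.exp (Complex.I * k * x) := by
  rw [hf hx, dirichletSol, inhomSol, inhomSol, hb, exp_I_mul_eq]
  simp only [mul_neg, intervalIntegral.integral_neg]
  field_simp
  ring

lemma memLp_mul_of_bounded {w f : ℝ → ℂ} (hw : MemLp w 2 halfLineMeasure)
    (hf : ContinuousOn f (Ici 0)) {C : ℝ} (hC : ∀ x, 0 ≤ x → ‖f x‖ ≤ C) :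
    MemLp (fun x => w x * f x) 2 halfLineMeasure := by
  refine hw.of_le_mul (c := C) (hw.aestronglyMeasurable.mul
    ((hf.mono Ioi_subset_Ici_self).aestronglyMeasurable measurableSet_Ioi)) ?_
  filter_upwards [ae_restrict_mem measurableSet_Ioi] with x hx
  rw [norm_mul, mul_comm]
  gcongr
  exact hC x (le_of_lt hx)

/-- The Neumann trace of the Dirichlet resolvent in terms of the Jost solution. -/
lemma neumannTrace_resolvent {R : L2 →L[ℂ] L2} (hR : IsResolventAt (opD V) z R) {f f' : ℝ → ℂ}
    (hfC : IsC1AC f f' fun x => (V x - z) * f x) (hf2 : MemLp f 2 halfLineMeasure)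
    (hf2' : MemLp f' 2 halfLineMeasure) (hf0 : f 0 ≠ 0) (g : L2) {w : ℂ} :
    (R g, w) ∈ traceN.graph ↔ w = -(∫ x, f x * g x ∂halfLineMeasure) / f 0 := by
  have h1 := hR.mem_graph g
  rw [opD, schrodingerOp_graph] at h1
  obtain ⟨G, G', G'', hG, hbc⟩ := h1
  have hG0 : G 0 = 0 := by simpa using hbc
  rw [mem_traceN_graph hG.eq_left hG.isC1AC]
  -- Lagrange's identity: fG'' - f''G = -fg, and because G(0) = 0 the boundary term is f(0) G'(0).
  have h2 := wronskian_zero_add_integral hfC hG.isC1AC hf2 hf2'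
    ((memLp_congr_ae hG.eq_left).1 (Lp.memLp (R g))) (w := fun x => -(f x * g x))
    (hf2.integrable_mul (Lp.memLp g)).neg (by
      filter_upwards [hG.eq_left, hG.eq_right, Lp.coeFn_add g (z • R g), Lp.coeFn_smul z (R g)]
        with x h3 h4 h5 h6
      rw [h5, Pi.add_apply, h6, Pi.smul_apply, h3, smul_eq_mul] at h4
      linear_combination f x * h4)
  rw [hG0, mul_zero, sub_zero, integral_neg] at h2
  have h3 : -G' 0 = -(∫ x, f x * g x ∂halfLineMeasure) / f 0 := by
    rw [eq_div_iff hf0]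
    linear_combination -h2
  rw [h3]

/-- The closure of the Neumann trace of the Dirichlet resolvent, composed with multiplication by
`u`, is a bounded functional. -/
lemma exists_neumannFunctional_eq (hV : IntegrableOn V (Ioi 0)) {R : L2 →L[ℂ] L2}
    (hR : IsResolventAt (opD V) z R) {f f' : ℝ → ℂ}
    (hfC : IsC1AC f f' fun x => (V x - z) * f x) (hf2 : MemLp f 2 halfLineMeasure)
    (hf2' : MemLp f' 2 halfLineMeasure) (hf0 : f 0 ≠ 0) {C : ℝ} (hC : ∀ x, 0 ≤ x → ‖f x‖ ≤ C) :
    ∃ N : L2 →L[ℂ] ℂ, neumannFunctional V z = (N : L2 →ₗ[ℂ] ℂ).toPMap ⊤ ∧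
      ∀ g, N g = -(∫ x, f x * (uFactor V x * g x) ∂halfLineMeasure) / f 0 := by
  have hm : MemLp (star fun x => uFactor V x * f x) 2 halfLineMeasure :=
    (memLp_mul_of_bounded (memLp_uFactor hV) hfC.continuousOn hC).star
  set N : L2 →L[ℂ] ℂ := (-(f 0)⁻¹) • innerSL ℂ (hm.toLp _) with hN
  have hNf : ∀ g, N g = -(∫ x, f x * (uFactor V x * g x) ∂halfLineMeasure) / f 0 := by
    intro g
    have h1 : N g = -(f 0)⁻¹ * inner ℂ (hm.toLp _) g := rfl
    have h2 : inner ℂ (hm.toLp _) g = ∫ x, f x * (uFactor V x * g x) ∂halfLineMeasure := by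
      rw [inner_eq_integral]
      refine integral_congr_ae ?_
      filter_upwards [hm.coeFn_toLp] with x hx
      rw [hx, Pi.star_apply, RCLike.star_def, Complex.conj_conj]
      ring
    rw [h1, h2]
    ring
  have hint : ∀ g g₁ : L2, (g, g₁) ∈ (mulOp (uFactor V)).graph →
      -(∫ x, f x * g₁ x ∂halfLineMeasure) / f 0 = N g := by
    intro g g₁ hg
    rw [hNf]
    congr 2
    refine integral_congr_ae ?_
    filter_upwards [mem_mulOp_graph.1 hg] with x hx
    rw [hx]
  refine ⟨N, hasBoundedClosure_of_graph ?_ fun g w hgw => ?_, hNf⟩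
  · refine (dense_mulOp_domain (memLp_uFactor hV)).mono fun g hg => ?_
    obtain ⟨g₁, hg₁⟩ := LinearPMap.mem_domain_iff.1 hg
    exact LinearPMap.mem_domain_iff.2 ⟨_, mem_pcomp_graph.2 ⟨R g₁, mem_pcomp_graph.2
      ⟨g₁, hg₁, hR.mem_pinv_graph.2 rfl⟩,
      (neumannTrace_resolvent hR hfC hf2 hf2' hf0 g₁).2 rfl⟩⟩
  · obtain ⟨r, hr, hw⟩ := mem_pcomp_graph.1 hgw
    obtain ⟨g₁, hg₁, hgr⟩ := mem_pcomp_graph.1 hr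
    rw [hR.mem_pinv_graph] at hgr
    subst hgr
    rw [(neumannTrace_resolvent hR hfC hf2 hf2' hf0 g₁).1 hw]
    exact hint g g₁ hg₁

lemma adjoint_innerSL_one (a : L2) : ContinuousLinearMap.adjoint (innerSL ℂ a) (1 : ℂ) = a := by
  refine ext_inner_right ℂ fun x => ?_
  rw [ContinuousLinearMap.adjoint_inner_left, innerSL_apply_apply]
  simp

/-- The value of the boundary operator in terms of the Jost solution. -/
lemma boundaryOp_one (hV : IntegrableOn V (Ioi 0)) (hk : 0 < (sqrtUp z).im) {R : L2 →L[ℂ] L2}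
    (hR : IsResolventAt (opD V) z R) {f f' : ℝ → ℂ}
    (hfC : IsC1AC f f' fun x => (V x - z) * f x) (hf2 : MemLp f 2 halfLineMeasure)
    (hf2' : MemLp f' 2 halfLineMeasure) (hf0 : f 0 ≠ 0) {C : ℝ} (hC : ∀ x, 0 ≤ x → ‖f x‖ ≤ C) :
    ((1 : ℂ), -(Complex.I / sqrtUp z * ∫ y in Ioi (0 : ℝ),
      Complex.exp (Complex.I * sqrtUp z * y) * (V y * f y)) / f 0) ∈ (boundaryOp V z).graph := by
  obtain ⟨N, hN, hNf⟩ := exists_neumannFunctional_eq hV hR hfC hf2 hf2' hf0 hC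
  set k := sqrtUp z with hkdef
  set m := (Complex.I / k) • mulExpL2 hk (memLp_vFactor hV) with hm
  have hma : m =ᵐ[halfLineMeasure]
      fun x => Complex.I / k * (vFactor V x * Complex.exp (Complex.I * k * x)) := by
    filter_upwards [Lp.coeFn_smul (Complex.I / k) (mulExpL2 hk (memLp_vFactor hV)),
      coeFn_mulExpL2 hk (memLp_vFactor hV)] with x h1 h2
    rw [h1, Pi.smul_apply, h2, smul_eq_mul]
  rw [boundaryOp, mem_pcomp_graph]
  refine ⟨m, mem_pcomp_graph.2 ⟨(Complex.I / k) • expL2 k hk, ?_, ?_⟩, ?_⟩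
  · rw [dirichletAdjoint_eq hk, mem_toPMap_top_graph, adjoint_innerSL_one]
  · rw [mem_mulOp_graph]
    filter_upwards [hma, Lp.coeFn_smul (Complex.I / k) (expL2 k hk), coeFn_expL2 hk]
      with x h1 h2 h3
    rw [h1, h2, Pi.smul_apply, h3, smul_eq_mul]
    ring
  · rw [hN, mem_toPMap_top_graph, hNf, ← integral_const_mul]
    congr 2
    refine integral_congr_ae ?_
    filter_upwards [hma] with x hx
    rw [hx, ← uFactor_mul_vFactor V x]
    ring

end Perturbed

end HalfLine

end

/-! ### The chain of equalities. -/

open HalfLine in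
theorem theorem6p4 (V : ℝ → ℂ) (hV : IntegrableOn V (Ioi 0)) (z : ℂ)
    (hz : z ∉ opSpectrum (opD V)) (hIm : 0 < (sqrtUp z).im) :
    -- the free resolvents and the solutions that enter are well defined
    (z ∈ resolventSet (opD 0) ∧ z ∈ resolventSet (opN 0) ∧
      starRingEnd ℂ z ∈ resolventSet (opN 0)) ∧
    (IsJostSolution V z (jost V z) ∧ IsVolterraSolution V z (freeSin z) (phiD V z) ∧
      IsVolterraSolution V z (freeCos z) (thetaD V z)) ∧
    -- the closures of the Birman-Schwinger operators are trace class, with determinants dN, dD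
    ∃ (KN KD : L2 →L[ℂ] L2) (dN dD : ℂ),
      HasBoundedClosure (birmanSchwinger (opN 0) V z) KN ∧ IsTraceClass KN ∧
        HasFredholmDet KN dN ∧
      HasBoundedClosure (birmanSchwinger (opD 0) V z) KD ∧ IsTraceClass KD ∧
        HasFredholmDet KD dD ∧
      dD ≠ 0 ∧ jost V z 0 ≠ 0 ∧
      -- the chain of equalities
      (∀ x : ℝ, 0 ≤ x → wronskian (jost V z) (phiD V z) x ≠ 0 ∧
        dN / dD = wronskian (jost V z) (phiN V z) x /
          (Complex.I * sqrtUp z * wronskian (jost V z) (phiD V z) x)) ∧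
      dN / dD = deriv₀ (jost V z) 0 / (Complex.I * sqrtUp z * jost V z 0) ∧
      dN / dD = mD V z / m0D z ∧
      dN / dD = m0N z / mN V z ∧
      ∃ h : (1 : ℂ) ∈ (boundaryOp V z).domain, dN / dD = 1 - boundaryOp V z ⟨1, h⟩ := by
  obtain ⟨RV, hRV⟩ : ∃ R, IsResolventAt (opD V) z R := not_not.1 hz
  have hJ := jost_isJostSolution hV hIm
  obtain ⟨f', hfC, hf2, hf2', ⟨C, hC⟩, hfeq, hfint, hf'0⟩ := hJ.exists_deriv hV hIm
  obtain ⟨φ', hφC, hφ0, hφ'0⟩ := exists_phiD_deriv hV hIm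
  obtain ⟨θ', hθC, hθ0, hθ'0⟩ := exists_phiN_deriv hV hIm
  have hf0 := jost_zero_ne_zero hRV hJ hfC hf2
  have hB := boundaryOp_one hV hIm hRV hfC hf2 hf2' hf0 hC
  have hd0 : deriv₀ (jost V z) 0 = f' 0 := hfC.deriv₀ le_rfl
  set f := jost V z with hf
  set k := sqrtUp z with hk
  have hk0 : k ≠ 0 := fun h => by rw [h] at hIm; simp at hIm
  have hz2 : z = k ^ 2 := (sqrtUp_sq z).symm
  set c := ∫ y in Ioi (0 : ℝ), Complex.exp (Complex.I * k * y) * (V y * f y) with hc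
  have hWs : IsSource k fun y => V y * f y := ⟨locallyIntegrable_indicator_mul hV hJ.1, hfint⟩
  obtain ⟨R, hR⟩ := exists_greenOperator hIm
  obtain ⟨R', hR'⟩ := exists_greenOperator (neg_conj_im_pos hIm)
  obtain ⟨KD, hKD, hKDf⟩ := exists_dirichletBS hV hIm
  set a := mulExpL2 hIm (memLp_uFactor hV) with ha
  set b := starRingEnd ℂ (Complex.I / k) • mulExpL2 (neg_conj_im_pos hIm) (memLp_vFactor hV) with hb
  have hm : MemLp (fun x => uFactor V x * f x * (f 0)⁻¹) 2 halfLineMeasure :=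
    (memLp_mul_of_bounded (memLp_uFactor hV) hJ.1 hC).mul_const _
  -- The solution of (I + K)h = a, obtained by multiplying the Lippmann–Schwinger equation for f by
  -- u and dividing by f(0).
  set h := hm.toLp _ with hh
  have hha : h =ᵐ[halfLineMeasure] fun x => uFactor V x * f x * (f 0)⁻¹ := hm.coeFn_toLp
  have hvh : (fun y => vFactor V y * h y) =ᵐ[halfLineMeasure] fun y => V y * f y * (f 0)⁻¹ := by
    filter_upwards [hha] with x hx
    rw [hx, ← uFactor_mul_vFactor V x]
    ring
  have hheq : h + KD h = a := by
    refine Lp.ext ?_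
    filter_upwards [Lp.coeFn_add h (KD h), hha, hKDf h, coeFn_mulExpL2 hIm (memLp_uFactor hV),
      ae_restrict_mem measurableSet_Ioi] with x h1 h2 h3 h4 hx
    have h5 := dirichletSol_add_jost hk0 hfeq hf'0 (le_of_lt (mem_Ioi.1 hx))
    rw [h1, Pi.add_apply, h2, h3, dirichletSol_congr hvh,
      dirichletSol_mul_const hWs _ (le_of_lt (mem_Ioi.1 hx)), h4]
    field_simp
    linear_combination uFactor V x * h5
  obtain ⟨dD, dN, hdD, hdN, hdD0, hdiv⟩ := exists_hasFredholmDet_add_rankOne hKD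
    (dirichletBS_injective hV hIm hRV hKDf) a b h hheq
  have hinner : inner ℂ b h = Complex.I / k * c * (f 0)⁻¹ := by
    rw [hb, inner_smul_left, Complex.conj_conj, inner_mulExpL2_vFactor hV hIm, mul_assoc]
    congr 1
    rw [hc, ← integral_mul_const]
    refine integral_congr_ae ?_
    filter_upwards [hvh] with x hx
    rw [hx]
    ring
  have hI : Complex.I * k ≠ 0 := mul_ne_zero Complex.I_ne_zero hk0
  have hratio : dN / dD = f' 0 / (Complex.I * k * f 0) := by
    rw [hdiv, hinner, hf'0]
    field_simp
    linear_combination c * Complex.I_sq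
  refine ⟨⟨?_, ?_, ?_⟩, ⟨hJ, phiD_isVolterraSolution hV hIm, thetaD_isVolterraSolution hV hIm⟩,
    _, KD, dN, dD, ?_, isTraceClass_add_rankOne hKD a b, hdN, ?_, hKD, hdD, hdD0, hf0, ?_, ?_, ?_,
    ?_, ?_⟩
  · rw [hz2]
    exact ⟨R, isResolventAt_opD_zero hIm hR⟩
  · rw [hz2]
    exact ⟨_, isResolventAt_opN_zero hIm hR⟩
  · have : starRingEnd ℂ z = (-(starRingEnd ℂ k)) ^ 2 := by rw [neg_sq, ← map_pow, ← hz2]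
    rw [this]
    exact ⟨_, isResolventAt_opN_zero (neg_conj_im_pos hIm) hR'⟩
  · have := hasBoundedClosure_neumannBS hV hIm hR hKDf
    rwa [← hz2] at this
  · have := hasBoundedClosure_dirichletBS hV hIm hR hKDf
    rwa [← hz2] at this
  · intro x hx
    rw [wronskian_eq_of_isC1AC hfC hφC hx, wronskian_eq_of_isC1AC hfC hθC hx, hφ0, hφ'0, hθ0, hθ'0,
      hratio]
    simp [hf0]
  · rw [hratio, hd0]
  · rw [hratio, mD, m0D, hd0, ← hf, ← hk]
    field_simp
  · rw [hratio, m0N, mN, m0D, hd0, ← hf, ← hk]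
    -- At a pole of m_+^N division by zero returns 0 for m_+^N and again for the quotient, which
    -- matches the vanishing of f'(0).
    rcases eq_or_ne (f' 0) 0 with h0 | h0
    · simp [h0]
    · field_simp
  · obtain ⟨⟨_, hdom⟩, rfl, hval⟩ := (LinearPMap.mem_graph_iff _).1 hB
    refine ⟨hdom, ?_⟩
    rw [hval, hdiv, hinner]
    ring
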